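/- Let $0\le k\le n$ be integers and let $G(n,k)$ be the Grassmannian of $k$-dimensional linear subspaces of Euclidean space $\mathbb R^n$. Equip $O_m(\mathbb R)$, for each $m\ge 0$, with the Riemannian metric induced by its embedding in the space of real $m\times m$ matrices with inner product $\langle X,Y\rangle=\operatorname{tr}(X^{T}Y)$, and equip $G(n,k)$ with the Riemannian metric induced from $O_n(\mathbb R)$ as the homogeneous space $O_n(\mathbb R)/(O_k(\mathbb R)\times O_{n-k}(\mathbb R))$; write $dO_n(\mathbb R)$ and $dG(n,k)$ for the corresponding Riemannian volume measures and $\mathrm{vol}\,O_m(\mathbb R)$ for the total volume of $O_m(\mathbb R)$ (so $\mathrm{vol}\,O_0(\mathbb R)=1$ and $\mathrm{vol}\,O_1(\mathbb R)=2$). For $M\in GL_n(\mathbb R)$ and $g\in G(n,k)$ let $M_\#g\in G(n,k)$ be the image of $g$ under $M$, and let $|\det M|_g|$ be the absolute value of the determinant of the restriction $M|_g\colon g\to M_\#g$ with respect to orthonormal bases of $g$ and $M_\#g$. Let $\log^+x=\max\{\log x,0\}$, and put $$c_{n,k}=\frac{\mathrm{vol}\,O_k(\mathbb R)\cdot\mathrm{vol}\,O_{n-k}(\mathbb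 R)}{\binom nk}.$$ Then for every $A\in GL_n(\mathbb R)$ both integrands below are integrable, and $$\int_{U\in O_n(\mathbb R)}\Bigl[\sup_{g\in G(n,k):\,(UA)_\#g=g}\log^+\bigl|\det (UA)|_g\bigr|\Bigr]\,dO_n(\mathbb R)\ \ge\ c_{n,k}\int_{g\in G(n,k)}\log^+\bigl|\det A|_g\bigr|\,dG(n,k),$$ where the supremum is taken to be $0$ if no $g\in G(n,k)$ satisfies $(UA)_\#g=g$. -/

import Mathlib

open MeasureTheory

noncomputable section

section Frobenius

/- Real matrices carry the inner product `⟨X, Y⟩ = tr (Xᵀ Y)`, whose norm is the Frobenius norm. -/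
attribute [local instance] Matrix.frobeniusNormedAddCommGroup

/-- The metric on `O_n(ℝ)` inherited from its embedding in the Euclidean space of `n × n` real
matrices with the inner product `tr (Xᵀ Y)`. -/
instance orthogonalMetric (n : ℕ) : MetricSpace (Matrix.orthogonalGroup (Fin n) ℝ) :=
  Subtype.metricSpace

instance orthogonalMeasurableSpace (n : ℕ) :
    MeasurableSpace (Matrix.orthogonalGroup (Fin n) ℝ) := borel _

instance orthogonalBorelSpace (n : ℕ) : BorelSpace (Matrix.orthogonalGroup (Fin n) ℝ) := ⟨rfl⟩

/-- The same fact, for the topology of `orthogonalMetric` (definitionally the usual topology). -/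
instance orthogonalBorelSpaceMetric (n : ℕ) :
    @BorelSpace (Matrix.orthogonalGroup (Fin n) ℝ)
      (orthogonalMetric n).toPseudoMetricSpace.toUniformSpace.toTopologicalSpace _ := ⟨rfl⟩

/-- The Grassmannian of `k`-dimensional linear subspaces of Euclidean `n`-space. -/
@[ext]
structure Grass (n k : ℕ) where
  /-- the underlying linear subspace -/
  space : Submodule ℝ (EuclideanSpace ℝ (Fin n))
  finrank_eq : Module.finrank ℝ space = k

/-- The matrix (in the standard basis) of the orthogonal projection onto `g`. -/
def projMatrix {n k : ℕ} (g : Grass n k) : Matrix (Fin n) (Fin n) ℝ :=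
  Matrix.toEuclideanLin.symm (g.space.starProjection : _ →ₗ[ℝ] _)

theorem projMatrix_injective (n k : ℕ) :
    Function.Injective (projMatrix : Grass n k → Matrix (Fin n) (Fin n) ℝ) := by
  intro g h hgh
  have h1 := Matrix.toEuclideanLin.symm.injective hgh
  exact Grass.ext (Submodule.starProjection_inj.1 (ContinuousLinearMap.coe_injective h1))

/-- The metric on the Grassmannian inherited from its embedding `g ↦ P_g` (orthogonal projection)
in the Euclidean space of matrices with inner product `tr (Xᵀ Y)`.

The Riemannian structure it induces is the one of the homogeneous space `O_n / (O_k × O_{n-k})`: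
the orbit map `U ↦ P_{U g} = U P_g Uᵀ` has differential `X ↦ X P_g - P_g X` at the identity, which
vanishes on the block-diagonal skew matrices (the Lie algebra of the stabilizer of `g`), and sends
the orthogonal complement of these, the skew matrices with blocks `0, -Bᵀ, B, 0`, isometrically to
the symmetric matrices with blocks `0, Bᵀ, B, 0`.  So the orbit map is a Riemannian submersion. -/
instance grassMetric (n k : ℕ) : MetricSpace (Grass n k) :=
  MetricSpace.induced projMatrix (projMatrix_injective n k) inferInstance

instance grassMeasurableSpace (n k : ℕ) : MeasurableSpace (Grass n k) := borel _

instance grassBorelSpace (n k : ℕ) : BorelSpace (Grass n k) := ⟨rfl⟩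

end Frobenius

/-- The Riemannian volume measure of `O_n(ℝ)`, as the Hausdorff measure of dimension
`dim O_n = n (n - 1) / 2`, normalized so as to agree with Lebesgue measure on Euclidean space. -/
def orthogonalVolume (n : ℕ) : Measure (Matrix.orthogonalGroup (Fin n) ℝ) :=
  μHE[n * (n - 1) / 2]

/-- The Riemannian volume measure of the Grassmannian, as the Hausdorff measure of dimension
`dim G(n, k) = k (n - k)`, normalized so as to agree with Lebesgue measure on Euclidean space. -/
def grassVolume (n k : ℕ) : Measure (Grass n k) :=
  μHE[k * (n - k)]

/-- The constant `c_{n,k} = vol O_k · vol O_{n-k} / (n choose k)`. -/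
def cConst (n k : ℕ) : ℝ :=
  (orthogonalVolume k).real Set.univ * (orthogonalVolume (n - k)).real Set.univ / (n.choose k : ℝ)

/-- `|det M|_g|`: the absolute value of the determinant of `M : g → M g` in orthonormal bases
of `g` and of its image. -/
def absDetOn {n k : ℕ} (M : Matrix (Fin n) (Fin n) ℝ) (g : Grass n k) : ℝ :=
  ((Matrix.toEuclideanLin M).comp g.space.subtype).normDet

/-- The `k`-planes `g` with `M_# g = g`. -/
def fixedPlanes {n : ℕ} (k : ℕ) (M : Matrix (Fin n) (Fin n) ℝ) : Set (Grass n k) :=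
  {g | g.space.map (Matrix.toEuclideanLin M) = g.space}

/-- `sup {log⁺ |det M|_g| : g a k-plane with M_# g = g}`, which is `0` if there is no such `g`. -/
def supFixed {n : ℕ} (k : ℕ) (M : Matrix (Fin n) (Fin n) ℝ) : ℝ :=
  ⨆ g : fixedPlanes k M, Real.posLog (absDetOn M g.1)

end

/-! Write n = k + m and let g₀ be the plane of the first k coordinates. The proof double counts
pairs (U, V) of orthogonal matrices such that U A has a nondegenerate fixed plane in the chart ball
of radius δ around V g₀, each pair weighted by log⁺ |det A| at V g₀ less a small ε.

Fix U. A fixed plane is nondegenerate when the restriction of U A to it and the induced map on the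
complement share no eigenvalue. Such a plane is the kernel of p(U A), where p is the characteristic
polynomial of the restriction. It is thus determined by k of the n complex eigenvalues, so there are
at most n choose k of them (`goodPlanes_finite_ncard_le`). As U does not change |det A|_g|, each
accounts for at most the supremum at U times the volume of the V whose δ-ball contains it
(`lintegral_goodPairs_le`).

Fix V. Translations reduce to the case V = 1 and A g₀ = g₀. Near the stabilizer of g₀, write U =
(rotation with small off-diagonal generator y) * (h₁, h₂), and let a, d be the diagonal blocks of
(h₁, h₂) A. By the implicit function theorem a fixed plane with coordinate x corresponds to first
order to y = x - d x a⁻¹. So the U with a fixed plane near g₀ have density at least the average over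
O_k × O_m of |det (1 - a⁻ᵀ ⊗ d)|. This average is at least 1 (`measure_univ_le_lintegral_abs_det`):
polar decomposition and a sign change reduce it to the average of det (1 + ρ(h) RᵀR), a positive
definite function of h by Cauchy-Binet, whose average is a sum of squares one part of which already
gives 1.

Fatou's lemma as δ → 0 gives `lintegral_posLog_planeOf_le`, an inequality with the integral over V
in O_n. The comparison vol G · vol O_k · vol O_m ≤ vol O_n (`grassVolume_mul_fibreVolume_le`) passes
to the integral over the Grassmannian. Volumes being Hausdorff measures, all local computations use
Cayley charts that are almost isometric near the origin, together with invariance under isometries.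
-/

noncomputable section

/-! ### Averages of determinants over compact groups -/

section DeterminantAverage

open Matrix

/-- A Cauchy-Binet formula summing over all (not only injective) selections of rows. -/
theorem sum_det_submatrix_mul_det_submatrix {ι κ : Type*} [Fintype ι] [DecidableEq ι] [Fintype κ]
    (M N : Matrix κ ι ℝ) :
    ∑ f : ι → κ, (M.submatrix f id).det * (N.submatrix f id).det =
      (Fintype.card ι).factorial * (Mᵀ * N).det := by
  classical
  -- Every term σ of the Leibniz expansion of the first minor contributes the same amount: the sign
  -- of σ cancels the sign from permuting the rows of `Mᵀ * N`. This produces the factorial.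
  have h1 : ∀ σ : Equiv.Perm ι, ∑ f : ι → κ,
      (Equiv.Perm.sign σ : ℤ) * (∏ i, M (f i) (σ i)) * (N.submatrix f id).det
      = (Mᵀ * N).det := by
    intro σ
    have h2 : ∀ f : ι → κ, (Equiv.Perm.sign σ : ℤ) * (∏ i, M (f i) (σ i)) * (N.submatrix f id).det
        = ∑ τ : Equiv.Perm ι, (Equiv.Perm.sign σ : ℤ) * (Equiv.Perm.sign τ : ℤ) *
            ∏ i, (M (f i) (σ i) * N (f i) (τ i)) := by
      intro f
      rw [← det_transpose (N.submatrix f id), det_apply', Finset.mul_sum]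
      refine Finset.sum_congr rfl fun τ _ => ?_
      rw [Finset.prod_mul_distrib]
      simp only [transpose_apply, submatrix_apply, id]
      ring
    simp_rw [h2]
    rw [Finset.sum_comm]
    have h3 : ∀ τ : Equiv.Perm ι, ∑ f : ι → κ, ((Equiv.Perm.sign σ : ℤ) : ℝ) *
        (Equiv.Perm.sign τ : ℤ) * ∏ i, (M (f i) (σ i) * N (f i) (τ i)) =
        ((Equiv.Perm.sign σ : ℤ) : ℝ) * (Equiv.Perm.sign τ : ℤ) *
          ∏ i, (Mᵀ * N) (σ i) (τ i) := by
      intro τ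
      rw [← Finset.mul_sum]
      congr 1
      simp only [mul_apply, transpose_apply]
      rw [Finset.prod_univ_sum]
      simp
    simp_rw [h3]
    have h4 : ((Equiv.Perm.sign σ : ℤ) : ℝ) * ((Mᵀ * N).submatrix σ id).det = (Mᵀ * N).det := by
      rw [det_permute]
      rw [← mul_assoc]
      rcases Int.units_eq_one_or (Equiv.Perm.sign σ) with h | h <;> simp [h]
    rw [← h4, ← det_transpose ((Mᵀ * N).submatrix σ id), det_apply', Finset.mul_sum]
    refine Finset.sum_congr rfl fun τ _ => ?_
    simp only [transpose_apply, submatrix_apply, id]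
    ring
  have h5 : ∀ f : ι → κ, (M.submatrix f id).det * (N.submatrix f id).det =
      ∑ σ : Equiv.Perm ι, (Equiv.Perm.sign σ : ℤ) * (∏ i, M (f i) (σ i)) *
        (N.submatrix f id).det := by
    intro f
    rw [← det_transpose (M.submatrix f id), det_apply', Finset.sum_mul]
    rfl
  simp_rw [h5]
  rw [Finset.sum_comm]
  simp_rw [h1]
  simp [Fintype.card_perm]

/-- Averages of `det (1 + ρ(h) RᵀR)` over a compact group of orthogonal matrices are at least `1`. -/
theorem measure_univ_le_integral_det_one_add {G ι : Type*} [Group G] [TopologicalSpace G]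
    [CompactSpace G] [MeasurableSpace G] [OpensMeasurableSpace G] [MeasurableMul G]
    [Fintype ι] [DecidableEq ι]
    (μ : Measure G) [IsFiniteMeasure μ] [μ.IsMulLeftInvariant]
    (ρ : G → Matrix ι ι ℝ) (hc : Continuous ρ)
    (hρ : ∀ v w, ρ (v⁻¹ * w) = (ρ v)ᵀ * ρ w) (R : Matrix ι ι ℝ) :
    μ.real Set.univ ≤ ∫ h, (1 + ρ h * (Rᵀ * R)).det ∂μ := by
  classical
  have hint : ∀ f : G → ℝ, Continuous f → Integrable f μ := fun f hf => by
    obtain ⟨C, hC⟩ := (isCompact_range hf).isBounded.exists_norm_le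
    exact Integrable.of_bound hf.measurable.aestronglyMeasurable C
      (Filter.Eventually.of_forall fun x => hC _ ⟨x, rfl⟩)
  set c : ℝ := μ.real Set.univ with hcdef
  rcases eq_or_ne c 0 with h0 | h0
  · have : μ = 0 := by
      rw [← Measure.measure_univ_eq_zero]
      exact (measureReal_eq_zero_iff).1 h0
    simp [hcdef, this]
  have hcpos : 0 < c := lt_of_le_of_ne measureReal_nonneg (Ne.symm h0)
  let F : G → ℝ := fun h => (1 + ρ h * (Rᵀ * R)).det
  -- Stacking in this way gives (Φ v)ᵀ Φ w = 1 + R ρ(v⁻¹ w) Rᵀ, whose determinant is F(v⁻¹ w). By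
  -- Cauchy-Binet the kernel F(v⁻¹ w) is then a finite sum of products φ(v) φ(w).
  let Φ : G → Matrix (ι ⊕ ι) ι ℝ := fun v => fromRows (ρ v * Rᵀ) 1
  let φ : (ι → ι ⊕ ι) → G → ℝ := fun f v => ((Φ v).submatrix f id).det
  have hΦ : Continuous Φ := by
    refine continuous_pi fun i => continuous_pi fun j => ?_
    rcases i with i | i
    · exact (hc.matrix_mul continuous_const).matrix_elem i j
    · exact continuous_const
  have hφ : ∀ f, Continuous (φ f) := fun f => (hΦ.matrix_submatrix f id).matrix_det
  have hK : ∀ v w, (Fintype.card ι).factorial * F (v⁻¹ * w) = ∑ f, φ f v * φ f w := by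
    intro v w
    rw [sum_det_submatrix_mul_det_submatrix]
    congr 1
    simp only [F, Φ, transpose_fromRows, fromCols_mul_fromRows, hρ]
    rw [transpose_mul, transpose_transpose, transpose_one, Matrix.one_mul, add_comm _ (1 : Matrix ι ι ℝ)]
    rw [show (ρ v)ᵀ * ρ w * (Rᵀ * R) = ((ρ v)ᵀ * (ρ w * Rᵀ)) * R by simp only [Matrix.mul_assoc],
      det_one_add_mul_comm]
    simp only [Matrix.mul_assoc]
  -- Integrate the kernel identity in both variables; by left invariance the integral in w does not
  -- depend on v.
  have h1 : (Fintype.card ι).factorial * (c * ∫ h, F h ∂μ) = ∑ f, (∫ v, φ f v ∂μ) ^ 2 := by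
    have h2 : ∀ v, (Fintype.card ι).factorial * ∫ h, F h ∂μ = ∑ f, φ f v * ∫ w, φ f w ∂μ := by
      intro v
      rw [← integral_mul_left_eq_self F v⁻¹, ← integral_const_mul]
      simp_rw [hK]
      rw [integral_finsetSum _ fun f _ => (hint _ (hφ f)).const_mul _]
      simp_rw [integral_const_mul]
    have h3 : ∫ v, ((Fintype.card ι).factorial * ∫ h, F h ∂μ : ℝ) ∂μ
        = ∑ f, (∫ v, φ f v ∂μ) ^ 2 := by
      rw [integral_congr_ae (Filter.Eventually.of_forall h2),
        integral_finsetSum _ fun f _ => (hint _ (hφ f)).mul_const _]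
      simp_rw [integral_mul_const, sq]
    rw [← h3, integral_const, smul_eq_mul]
    ring
  have h4 : (Fintype.card ι).factorial * c ^ 2 ≤ ∑ f, (∫ v, φ f v ∂μ) ^ 2 := by
    -- Selections taking all rows from the identity block have constant minor ±1, so each
    -- contributes exactly c². All other squares are dropped.
    let e : Equiv.Perm ι ↪ (ι → ι ⊕ ι) := ⟨fun σ i => Sum.inr (σ i), fun σ τ h => by
      ext i; simpa using congrFun h i⟩
    have h5 : ∀ σ, (∫ v, φ (e σ) v ∂μ) ^ 2 = c ^ 2 := by
      intro σ
      have : ∀ v, φ (e σ) v = ((Equiv.Perm.sign σ : ℤ) : ℝ) := by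
        intro v
        have : (Φ v).submatrix (e σ) id = (1 : Matrix ι ι ℝ).submatrix σ id := by
          ext i j; rfl
        simp only [φ, this, det_permute, det_one, mul_one]
      simp_rw [this]
      rw [integral_const, smul_eq_mul, mul_pow]
      rcases Int.units_eq_one_or (Equiv.Perm.sign σ) with h | h <;> simp [h, hcdef]
    calc (Fintype.card ι).factorial * c ^ 2 = ∑ σ : Equiv.Perm ι, (∫ v, φ (e σ) v ∂μ) ^ 2 := by
          simp_rw [h5]; simp [Fintype.card_perm]
      _ = ∑ f ∈ Finset.univ.map e, (∫ v, φ f v ∂μ) ^ 2 := by rw [Finset.sum_map]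
      _ ≤ _ := Finset.sum_le_sum_of_subset_of_nonneg (Finset.subset_univ _)
          fun f _ _ => sq_nonneg _
  rw [← h1] at h4
  have h6 := le_of_mul_le_mul_left h4 (by positivity)
  rw [sq] at h6
  exact le_of_mul_le_mul_left h6 hcpos

/-- Polar decomposition of an invertible real matrix, the positive factor written as `pᵀp`. -/
theorem exists_orthogonal_mul_transpose_mul {n : ℕ} (b : Matrix (Fin n) (Fin n) ℝ)
    (hb : IsUnit b.det) :
    ∃ u : orthogonalGroup (Fin n) ℝ, ∃ p : Matrix (Fin n) (Fin n) ℝ, b = u * (pᵀ * p) := by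
  have hpd : (bᵀ * b).PosSemidef := by
    simpa [conjTranspose_eq_transpose_of_trivial] using posSemidef_conjTranspose_mul_self b
  open scoped MatrixOrder ComplexOrder in
  obtain ⟨s, hs, hss⟩ : ∃ s : Matrix (Fin n) (Fin n) ℝ, s.PosSemidef ∧ s * s = bᵀ * b :=
    ⟨CFC.sqrt (bᵀ * b), (CFC.sqrt_nonneg _).posSemidef,
      CFC.sqrt_mul_sqrt_self _ hpd.nonneg⟩
  have hst : sᵀ = s := by
    simpa [conjTranspose_eq_transpose_of_trivial] using hs.1.eq
  have hdet : IsUnit s.det := by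
    have h := congrArg det hss
    rw [det_mul, det_mul, det_transpose] at h
    refine isUnit_iff_ne_zero.2 fun h0 => hb.ne_zero ?_
    rw [h0, mul_zero] at h
    exact mul_self_eq_zero.1 h.symm
  open scoped MatrixOrder ComplexOrder in
  obtain ⟨p, hp⟩ : ∃ p : Matrix (Fin n) (Fin n) ℝ, s = pᵀ * p := by
    refine ⟨CFC.sqrt s, ?_⟩
    have : (CFC.sqrt s)ᵀ = CFC.sqrt s := by
      simpa [conjTranspose_eq_transpose_of_trivial] using (CFC.sqrt_nonneg s).posSemidef.1.eq
    rw [this, CFC.sqrt_mul_sqrt_self _ hs.nonneg]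
  refine ⟨⟨b * s⁻¹, ?_⟩, p, ?_⟩
  · rw [mem_orthogonalGroup_iff', transpose_mul, transpose_nonsing_inv, hst,
      show s⁻¹ * bᵀ * (b * s⁻¹) = s⁻¹ * (bᵀ * b) * s⁻¹ by simp only [Matrix.mul_assoc], ← hss,
      nonsing_inv_mul_cancel_left _ _ hdet, mul_nonsing_inv _ hdet]
  · rw [← hp]
    exact (nonsing_inv_mul_cancel_right _ _ hdet).symm


instance orthogonalGroup_compactSpace (n : ℕ) : CompactSpace (orthogonalGroup (Fin n) ℝ) := by
  refine isCompact_iff_compactSpace.1 ?_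
  have hsub : (orthogonalGroup (Fin n) ℝ : Set (Matrix (Fin n) (Fin n) ℝ)) ⊆
      Set.univ.pi fun _ => Set.univ.pi fun _ => Set.Icc (-1 : ℝ) 1 := by
    intro U hU i _ j _
    have := entry_norm_bound_of_unitary (𝕜 := ℝ) hU i j
    exact abs_le.1 this
  refine IsCompact.of_isClosed_subset
    (isCompact_univ_pi fun _ => isCompact_univ_pi fun _ => isCompact_Icc) ?_ hsub
  have : (orthogonalGroup (Fin n) ℝ : Set (Matrix (Fin n) (Fin n) ℝ)) =
      {U | U * Uᵀ = 1} := by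
    ext U
    exact mem_orthogonalGroup_iff _ _
  rw [this]
  exact isClosed_eq (continuous_id.matrix_mul continuous_id.matrix_transpose) continuous_const

instance orthogonalGroup_secondCountable (n : ℕ) :
    SecondCountableTopology (orthogonalGroup (Fin n) ℝ) :=
  haveI : SecondCountableTopology (Matrix (Fin n) (Fin n) ℝ) :=
    inferInstanceAs (SecondCountableTopology (Fin n → Fin n → ℝ))
  TopologicalSpace.Subtype.secondCountableTopology _

theorem orthogonalGroup_coe_inv {n : ℕ} (U : orthogonalGroup (Fin n) ℝ) :
    ((U⁻¹ : orthogonalGroup (Fin n) ℝ) : Matrix (Fin n) (Fin n) ℝ) = (U : Matrix (Fin n) (Fin n) ℝ)ᵀ :=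
  rfl

theorem orthogonalGroup_transpose_mul_self {n : ℕ} (U : orthogonalGroup (Fin n) ℝ) :
    (U : Matrix (Fin n) (Fin n) ℝ)ᵀ * (U : Matrix (Fin n) (Fin n) ℝ) = 1 :=
  (mem_orthogonalGroup_iff' _ _).1 U.2

theorem orthogonalGroup_mul_transpose_self {n : ℕ} (U : orthogonalGroup (Fin n) ℝ) :
    (U : Matrix (Fin n) (Fin n) ℝ) * (U : Matrix (Fin n) (Fin n) ℝ)ᵀ = 1 :=
  (mem_orthogonalGroup_iff _ _).1 U.2

open scoped Kronecker

/-- The average over `O_k × O_m` of `|det (1 - h₁b ⊗ h₂d)|` is at least `1`. -/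
theorem measure_univ_le_lintegral_abs_det {k m : ℕ}
    (μ₁ : Measure (orthogonalGroup (Fin k) ℝ)) (μ₂ : Measure (orthogonalGroup (Fin m) ℝ))
    [IsFiniteMeasure μ₁] [IsFiniteMeasure μ₂] [μ₁.IsMulLeftInvariant] [μ₂.IsMulLeftInvariant]
    [μ₁.IsMulRightInvariant] [μ₂.IsMulRightInvariant]
    (b : Matrix (Fin k) (Fin k) ℝ) (d : Matrix (Fin m) (Fin m) ℝ)
    (hb : IsUnit b.det) (hd : IsUnit d.det) :
    μ₁ Set.univ * μ₂ Set.univ ≤ ∫⁻ h, ENNReal.ofReal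
      |(1 - (h.1.1 * b) ⊗ₖ (h.2.1 * d)).det|
      ∂(μ₁.prod μ₂) := by
  obtain ⟨u, p, rfl⟩ := exists_orthogonal_mul_transpose_mul b hb
  obtain ⟨v, q, rfl⟩ := exists_orthogonal_mul_transpose_mul d hd
  let G := orthogonalGroup (Fin k) ℝ × orthogonalGroup (Fin m) ℝ
  let ρ : G → Matrix (Fin k × Fin m) (Fin k × Fin m) ℝ := fun h =>
    h.1.1 ⊗ₖ h.2.1
  have hρc : Continuous ρ := by
    refine continuous_pi fun i => continuous_pi fun j => ?_
    exact ((continuous_subtype_val.comp continuous_fst).matrix_elem i.1 j.1).mul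
      ((continuous_subtype_val.comp continuous_snd).matrix_elem i.2 j.2)
  have hρ : ∀ v w, ρ (v⁻¹ * w) = (ρ v)ᵀ * ρ w := by
    intro v w
    simp only [ρ]
    rw [← kroneckerMap_transpose, ← mul_kronecker_mul]
    rfl
  have hmain := measure_univ_le_integral_det_one_add (μ₁.prod μ₂) ρ hρc hρ (p ⊗ₖ q)
  let F : G → ℝ := fun h => (1 - (h.1.1 * (u.1 * (pᵀ * p))) ⊗ₖ
    (h.2.1 * (v.1 * (qᵀ * q)))).det
  -- Right translation strips the orthogonal polar factors, and the extra -1 in the second component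
  -- turns 1 - … into 1 + ….
  have hF : ∀ h : G, F (h * (u⁻¹, v⁻¹ * -1)) = (1 + ρ h * ((p ⊗ₖ q)ᵀ * (p ⊗ₖ q))).det := by
    intro h
    have h1 : (h.1 * u⁻¹ : orthogonalGroup (Fin k) ℝ).1 * (u.1 * (pᵀ * p))
        = h.1.1 * (pᵀ * p) := by
      rw [Submonoid.coe_mul, orthogonalGroup_coe_inv, Matrix.mul_assoc, ← Matrix.mul_assoc _ᵀ,
        orthogonalGroup_transpose_mul_self, Matrix.one_mul]
    have h2 : (h.2 * (v⁻¹ * -1) : orthogonalGroup (Fin m) ℝ).1 *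
        (v.1 * (qᵀ * q)) = -(h.2.1 * (qᵀ * q)) := by
      rw [mul_neg, mul_one, mul_neg, Unitary.coe_neg, Submonoid.coe_mul, orthogonalGroup_coe_inv,
        Matrix.neg_mul, Matrix.mul_assoc, ← Matrix.mul_assoc _ᵀ,
        orthogonalGroup_transpose_mul_self, Matrix.one_mul]
    have h3 : ∀ (x : Matrix (Fin k) (Fin k) ℝ) (y : Matrix (Fin m) (Fin m) ℝ),
        x ⊗ₖ (-y) = -(x ⊗ₖ y) := by
      intro x y; ext i j; simp
    change (1 - ((h.1 * u⁻¹ : orthogonalGroup (Fin k) ℝ).1 * (u.1 * (pᵀ * p))) ⊗ₖ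
      ((h.2 * (v⁻¹ * -1) : orthogonalGroup (Fin m) ℝ).1 * (v.1 * (qᵀ * q)))).det = _
    rw [h1, h2, h3, sub_neg_eq_add, ← kroneckerMap_transpose, ← mul_kronecker_mul,
      ← mul_kronecker_mul]
  have hFc : Continuous F := by
    have hc : Continuous fun h : G => (h.1.1 * (u.1 * (pᵀ * p))) ⊗ₖ
        (h.2.1 * (v.1 * (qᵀ * q))) := by
      refine continuous_pi fun i => continuous_pi fun j => ?_
      exact (((continuous_subtype_val.comp continuous_fst).matrix_mul
        continuous_const).matrix_elem i.1 j.1).mul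
        (((continuous_subtype_val.comp continuous_snd).matrix_mul
        continuous_const).matrix_elem i.2 j.2)
    exact (continuous_const.sub hc).matrix_det
  have hint : Integrable F (μ₁.prod μ₂) := by
    obtain ⟨C, hC⟩ := (isCompact_range hFc).isBounded.exists_norm_le
    exact Integrable.of_bound hFc.measurable.aestronglyMeasurable C
      (Filter.Eventually.of_forall fun x => hC _ ⟨x, rfl⟩)
  simp_rw [← hF] at hmain
  rw [integral_mul_right_eq_self F] at hmain
  have h4 : (μ₁.prod μ₂).real Set.univ ≤ ∫ h, |F h| ∂(μ₁.prod μ₂) :=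
    hmain.trans (integral_mono hint hint.abs fun h => le_abs_self _)
  have h5 := ENNReal.ofReal_le_ofReal h4
  rw [ofReal_integral_eq_lintegral_ofReal hint.abs
    (Filter.Eventually.of_forall fun _ => abs_nonneg _), ofReal_measureReal,
    ← Set.univ_prod_univ, Measure.prod_prod] at h5
  exact h5

end DeterminantAverage

/-! ### Block matrices and the Sylvester operator -/

section Blocks

open Matrix Polynomial
open scoped Kronecker

variable {k m : ℕ}

/-- The block matrix with the given blocks, indexed by `Fin (k + m)`. -/
def blk (a : Matrix (Fin k) (Fin k) ℝ) (b : Matrix (Fin k) (Fin m) ℝ)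
    (c : Matrix (Fin m) (Fin k) ℝ) (d : Matrix (Fin m) (Fin m) ℝ) :
    Matrix (Fin (k + m)) (Fin (k + m)) ℝ :=
  (fromBlocks a b c d).submatrix finSumFinEquiv.symm finSumFinEquiv.symm

/-- The upper left block. -/
def ulBlock (M : Matrix (Fin (k + m)) (Fin (k + m)) ℝ) : Matrix (Fin k) (Fin k) ℝ :=
  (M.submatrix finSumFinEquiv finSumFinEquiv).toBlocks₁₁

/-- The upper right block. -/
def urBlock (M : Matrix (Fin (k + m)) (Fin (k + m)) ℝ) : Matrix (Fin k) (Fin m) ℝ :=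
  (M.submatrix finSumFinEquiv finSumFinEquiv).toBlocks₁₂

/-- The lower left block, as a linear map. -/
def llBlock : Matrix (Fin (k + m)) (Fin (k + m)) ℝ →ₗ[ℝ] Matrix (Fin m) (Fin k) ℝ where
  toFun M := (M.submatrix finSumFinEquiv finSumFinEquiv).toBlocks₂₁
  map_add' _ _ := by ext; rfl
  map_smul' _ _ := by ext; rfl

theorem llBlock_apply (M : Matrix (Fin (k + m)) (Fin (k + m)) ℝ) :
    llBlock M = (M.submatrix finSumFinEquiv finSumFinEquiv).toBlocks₂₁ := rfl

/-- The lower right block. -/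
def lrBlock (M : Matrix (Fin (k + m)) (Fin (k + m)) ℝ) : Matrix (Fin m) (Fin m) ℝ :=
  (M.submatrix finSumFinEquiv finSumFinEquiv).toBlocks₂₂

theorem blk_blocks (M : Matrix (Fin (k + m)) (Fin (k + m)) ℝ) :
    blk (ulBlock M) (urBlock M) (llBlock M) (lrBlock M) = M := by
  simp only [blk, ulBlock, urBlock, llBlock_apply, lrBlock]
  rw [fromBlocks_toBlocks]
  simp

variable (a a' : Matrix (Fin k) (Fin k) ℝ) (b b' : Matrix (Fin k) (Fin m) ℝ)
  (c c' : Matrix (Fin m) (Fin k) ℝ) (d d' : Matrix (Fin m) (Fin m) ℝ)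

@[simp] theorem ulBlock_blk : ulBlock (blk a b c d) = a := by
  simp [ulBlock, blk]

@[simp] theorem llBlock_blk : llBlock (blk a b c d) = c := by
  simp [llBlock_apply, blk]

@[simp] theorem lrBlock_blk : lrBlock (blk a b c d) = d := by
  simp [lrBlock, blk]

theorem blk_mul : blk a b c d * blk a' b' c' d' =
    blk (a * a' + b * c') (a * b' + b * d') (c * a' + d * c') (c * b' + d * d') := by
  simp only [blk]
  rw [submatrix_mul_equiv, fromBlocks_multiply]

theorem blk_add : blk a b c d + blk a' b' c' d' = blk (a + a') (b + b') (c + c') (d + d') := by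
  rw [blk, blk, blk, ← fromBlocks_add]
  rfl

theorem blk_smul (r : ℝ) : r • blk a b c d = blk (r • a) (r • b) (r • c) (r • d) := by
  simp only [blk, ← fromBlocks_smul, submatrix_smul, Pi.smul_apply]

theorem blk_neg : -blk a b c d = blk (-a) (-b) (-c) (-d) := by
  simp only [blk, ← fromBlocks_neg, submatrix_neg, Pi.neg_apply]

theorem blk_sub : blk a b c d - blk a' b' c' d' = blk (a - a') (b - b') (c - c') (d - d') := by
  simp only [sub_eq_add_neg, blk_neg, blk_add]

theorem blk_one : blk (1 : Matrix (Fin k) (Fin k) ℝ) 0 0 (1 : Matrix (Fin m) (Fin m) ℝ) = 1 := by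
  simp [blk, fromBlocks_one]

theorem blk_transpose : (blk a b c d)ᵀ = blk aᵀ cᵀ bᵀ dᵀ := by
  simp [blk, fromBlocks_transpose]

theorem det_blk_zero : (blk a b 0 d).det = a.det * d.det := by
  simp [blk, det_submatrix_equiv_self]

theorem charpoly_blk_zero : (blk a b 0 d).charpoly = a.charpoly * d.charpoly := by
  rw [← charpoly_fromBlocks_zero₂₁ a b d, ← charpoly_reindex finSumFinEquiv]
  rfl

theorem exists_aeval_blk_zero (p : ℝ[X]) :
    ∃ b' : Matrix (Fin k) (Fin m) ℝ, aeval (blk a b 0 d) p = blk (aeval a p) b' 0 (aeval d p) := by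
  have hpow : ∀ n : ℕ, ∃ b' : Matrix (Fin k) (Fin m) ℝ, (blk a b 0 d) ^ n = blk (a ^ n) b' 0 (d ^ n) := by
    intro n
    induction n with
    | zero => exact ⟨0, by simp [blk_one]⟩
    | succ n ih =>
      obtain ⟨b', hb'⟩ := ih
      refine ⟨a ^ n * b + b' * d, ?_⟩
      rw [pow_succ, hb', blk_mul]
      simp only [Matrix.zero_mul, Matrix.mul_zero, add_zero, zero_add, ← pow_succ]
  induction p using Polynomial.induction_on' with
  | add p q hp hq =>
    obtain ⟨b₁, h₁⟩ := hp
    obtain ⟨b₂, h₂⟩ := hq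
    exact ⟨b₁ + b₂, by simp [h₁, h₂, blk_add]⟩
  | monomial n r =>
    obtain ⟨b', hb'⟩ := hpow n
    refine ⟨r • b', ?_⟩
    simp only [aeval_monomial, ← Algebra.smul_def, hb', blk_smul, smul_zero]

/-- Meant for p(N), with N block triangular and p the characteristic polynomial of its upper left
block: Cayley-Hamilton kills the first block column, and the kernel is then a coordinate plane. -/
theorem blk_zero_mulVec_eq_zero_iff (hd : IsUnit d.det) (y : Fin (k + m) → ℝ) :
    blk 0 b 0 d *ᵥ y = 0 ↔ ∀ i, y (Fin.natAdd k i) = 0 := by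
  have hy : y ∘ finSumFinEquiv = Sum.elim (fun i => y (Fin.castAdd m i)) (fun i => y (Fin.natAdd k i)) := by
    ext i; rcases i with i | i <;> simp
  have h1 : blk 0 b 0 d *ᵥ y = 0 ↔ fromBlocks 0 b 0 d *ᵥ (y ∘ finSumFinEquiv) = 0 := by
    rw [blk, submatrix_mulVec_equiv, Equiv.symm_symm]
    constructor
    · intro h
      ext i
      have := congrFun h (finSumFinEquiv i)
      simpa only [Function.comp, Equiv.symm_apply_apply, Pi.zero_apply] using this
    · intro h
      rw [h]; rfl
  rw [h1, hy, fromBlocks_mulVec]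
  simp only [Sum.elim_comp_inl, Sum.elim_comp_inr, zero_mulVec, zero_add]
  constructor
  · intro h
    have h2 : d *ᵥ (fun i => y (Fin.natAdd k i)) = 0 := by
      ext i; exact congrFun h (Sum.inr i)
    have h3 := congrArg (d⁻¹ *ᵥ ·) h2
    simp only [mulVec_mulVec, nonsing_inv_mul _ hd, one_mulVec, mulVec_zero] at h3
    exact fun i => congrFun h3 i
  · intro h
    have h2 : (fun i => y (Fin.natAdd k i)) = 0 := funext h
    rw [h2]
    ext i; rcases i with i | i <;> simp

/-- The matrix of the Sylvester operator `X ↦ X a - d X`. -/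
def sylv : Matrix (Fin k × Fin m) (Fin k × Fin m) ℝ :=
  aᵀ ⊗ₖ (1 : Matrix (Fin m) (Fin m) ℝ) - (1 : Matrix (Fin k) (Fin k) ℝ) ⊗ₖ d

theorem sylv_mulVec_vec (X : Matrix (Fin m) (Fin k) ℝ) :
    sylv a d *ᵥ X.vec = (X * a - d * X).vec := by
  rw [sylv, sub_mulVec, kronecker_mulVec_vec, kronecker_mulVec_vec]
  simp

theorem eq_zero_of_det_sylv_ne_zero (h : (sylv a d).det ≠ 0) (X : Matrix (Fin m) (Fin k) ℝ)
    (hX : X * a = d * X) : X = 0 := by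
  have h1 : sylv a d *ᵥ X.vec = 0 := by rw [sylv_mulVec_vec, hX, sub_self, vec_zero]
  by_contra hne
  exact h (exists_mulVec_eq_zero_iff.1 ⟨X.vec, fun h0 => hne (vec_eq_zero_iff.1 h0), h1⟩)

/-- Otherwise `a` and `d` share a complex eigenvalue. With u a right eigenvector of `d` and w a left
eigenvector of `a`, the matrix u wᵀ solves Z a = d Z. Its real and imaginary parts are real
solutions, hence zero, contradicting u, w ≠ 0. -/
theorem isUnit_det_aeval_charpoly (h : (sylv a d).det ≠ 0) : IsUnit (aeval d a.charpoly).det := by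
  let φ : ℝ →+* ℂ := Complex.ofRealHom
  by_contra hnot
  let aC := a.map φ
  let dC := d.map φ
  have h1 : (aeval d a.charpoly).map φ = aeval dC (a.charpoly.map φ) := by
    rw [aeval_def, aeval_def, eval₂_map, ← RingHom.mapMatrix_apply, hom_eval₂]
    congr 1
    ext r i j
    by_cases hij : i = j <;> simp [algebraMap_matrix_apply, φ, hij]
  have h2 : ¬ IsUnit (aeval dC (Multiset.map (fun x : ℂ => X - C x)
      (a.charpoly.map φ).roots).prod) := by
    rw [← (IsAlgClosed.splits _).eq_prod_roots_of_monic ((charpoly_monic a).map φ), ← h1,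
      isUnit_iff_isUnit_det]
    have : ((aeval d a.charpoly).map φ).det = φ (aeval d a.charpoly).det := by
      rw [RingHom.map_det]; rfl
    rw [this]
    intro hu
    apply hnot
    rw [isUnit_iff_ne_zero] at hu ⊢
    intro h0
    exact hu (by rw [h0, map_zero])
  obtain ⟨lam, hlam, hroot⟩ := spectrum.exists_mem_of_not_isUnit_aeval_prod h2
  rw [← charpoly_map] at hroot
  have hlam' : lam ∈ spectrum ℂ aC := mem_spectrum_of_isRoot_charpoly hroot
  rw [spectrum.mem_iff, isUnit_iff_isUnit_det, isUnit_iff_ne_zero, not_not] at hlam hlam'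
  obtain ⟨u, hu0, hu⟩ := exists_mulVec_eq_zero_iff.2 hlam
  obtain ⟨w, hw0, hw⟩ := exists_vecMul_eq_zero_iff.2 hlam'
  rw [sub_mulVec, Algebra.algebraMap_eq_smul_one, smul_mulVec, one_mulVec, sub_eq_zero] at hu
  rw [vecMul_sub, Algebra.algebraMap_eq_smul_one, vecMul_smul, vecMul_one, sub_eq_zero] at hw
  let Z : Matrix (Fin m) (Fin k) ℂ := vecMulVec u w
  have hZ : Z * aC = dC * Z := by
    rw [vecMulVec_mul, mul_vecMulVec, ← hu, ← hw, vecMulVec_smul, smul_vecMulVec]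
  have hre : Z.map Complex.re = 0 := by
    refine eq_zero_of_det_sylv_ne_zero a d h _ ?_
    ext i j
    have := congrArg Complex.re (congrFun (congrFun hZ i) j)
    simpa [mul_apply, aC, dC, φ] using this
  have him : Z.map Complex.im = 0 := by
    refine eq_zero_of_det_sylv_ne_zero a d h _ ?_
    ext i j
    have := congrArg Complex.im (congrFun (congrFun hZ i) j)
    simpa [mul_apply, aC, dC, φ] using this
  obtain ⟨i, hi⟩ := Function.ne_iff.1 hu0
  obtain ⟨j, hj⟩ := Function.ne_iff.1 hw0
  have hz : Z i j = 0 :=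
    Complex.ext (congrFun (congrFun hre i) j) (congrFun (congrFun him i) j)
  exact mul_ne_zero hi hj hz

end Blocks

/-! ### Planes as orbits of orthonormal frames -/

section Planes

open Matrix

/-- The linear isometry given by a matrix with orthonormal columns. -/
def isometryOfMatrix {ι κ : Type*} [Fintype ι] [DecidableEq ι] [Fintype κ] [DecidableEq κ]
    (F : Matrix ι κ ℝ) (hF : Fᵀ * F = 1) :
    EuclideanSpace ℝ κ →ₗᵢ[ℝ] EuclideanSpace ℝ ι where
  toLinearMap := toEuclideanLin F
  norm_map' x := by
    rw [← sq_eq_sq₀ (norm_nonneg _) (norm_nonneg _), ← real_inner_self_eq_norm_sq,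
      ← real_inner_self_eq_norm_sq, EuclideanSpace.inner_eq_star_dotProduct,
      EuclideanSpace.inner_eq_star_dotProduct]
    simp only [ofLp_toLpLin, toLin'_apply, star_trivial]
    rw [dotProduct_mulVec, ← mulVec_transpose, mulVec_mulVec, hF, one_mulVec]

theorem starProjection_range_isometryOfMatrix {ι κ : Type*} [Fintype ι] [DecidableEq ι] [Fintype κ]
    [DecidableEq κ] (F : Matrix ι κ ℝ) (hF : Fᵀ * F = 1) :
    toEuclideanLin.symm (((toEuclideanLin F).range).starProjection : _ →ₗ[ℝ] _) = F * Fᵀ := by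
  rw [LinearEquiv.symm_apply_eq]
  ext1 x
  refine Submodule.eq_starProjection_of_mem_orthogonal ?_ ?_
  · rw [toLpLin_mul_same]
    exact ⟨_, rfl⟩
  · rw [Submodule.mem_orthogonal]
    rintro _ ⟨y, rfl⟩
    rw [inner_sub_right, sub_eq_zero, EuclideanSpace.inner_eq_star_dotProduct,
      EuclideanSpace.inner_eq_star_dotProduct]
    simp only [ofLp_toLpLin, toLin'_apply, star_trivial]
    rw [dotProduct_mulVec, dotProduct_mulVec, ← mulVec_transpose, ← mulVec_transpose,
      mulVec_mulVec, ← Matrix.mul_assoc, hF, Matrix.one_mul]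

variable {k m : ℕ}

/-- The matrix of the inclusion of the first `k` coordinates. -/
def inclMat (k m : ℕ) : Matrix (Fin (k + m)) (Fin k) ℝ :=
  (1 : Matrix (Fin (k + m)) (Fin (k + m)) ℝ).submatrix id (Fin.castAdd m)

theorem mul_inclMat {ι : Type*} (M : Matrix ι (Fin (k + m)) ℝ) :
    M * inclMat k m = M.submatrix id (Fin.castAdd m) := by
  ext i j
  simp [inclMat, mul_apply, one_apply]

theorem inclMat_transpose_mul_self : (inclMat k m)ᵀ * inclMat k m = 1 := by
  rw [mul_inclMat]
  ext i j
  simp [inclMat, one_apply]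

theorem inclMat_castAdd (i j : Fin k) :
    inclMat k m (Fin.castAdd m i) j = (1 : Matrix (Fin k) (Fin k) ℝ) i j := by
  simp [inclMat, one_apply]

theorem inclMat_natAdd (i : Fin m) (j : Fin k) : inclMat k m (Fin.natAdd k i) j = 0 := by
  simp only [inclMat, submatrix_apply, id, one_apply, Fin.ext_iff]
  rw [if_neg]
  simp only [Fin.val_natAdd, Fin.val_castAdd]
  omega

theorem inclMat_mul_transpose : inclMat k m * (inclMat k m)ᵀ = blk 1 0 0 0 := by
  ext i j
  induction i using Fin.addCases with
  | left i =>
    induction j using Fin.addCases with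
    | left j => simp [mul_apply, blk, inclMat_castAdd, one_apply]
    | right j => simp [mul_apply, blk, inclMat_castAdd, inclMat_natAdd]
  | right i =>
    induction j using Fin.addCases with
    | left j => simp [mul_apply, blk, inclMat_castAdd, inclMat_natAdd]
    | right j => simp [mul_apply, blk, inclMat_natAdd]

theorem frame_transpose_mul_self (W : orthogonalGroup (Fin (k + m)) ℝ) :
    (W.1 * inclMat k m)ᵀ * (W.1 * inclMat k m) = 1 := by
  rw [transpose_mul, Matrix.mul_assoc, ← Matrix.mul_assoc _ᵀ W.1,
    orthogonalGroup_transpose_mul_self, Matrix.one_mul, inclMat_transpose_mul_self]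

/-- The `k`-plane spanned by the first `k` columns of `W`. -/
def planeOf (W : orthogonalGroup (Fin (k + m)) ℝ) : Grass (k + m) k where
  space := (toEuclideanLin (W.1 * inclMat k m)).range
  finrank_eq := by
    have h := LinearMap.finrank_range_of_inj (f := toEuclideanLin (W.1 * inclMat k m))
      (isometryOfMatrix _ (frame_transpose_mul_self W)).injective
    rw [h]
    simp

theorem projMatrix_planeOf (W : orthogonalGroup (Fin (k + m)) ℝ) :
    projMatrix (planeOf W) = W.1 * blk 1 0 0 0 * W.1ᵀ := by
  rw [projMatrix, planeOf, starProjection_range_isometryOfMatrix _ (frame_transpose_mul_self W),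
    transpose_mul, ← inclMat_mul_transpose]
  simp only [Matrix.mul_assoc]

theorem mem_planeOf_iff (W : orthogonalGroup (Fin (k + m)) ℝ)
    (x : EuclideanSpace ℝ (Fin (k + m))) :
    x ∈ (planeOf W).space ↔ ∀ i, (W.1ᵀ *ᵥ x.ofLp) (Fin.natAdd k i) = 0 := by
  constructor
  · rintro ⟨y, rfl⟩ i
    simp only [ofLp_toLpLin, toLin'_apply]
    rw [mulVec_mulVec, ← Matrix.mul_assoc, orthogonalGroup_transpose_mul_self, Matrix.one_mul]
    simp [mulVec, dotProduct, inclMat_natAdd]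
  · intro h
    refine ⟨WithLp.toLp 2 fun j => (W.1ᵀ *ᵥ x.ofLp) (Fin.castAdd m j), ?_⟩
    have h1 : inclMat k m *ᵥ (fun j => (W.1ᵀ *ᵥ x.ofLp) (Fin.castAdd m j)) = W.1ᵀ *ᵥ x.ofLp := by
      ext i
      induction i using Fin.addCases with
      | left i =>
        simp [mulVec, dotProduct, inclMat_castAdd, one_apply]
      | right i =>
        rw [h i]
        simp [mulVec, dotProduct, inclMat_natAdd]
    rw [toLpLin_toLp, toLin'_apply, ← mulVec_mulVec, h1, mulVec_mulVec,
      orthogonalGroup_mul_transpose_self, one_mulVec]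

theorem exists_orthogonalGroup_eq {n : ℕ}
    (L : EuclideanSpace ℝ (Fin n) →ₗᵢ[ℝ] EuclideanSpace ℝ (Fin n)) :
    ∃ W : orthogonalGroup (Fin n) ℝ, toEuclideanLin W.1 = L.toLinearMap := by
  refine ⟨⟨toEuclideanLin.symm L.toLinearMap, ?_⟩, by simp⟩
  rw [mem_orthogonalGroup_iff', ← conjTranspose_eq_transpose_of_trivial]
  apply toEuclideanLin.injective
  rw [toLpLin_mul_same, toEuclideanLin_conjTranspose_eq_adjoint, LinearEquiv.apply_symm_apply,
    toLpLin_one]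
  refine LinearMap.ext fun x => ext_inner_left ℝ fun y => ?_
  simp

/-- An isometry from the coordinate plane onto `g` extends to an isometry of the whole space, whose
matrix is the required frame. -/
theorem planeOf_surjective :
    Function.Surjective (planeOf : orthogonalGroup (Fin (k + m)) ℝ → Grass (k + m) k) := by
  intro g
  let b₀ := (stdOrthonormalBasis ℝ (planeOf (1 : orthogonalGroup (Fin (k + m)) ℝ)).space).reindex
    (finCongr (planeOf (1 : orthogonalGroup (Fin (k + m)) ℝ)).finrank_eq)
  let b := (stdOrthonormalBasis ℝ g.space).reindex (finCongr g.finrank_eq)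
  let e := b₀.equiv b (Equiv.refl _)
  let L := (g.space.subtypeₗᵢ.comp e.toLinearIsometry)
  obtain ⟨W, hW⟩ := exists_orthogonalGroup_eq L.extend
  refine ⟨W, Grass.ext ?_⟩
  have h1 : (planeOf W).space =
      (planeOf (1 : orthogonalGroup (Fin (k + m)) ℝ)).space.map (toEuclideanLin W.1) := by
    simp only [planeOf]
    rw [← LinearMap.range_comp, ← toLpLin_mul_same]
    simp
  rw [h1, hW]
  ext x
  constructor
  · rintro ⟨y, hy, rfl⟩
    have : L.extend y = L ⟨y, hy⟩ := L.extend_apply ⟨y, hy⟩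
    change L.extend y ∈ _
    rw [this]
    exact (e ⟨y, hy⟩).2
  · intro hx
    refine ⟨(e.symm ⟨x, hx⟩ : _), (e.symm ⟨x, hx⟩).2, ?_⟩
    change L.extend _ = x
    rw [L.extend_apply]
    simp [L]

theorem continuous_grass_iff {n k : ℕ} {X : Type*} [TopologicalSpace X] {f : X → Grass n k} :
    Continuous f ↔ Continuous fun x => projMatrix (f x) :=
  continuous_induced_rng

theorem continuous_planeOf :
    Continuous (planeOf : orthogonalGroup (Fin (k + m)) ℝ → Grass (k + m) k) := by
  rw [continuous_grass_iff]
  simp_rw [projMatrix_planeOf]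
  exact (continuous_subtype_val.matrix_mul continuous_const).matrix_mul
    continuous_subtype_val.matrix_transpose

theorem grass_compactSpace : CompactSpace (Grass (k + m) k) :=
  planeOf_surjective.compactSpace continuous_planeOf

/-- A continuous surjection from a compact space to a Hausdorff space is closed. This lets
continuity on the Grassmannian be tested on frames. -/
theorem isQuotientMap_planeOf : Topology.IsQuotientMap
    (planeOf : orthogonalGroup (Fin (k + m)) ℝ → Grass (k + m) k) :=
  continuous_planeOf.isClosedMap.isQuotientMap continuous_planeOf planeOf_surjective

theorem toEuclideanLin_orthogonal_injective {n : ℕ} (U : orthogonalGroup (Fin n) ℝ) :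
    Function.Injective (toEuclideanLin U.1) :=
  (isometryOfMatrix U.1 (orthogonalGroup_transpose_mul_self U)).injective

/-- The action of the orthogonal group on planes. -/
def rotGrass {n k : ℕ} (U : orthogonalGroup (Fin n) ℝ) (g : Grass n k) : Grass n k where
  space := g.space.map (toEuclideanLin U.1)
  finrank_eq := by
    rw [(Submodule.equivMapOfInjective _ (toEuclideanLin_orthogonal_injective U)
      g.space).symm.finrank_eq, g.finrank_eq]

theorem rotGrass_planeOf (U W : orthogonalGroup (Fin (k + m)) ℝ) :
    rotGrass U (planeOf W) = planeOf (U * W) := by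
  refine Grass.ext ?_
  simp only [rotGrass, planeOf]
  rw [← LinearMap.range_comp, ← toLpLin_mul_same, ← Matrix.mul_assoc]
  rfl

theorem projMatrix_rotGrass (U : orthogonalGroup (Fin (k + m)) ℝ) (g : Grass (k + m) k) :
    projMatrix (rotGrass U g) = U.1 * projMatrix g * U.1ᵀ := by
  obtain ⟨W, rfl⟩ := planeOf_surjective g
  rw [rotGrass_planeOf, projMatrix_planeOf, projMatrix_planeOf, Submonoid.coe_mul, transpose_mul]
  simp only [Matrix.mul_assoc]

theorem continuous_projMatrix {n k : ℕ} :
    Continuous (projMatrix : Grass n k → Matrix (Fin n) (Fin n) ℝ) :=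
  continuous_grass_iff.1 continuous_id

theorem continuous_rotGrass : Continuous fun p : orthogonalGroup (Fin (k + m)) ℝ × Grass (k + m) k =>
    rotGrass p.1 p.2 := by
  rw [continuous_grass_iff]
  simp_rw [projMatrix_rotGrass]
  have h1 : Continuous fun p : orthogonalGroup (Fin (k + m)) ℝ × Grass (k + m) k => p.1.1 :=
    continuous_subtype_val.comp continuous_fst
  exact (h1.matrix_mul (continuous_projMatrix.comp continuous_snd)).matrix_mul h1.matrix_transpose

theorem absDetOn_planeOf_sq (A : Matrix (Fin (k + m)) (Fin (k + m)) ℝ)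
    (W : orthogonalGroup (Fin (k + m)) ℝ) :
    absDetOn A (planeOf W) ^ 2 =
      ((A * (W.1 * inclMat k m))ᵀ * (A * (W.1 * inclMat k m))).det := by
  let T : EuclideanSpace ℝ (Fin k) ≃ₗᵢ[ℝ] (planeOf W).space :=
    (isometryOfMatrix _ (frame_transpose_mul_self W)).equivRange
  have h1 : absDetOn A (planeOf W) = (toEuclideanLin (A * (W.1 * inclMat k m))).normDet := by
    have h2 : toEuclideanLin (A * (W.1 * inclMat k m)) =
        ((toEuclideanLin A).comp (planeOf W).space.subtype) ∘ₗ
          T.toLinearIsometry.toLinearMap := by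
      rw [toLpLin_mul_same]
      rfl
    rw [h2, LinearMap.normDet_comp_of_finrank_eq]
    · rw [LinearIsometry.normDet_eq_one, mul_one]; rfl
    · exact T.toLinearEquiv.finrank_eq
  rw [h1]
  have h3 := LinearMap.normDet_sq (toEuclideanLin (A * (W.1 * inclMat k m)))
  rw [← toEuclideanLin_conjTranspose_eq_adjoint, ← toLpLin_mul_same, LinearMap.det_toLpLin,
    conjTranspose_eq_transpose_of_trivial] at h3
  exact h3

theorem absDetOn_nonneg {n k : ℕ} (A : Matrix (Fin n) (Fin n) ℝ) (g : Grass n k) :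
    0 ≤ absDetOn A g :=
  LinearMap.normDet_nonneg _

theorem absDetOn_planeOf (A : Matrix (Fin (k + m)) (Fin (k + m)) ℝ)
    (W : orthogonalGroup (Fin (k + m)) ℝ) :
    absDetOn A (planeOf W) =
      √((A * (W.1 * inclMat k m))ᵀ * (A * (W.1 * inclMat k m))).det := by
  rw [← absDetOn_planeOf_sq, Real.sqrt_sq (absDetOn_nonneg _ _)]

theorem continuous_absDetOn (A : Matrix (Fin (k + m)) (Fin (k + m)) ℝ) :
    Continuous fun g : Grass (k + m) k => absDetOn A g := by
  rw [isQuotientMap_planeOf.continuous_iff]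
  simp only [Function.comp_def, absDetOn_planeOf]
  have h1 : Continuous fun W : orthogonalGroup (Fin (k + m)) ℝ => A * (W.1 * inclMat k m) :=
    continuous_const.matrix_mul (continuous_subtype_val.matrix_mul continuous_const)
  exact (h1.matrix_transpose.matrix_mul h1).matrix_det.sqrt

theorem absDetOn_orthogonal_mul (A : Matrix (Fin (k + m)) (Fin (k + m)) ℝ)
    (U : orthogonalGroup (Fin (k + m)) ℝ) (g : Grass (k + m) k) :
    absDetOn (U.1 * A) g = absDetOn A g := by
  obtain ⟨W, rfl⟩ := planeOf_surjective g
  rw [absDetOn_planeOf, absDetOn_planeOf]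
  congr 2
  rw [Matrix.mul_assoc U.1, transpose_mul U.1, Matrix.mul_assoc, ← Matrix.mul_assoc _ᵀ U.1,
    orthogonalGroup_transpose_mul_self, Matrix.one_mul]

/-- As `M` is injective, equality of dimensions turns M g ⊆ g into M g = g, and the inclusion is the
vanishing of one block in the frame `W`. Being fixed thus becomes a closed condition on the pair of
`M` and `W`. -/
theorem planeOf_mem_fixedPlanes_iff (M : Matrix (Fin (k + m)) (Fin (k + m)) ℝ)
    (hM : IsUnit M.det) (W : orthogonalGroup (Fin (k + m)) ℝ) :
    planeOf W ∈ fixedPlanes k M ↔ llBlock (W.1ᵀ * M * W.1) = 0 := by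
  have hinj : Function.Injective (toEuclideanLin M) := by
    intro x y hxy
    have h1 := congrArg (fun z => M⁻¹ *ᵥ z.ofLp) hxy
    simp only [ofLp_toLpLin, toLin'_apply, mulVec_mulVec, nonsing_inv_mul _ hM, one_mulVec] at h1
    exact WithLp.ofLp_injective 2 h1
  have h1 : planeOf W ∈ fixedPlanes k M ↔
      (planeOf W).space.map (toEuclideanLin M) ≤ (planeOf W).space := by
    refine ⟨fun h => le_of_eq h, fun h => Submodule.eq_of_le_of_finrank_eq h ?_⟩
    exact (Submodule.equivMapOfInjective _ hinj _).symm.finrank_eq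
  have h2 : llBlock (W.1ᵀ * M * W.1) = 0 ↔ ∀ (i : Fin m) (j : Fin k),
      (W.1ᵀ * M * W.1) (Fin.natAdd k i) (Fin.castAdd m j) = 0 := by
    rw [← Matrix.ext_iff]
    rfl
  have h3 : ∀ y : EuclideanSpace ℝ (Fin k), W.1ᵀ *ᵥ
      (toEuclideanLin M (toEuclideanLin (W.1 * inclMat k m) y)).ofLp =
      (W.1ᵀ * M * W.1).submatrix id (Fin.castAdd m) *ᵥ y.ofLp := by
    intro y
    simp only [ofLp_toLpLin, toLin'_apply, mulVec_mulVec]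
    rw [← mul_inclMat]
    simp only [Matrix.mul_assoc]
  rw [h1, h2, Submodule.map_le_iff_le_comap]
  constructor
  · intro h i j
    have h4 := h (show toEuclideanLin (W.1 * inclMat k m) (EuclideanSpace.single j 1) ∈
      (planeOf W).space from ⟨_, rfl⟩)
    rw [Submodule.mem_comap, mem_planeOf_iff] at h4
    have h5 := h4 i
    rw [h3] at h5
    simpa [mulVec, dotProduct] using h5
  · rintro h _ ⟨y, rfl⟩
    rw [Submodule.mem_comap, mem_planeOf_iff]
    intro i
    rw [h3]
    simp [mulVec, dotProduct, h]

end Planes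

/-! ### Nondegenerate fixed planes and their number -/

section GoodFrames

open Matrix Polynomial

variable {k m : ℕ}

/-- The span of the first `k` columns of `W` is invariant under `M` and is a nondegenerate fixed
point of the action of `M` on planes. -/
def IsGoodFrame (M : Matrix (Fin (k + m)) (Fin (k + m)) ℝ)
    (W : orthogonalGroup (Fin (k + m)) ℝ) : Prop :=
  llBlock (W.1ᵀ * M * W.1) = 0 ∧
    (sylv (ulBlock (W.1ᵀ * M * W.1)) (lrBlock (W.1ᵀ * M * W.1))).det ≠ 0

/-- The nondegenerate fixed `k`-planes of `M`. -/
def goodPlanes (M : Matrix (Fin (k + m)) (Fin (k + m)) ℝ) : Set (Grass (k + m) k) :=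
  {g | ∃ W, planeOf W = g ∧ IsGoodFrame M W}

theorem aeval_mul_of_mul_eq {n : ℕ} {W N M : Matrix (Fin n) (Fin n) ℝ} (h : W * N = M * W)
    (p : ℝ[X]) : W * aeval N p = aeval M p * W := by
  have hpow : ∀ i : ℕ, W * N ^ i = M ^ i * W := by
    intro i
    induction i with
    | zero => simp
    | succ i ih => rw [pow_succ, ← Matrix.mul_assoc, ih, Matrix.mul_assoc, h, ← Matrix.mul_assoc,
        ← pow_succ]
  induction p using Polynomial.induction_on' with
  | add p q hp hq => simp [Matrix.mul_add, Matrix.add_mul, hp, hq]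
  | monomial i r =>
    simp only [aeval_monomial, ← Algebra.smul_def, Matrix.mul_smul, Matrix.smul_mul, hpow]

theorem mul_conj_eq (W : orthogonalGroup (Fin (k + m)) ℝ)
    (M : Matrix (Fin (k + m)) (Fin (k + m)) ℝ) : W.1 * (W.1ᵀ * M * W.1) = M * W.1 := by
  rw [← Matrix.mul_assoc, ← Matrix.mul_assoc, orthogonalGroup_mul_transpose_self, Matrix.one_mul]

/-- In the frame `W` the polynomial of `M` has zero upper left block by Cayley-Hamilton and
invertible lower right block by nondegeneracy, so its kernel is exactly the plane. Hence the plane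
can be recovered from the polynomial alone. -/
theorem IsGoodFrame.mem_planeOf_iff {M : Matrix (Fin (k + m)) (Fin (k + m)) ℝ}
    {W : orthogonalGroup (Fin (k + m)) ℝ} (h : IsGoodFrame M W)
    (x : EuclideanSpace ℝ (Fin (k + m))) :
    x ∈ (planeOf W).space ↔ aeval M (ulBlock (W.1ᵀ * M * W.1)).charpoly *ᵥ x.ofLp = 0 := by
  set N := W.1ᵀ * M * W.1 with hN
  set p := (ulBlock N).charpoly
  have h1 : W.1 * aeval N p = aeval M p * W.1 := aeval_mul_of_mul_eq (mul_conj_eq W M) p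
  have hNb : N = blk (ulBlock N) (urBlock N) 0 (lrBlock N) := by
    conv_lhs => rw [← blk_blocks N, h.1]
  obtain ⟨b', hb'⟩ := exists_aeval_blk_zero (ulBlock N) (urBlock N) (lrBlock N) p
  rw [← hNb, aeval_self_charpoly] at hb'
  have hx : x.ofLp = W.1 *ᵥ (W.1ᵀ *ᵥ x.ofLp) := by
    rw [mulVec_mulVec, orthogonalGroup_mul_transpose_self, one_mulVec]
  rw [_root_.mem_planeOf_iff, ← blk_zero_mulVec_eq_zero_iff b' _
    (isUnit_det_aeval_charpoly _ _ h.2), ← hb']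
  conv_rhs => rw [hx, mulVec_mulVec, ← h1, ← mulVec_mulVec]
  constructor
  · intro h0
    rw [h0, mulVec_zero]
  · intro h0
    have := congrArg (W.1ᵀ *ᵥ ·) h0
    simpa only [mulVec_mulVec, ← Matrix.mul_assoc, orthogonalGroup_transpose_mul_self,
      Matrix.one_mul, mulVec_zero] using this

theorem IsGoodFrame.charpoly_dvd {M : Matrix (Fin (k + m)) (Fin (k + m)) ℝ}
    {W : orthogonalGroup (Fin (k + m)) ℝ} (h : IsGoodFrame M W) :
    (ulBlock (W.1ᵀ * M * W.1)).charpoly ∣ M.charpoly := by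
  set N := W.1ᵀ * M * W.1 with hN
  have hNb : N = blk (ulBlock N) (urBlock N) 0 (lrBlock N) := by
    conv_lhs => rw [← blk_blocks N, h.1]
  have h1 : M.charpoly = N.charpoly := by
    rw [hN, Matrix.mul_assoc, charpoly_mul_comm, Matrix.mul_assoc,
      orthogonalGroup_mul_transpose_self, Matrix.mul_one]
  rw [h1]
  conv_rhs => rw [hNb]
  rw [charpoly_blk_zero]
  exact dvd_mul_right _ _

/-- A matrix of size `k + m` has at most `(k + m).choose k` nondegenerate fixed `k`-planes. -/
theorem goodPlanes_finite_ncard_le (M : Matrix (Fin (k + m)) (Fin (k + m)) ℝ) :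
    (goodPlanes M : Set (Grass (k + m) k)).Finite ∧
      (goodPlanes M : Set (Grass (k + m) k)).ncard ≤ (k + m).choose k := by
  classical
  choose! W hW using fun (g : Grass (k + m) k) (hg : g ∈ goodPlanes M) => hg
  let q : Grass (k + m) k → ℝ[X] := fun g => (ulBlock ((W g).1ᵀ * M * (W g).1)).charpoly
  -- The eigenvalues of the restriction form a k-element submultiset of those of `M`. They determine
  -- the monic polynomial `q g`, hence `g`.
  let r : Grass (k + m) k → Multiset ℂ := fun g => ((q g).map Complex.ofRealHom).roots
  let T := (M.charpoly.map Complex.ofRealHom).roots.powersetCard k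
  have hmaps : ∀ g ∈ goodPlanes M, r g ∈ (T.toFinset : Set (Multiset ℂ)) := by
    intro g hg
    simp only [T, Finset.mem_coe, Multiset.mem_toFinset, Multiset.mem_powersetCard, r]
    constructor
    · refine roots.le_of_dvd ((charpoly_monic M).map _).ne_zero ?_
      exact Polynomial.map_dvd _ (hW g hg).2.charpoly_dvd
    · rw [← (IsAlgClosed.splits _).natDegree_eq_card_roots, natDegree_map]
      simp [q]
  have hinj : Set.InjOn r (goodPlanes M) := by
    intro g hg g' hg' hr
    have hq : q g = q g' := by
      apply Polynomial.map_injective Complex.ofRealHom Complex.ofRealHom.injective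
      rw [(IsAlgClosed.splits ((q g).map Complex.ofRealHom)).eq_prod_roots_of_monic
          ((charpoly_monic _).map _),
        (IsAlgClosed.splits ((q g').map Complex.ofRealHom)).eq_prod_roots_of_monic
          ((charpoly_monic _).map _)]
      change (Multiset.map _ (r g)).prod = (Multiset.map _ (r g')).prod
      rw [hr]
    rw [← (hW g hg).1, ← (hW g' hg').1]
    refine Grass.ext ?_
    ext x
    rw [(hW g hg).2.mem_planeOf_iff, (hW g' hg').2.mem_planeOf_iff]
    change aeval M (q g) *ᵥ _ = 0 ↔ aeval M (q g') *ᵥ _ = 0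
    rw [hq]
  refine ⟨Set.Finite.of_injOn hmaps hinj (Finset.finite_toSet _), ?_⟩
  refine (Set.ncard_le_ncard_of_injOn r hmaps hinj (Finset.finite_toSet _)).trans ?_
  rw [Set.ncard_coe_finset]
  refine (Multiset.toFinset_card_le _).trans ?_
  rw [Multiset.card_powersetCard, ← (IsAlgClosed.splits _).natDegree_eq_card_roots, natDegree_map,
    charpoly_natDegree_eq_dim, Fintype.card_fin]

theorem goodPlanes_subset_fixedPlanes (M : Matrix (Fin (k + m)) (Fin (k + m)) ℝ)
    (hM : IsUnit M.det) : (goodPlanes M : Set (Grass (k + m) k)) ⊆ fixedPlanes k M := by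
  rintro _ ⟨W, rfl, hW⟩
  exact (planeOf_mem_fixedPlanes_iff M hM W).2 hW.1

theorem isGoodFrame_mul_iff (M : Matrix (Fin (k + m)) (Fin (k + m)) ℝ)
    (V W : orthogonalGroup (Fin (k + m)) ℝ) :
    IsGoodFrame M (V * W) ↔ IsGoodFrame (V.1ᵀ * M * V.1) W := by
  have : (V * W).1ᵀ * M * (V * W).1 = W.1ᵀ * (V.1ᵀ * M * V.1) * W.1 := by
    rw [Submonoid.coe_mul, transpose_mul]
    simp only [Matrix.mul_assoc]
  rw [IsGoodFrame, this, IsGoodFrame]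

/-- Block diagonal orthogonal matrices. -/
def blkO (h : orthogonalGroup (Fin k) ℝ × orthogonalGroup (Fin m) ℝ) :
    orthogonalGroup (Fin (k + m)) ℝ :=
  ⟨blk h.1.1 0 0 h.2.1, by
    rw [mem_orthogonalGroup_iff, blk_transpose, blk_mul]
    simp only [transpose_zero, Matrix.mul_zero, Matrix.zero_mul, add_zero, zero_add,
      orthogonalGroup_mul_transpose_self, blk_one]⟩

theorem blkO_mul (h h' : orthogonalGroup (Fin k) ℝ × orthogonalGroup (Fin m) ℝ) :
    blkO (h * h') = blkO h * blkO h' := by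
  apply Subtype.ext
  change blk _ _ _ _ = blk _ _ _ _ * blk _ _ _ _
  rw [blk_mul]
  simp

theorem continuous_blkO : Continuous
    (blkO : orthogonalGroup (Fin k) ℝ × orthogonalGroup (Fin m) ℝ →
      orthogonalGroup (Fin (k + m)) ℝ) := by
  refine Continuous.subtype_mk ?_ _
  refine Continuous.matrix_submatrix ?_ _ _
  exact Continuous.matrix_fromBlocks (continuous_subtype_val.comp continuous_fst) continuous_const
    continuous_const (continuous_subtype_val.comp continuous_snd)

/-- Two frames spanning the same plane differ by a block diagonal matrix. -/
theorem exists_eq_mul_blkO {W W' : orthogonalGroup (Fin (k + m)) ℝ} (h : planeOf W = planeOf W') :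
    ∃ b, W' = W * blkO b := by
  have hP := congrArg projMatrix h
  rw [projMatrix_planeOf, projMatrix_planeOf] at hP
  set U := W⁻¹ * W' with hU
  -- W⁻¹ W' commutes with the projection onto the first k coordinates, which forces both
  -- off-diagonal blocks to vanish.
  have hcomm : blk (1 : Matrix (Fin k) (Fin k) ℝ) 0 0 (0 : Matrix (Fin m) (Fin m) ℝ) * U.1 =
      U.1 * blk 1 0 0 0 := by
    have h1 := congrArg (fun M => W.1ᵀ * M * W'.1) hP
    simp only [Matrix.mul_assoc, orthogonalGroup_transpose_mul_self, Matrix.mul_one] at h1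
    simp only [← Matrix.mul_assoc, orthogonalGroup_transpose_mul_self, Matrix.one_mul] at h1
    rw [Matrix.mul_assoc] at h1
    exact h1
  rw [← blk_blocks U.1, blk_mul, blk_mul] at hcomm
  have hll : llBlock U.1 = 0 := by
    have := congrArg llBlock hcomm
    simpa using this.symm
  have hur : urBlock U.1 = 0 := by
    have := congrArg urBlock hcomm
    simpa [urBlock, blk] using this
  have hUb : U.1 = blk (ulBlock U.1) 0 0 (lrBlock U.1) := by
    conv_lhs => rw [← blk_blocks U.1, hll, hur]
  have horth := orthogonalGroup_mul_transpose_self U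
  rw [hUb, blk_transpose, blk_mul, ← blk_one] at horth
  have h1 := congrArg ulBlock horth
  have h2 := congrArg lrBlock horth
  simp only [transpose_zero, Matrix.mul_zero, Matrix.zero_mul, add_zero, zero_add, ulBlock_blk,
    lrBlock_blk] at h1 h2
  refine ⟨(⟨ulBlock U.1, (mem_orthogonalGroup_iff _ _).2 h1⟩,
    ⟨lrBlock U.1, (mem_orthogonalGroup_iff _ _).2 h2⟩), ?_⟩
  have h3 : blkO (⟨ulBlock U.1, (mem_orthogonalGroup_iff _ _).2 h1⟩,
    ⟨lrBlock U.1, (mem_orthogonalGroup_iff _ _).2 h2⟩) = U := Subtype.ext hUb.symm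
  rw [h3, hU, mul_inv_cancel_left]

theorem planeOf_mul_blkO (W : orthogonalGroup (Fin (k + m)) ℝ)
    (b : orthogonalGroup (Fin k) ℝ × orthogonalGroup (Fin m) ℝ) :
    planeOf (W * blkO b) = planeOf W := by
  apply projMatrix_injective
  rw [projMatrix_planeOf, projMatrix_planeOf, Submonoid.coe_mul, transpose_mul]
  have : (blkO b).1 * blk 1 0 0 0 * (blkO b).1ᵀ = blk 1 0 0 0 := by
    change blk _ _ _ _ * blk _ _ _ _ * (blk _ _ _ _)ᵀ = _
    rw [blk_transpose, blk_mul, blk_mul]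
    simp [orthogonalGroup_mul_transpose_self]
  rw [show W.1 * (blkO b).1 * blk 1 0 0 0 * ((blkO b).1ᵀ * W.1ᵀ) =
    W.1 * ((blkO b).1 * blk 1 0 0 0 * (blkO b).1ᵀ) * W.1ᵀ by simp only [Matrix.mul_assoc], this]

end GoodFrames

/-! ### Hausdorff measure under almost isometric charts -/

section AsymptoticIsometry

open Metric Filter Topology

/-- A map is an asymptotic isometry at the origin if it distorts distances near the origin by
factors arbitrarily close to one. -/
def IsAsymptoticIsometry {E X : Type*} [NormedAddCommGroup E] [PseudoMetricSpace X]
    (f : E → X) : Prop :=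
  ∀ ε > 0, ∃ r > 0, ∀ x ∈ closedBall (0 : E) r, ∀ y ∈ closedBall (0 : E) r,
    (1 - ε) * dist x y ≤ dist (f x) (f y) ∧ dist (f x) (f y) ≤ (1 + ε) * dist x y

/-- Strict differentiability bounds f x - f y - f'(x - y) by ε ‖x - y‖ for both points free near 0,
which is what a two-sided distance estimate needs. -/
theorem HasStrictFDerivAt.isAsymptoticIsometry {E F : Type*} [NormedAddCommGroup E]
    [NormedSpace ℝ E] [NormedAddCommGroup F] [NormedSpace ℝ F] {f : E → F} {f' : E →L[ℝ] F}
    (hf : HasStrictFDerivAt f f' 0) (h : ∀ v, ‖f' v‖ = ‖v‖) : IsAsymptoticIsometry f := by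
  intro ε hε
  have h1 := hf.isLittleO.def hε
  rw [Metric.eventually_nhds_iff] at h1
  obtain ⟨r, hr, h2⟩ := h1
  refine ⟨r / 2, half_pos hr, fun x hx y hy => ?_⟩
  have h3 : ‖f x - f y - f' (x - y)‖ ≤ ε * ‖x - y‖ := by
    refine @h2 (x, y) ?_
    rw [Prod.dist_eq, max_lt_iff]
    rw [mem_closedBall] at hx hy
    exact ⟨by dsimp; linarith, by dsimp; linarith⟩
  have h4 := h (x - y)
  have h5 := abs_le.1 ((abs_norm_sub_norm_le (f x - f y) (f' (x - y))).trans h3)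
  rw [dist_eq_norm, dist_eq_norm]
  constructor <;> nlinarith

theorem euclideanHausdorffMeasure_image_le {Y Z : Type*} [MetricSpace Y] [MeasurableSpace Y]
    [BorelSpace Y] [MetricSpace Z] [MeasurableSpace Z] [BorelSpace Z] {d : ℕ} {K : ℝ} {g : Y → Z}
    {u : Set Y} (hK : 0 ≤ K) (hg : LipschitzOnWith K.toNNReal g u) :
    μHE[d] (g '' u) ≤ ENNReal.ofReal (K ^ d) * μHE[d] u := by
  have h1 := hg.hausdorffMeasure_image_le (d := d) (Nat.cast_nonneg d)
  simp only [Measure.euclideanHausdorffMeasure_def, Measure.smul_apply,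
    Measure.nnreal_smul_coe_apply]
  rw [ENNReal.ofReal_pow hK, mul_left_comm]
  gcongr
  rw [ENNReal.rpow_natCast] at h1
  exact h1

/-- On a small ball both `f` and its inverse are Lipschitz with constants near 1, and d-dimensional
Hausdorff measure scales by at most the d-th power of the constant. This plays the role of an area
formula, for arbitrary subsets and a target that is only a metric space. -/
theorem IsAsymptoticIsometry.exists_measure_image {E X : Type*} [NormedAddCommGroup E]
    [InnerProductSpace ℝ E] [FiniteDimensional ℝ E] [MeasurableSpace E] [BorelSpace E]
    [MetricSpace X] [MeasurableSpace X] [BorelSpace X] {f : E → X} (hf : IsAsymptoticIsometry f)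
    {d : ℕ} (hd : Module.finrank ℝ E = d) {ε : ℝ} (hε : 0 < ε) :
    ∃ r > 0, Set.InjOn f (closedBall 0 r) ∧ ContinuousOn f (closedBall 0 r) ∧
      ∀ s ⊆ closedBall (0 : E) r,
      ENNReal.ofReal (1 - ε) * volume s ≤ μHE[d] (f '' s) ∧
      μHE[d] (f '' s) ≤ ENNReal.ofReal (1 + ε) * volume s := by
  have hlow : ∀ᶠ t : ℝ in 𝓝[>] 0, 1 - ε ≤ (1 - t) ^ d := by
    have : Tendsto (fun t : ℝ => (1 - t) ^ d) (𝓝[>] 0) (𝓝 ((1 - 0) ^ d)) :=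
      tendsto_nhdsWithin_of_tendsto_nhds
        (Continuous.tendsto (by fun_prop) 0)
    refine this.eventually (eventually_ge_nhds ?_)
    simp [hε]
  have hup : ∀ᶠ t : ℝ in 𝓝[>] 0, (1 + t) ^ d ≤ 1 + ε := by
    have : Tendsto (fun t : ℝ => (1 + t) ^ d) (𝓝[>] 0) (𝓝 ((1 + 0) ^ d)) :=
      tendsto_nhdsWithin_of_tendsto_nhds
        (Continuous.tendsto (by fun_prop) 0)
    refine this.eventually (eventually_le_nhds ?_)
    simp [hε]
  have hlt : ∀ᶠ t : ℝ in 𝓝[>] 0, t < 1 :=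
    tendsto_nhdsWithin_of_tendsto_nhds tendsto_id |>.eventually (eventually_lt_nhds one_pos)
  obtain ⟨t, ⟨⟨hlow, hup⟩, hlt⟩, ht0⟩ := ((hlow.and hup).and hlt |>.and self_mem_nhdsWithin).exists
  obtain ⟨r, hr, hdist⟩ := hf t ht0
  have hlip : LipschitzOnWith (1 + t).toNNReal f (closedBall 0 r) := by
    refine LipschitzOnWith.of_dist_le_mul fun x hx y hy => ?_
    rw [Real.coe_toNNReal _ (by linarith)]
    exact (hdist x hx y hy).2
  have hinj : Set.InjOn f (closedBall 0 r) := by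
    intro x hx y hy hxy
    have h1 := (hdist x hx y hy).1
    rw [hxy, dist_self] at h1
    have h2 : 0 < 1 - t := by linarith
    exact dist_le_zero.1 (by nlinarith [dist_nonneg (x := x) (y := y)])
  refine ⟨r, hr, hinj, hlip.continuousOn, fun s hs => ?_⟩
  have hvol : (μHE[d] : Measure E) = volume := by
    rw [← hd, InnerProductSpace.euclideanHausdorffMeasure_eq_volume]
  constructor
  · have hpos : 0 < 1 - t := by linarith
    have hlip' : LipschitzOnWith ((1 - t)⁻¹).toNNReal (Function.invFunOn f s) (f '' s) := by
      refine LipschitzOnWith.of_dist_le_mul ?_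
      rintro _ ⟨x, hx, rfl⟩ _ ⟨y, hy, rfl⟩
      rw [(hinj.mono hs).leftInvOn_invFunOn hx, (hinj.mono hs).leftInvOn_invFunOn hy,
        Real.coe_toNNReal _ (by positivity), inv_mul_eq_div, le_div_iff₀ hpos, mul_comm]
      exact (hdist x (hs hx) y (hs hy)).1
    have h1 := euclideanHausdorffMeasure_image_le (d := d) (by positivity) hlip'
    rw [(hinj.mono hs).invFunOn_image subset_rfl, hvol] at h1
    calc ENNReal.ofReal (1 - ε) * volume s
        ≤ ENNReal.ofReal ((1 - t) ^ d) * (ENNReal.ofReal ((1 - t)⁻¹ ^ d) * μHE[d] (f '' s)) := by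
          gcongr
      _ = μHE[d] (f '' s) := by
          rw [← mul_assoc, ← ENNReal.ofReal_mul (by positivity), ← mul_pow,
            mul_inv_cancel₀ hpos.ne', one_pow, ENNReal.ofReal_one, one_mul]
  · have h1 := euclideanHausdorffMeasure_image_le (d := d) (by linarith) (hlip.mono hs)
    rw [hvol] at h1
    exact h1.trans (by gcongr)

end AsymptoticIsometry

/-! ### The Cayley transform to first order -/

section Cayley

open Metric Filter Topology

/-- The Cayley transform. -/
def cayley {R : Type*} [Ring R] [Algebra ℝ R] (Z : R) : R :=
  (1 + (1 / 2 : ℝ) • Z) * Ring.inverse (1 - (1 / 2 : ℝ) • Z)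

theorem cayley_zero {R : Type*} [Ring R] [Algebra ℝ R] : cayley (0 : R) = 1 := by
  simp [cayley]

variable {R E : Type*} [NormedRing R] [NormedAlgebra ℝ R] [FiniteDimensional ℝ R]
  [NormedAddCommGroup E] [NormedSpace ℝ E] [FiniteDimensional ℝ E]

/-- The halves in `cayley` are there for this: each factor contributes half of the identity to the
derivative at 0. -/
theorem hasStrictFDerivAt_cayley :
    HasStrictFDerivAt (cayley : R → R) (ContinuousLinearMap.id ℝ R) 0 := by
  have : CompleteSpace R := FiniteDimensional.complete ℝ R
  have h1 : HasStrictFDerivAt (fun Z : R => (1 / 2 : ℝ) • Z)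
      ((1 / 2 : ℝ) • ContinuousLinearMap.id ℝ R) 0 :=
    (hasStrictFDerivAt_id (0 : R)).const_smul (1 / 2 : ℝ)
  have h2 := h1.const_add 1
  have h3 := h1.const_sub 1
  have h4 : HasStrictFDerivAt Ring.inverse (-((ContinuousLinearMap.mulLeftRight ℝ R) 1) 1)
      (1 - (1 / 2 : ℝ) • (0 : R)) := by
    have := hasStrictFDerivAt_ringInverse (𝕜 := ℝ) (1 : Rˣ)
    simpa using this
  have h5 := h2.mul' (h4.comp (0 : R) h3)
  refine h5.congr_fderiv ?_
  ext Z
  simp [← add_smul]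
  norm_num

theorem hasStrictFDerivAt_cayley_comp (ℓ : E →ₗ[ℝ] R) :
    HasStrictFDerivAt (fun x => cayley (ℓ x)) (LinearMap.toContinuousLinearMap ℓ) 0 := by
  have h1 : HasStrictFDerivAt (cayley : R → R) (ContinuousLinearMap.id ℝ R)
      (LinearMap.toContinuousLinearMap ℓ 0) := by
    rw [map_zero]; exact hasStrictFDerivAt_cayley
  exact (h1.comp (0 : E) (LinearMap.toContinuousLinearMap ℓ).hasStrictFDerivAt).congr_fderiv
    (by ext; simp)

theorem isAsymptoticIsometry_cayley (ℓ : E →ₗ[ℝ] R) (h : ∀ x, ‖ℓ x‖ = ‖x‖) :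
    IsAsymptoticIsometry fun x => cayley (ℓ x) :=
  (hasStrictFDerivAt_cayley_comp ℓ).isAsymptoticIsometry h

theorem isAsymptoticIsometry_cayley_mul_cayley (ℓ ℓ' : E →ₗ[ℝ] R)
    (h : ∀ x, ‖ℓ x + ℓ' x‖ = ‖x‖) :
    IsAsymptoticIsometry fun x => cayley (ℓ x) * cayley (ℓ' x) := by
  refine ((hasStrictFDerivAt_cayley_comp ℓ).mul'
    (hasStrictFDerivAt_cayley_comp ℓ')).isAsymptoticIsometry fun v => ?_
  rw [← h v]
  simp [cayley_zero, add_comm]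

/-- The derivative of the conjugation orbit of `P` at the origin is the commutator with `P`, so only
the commutator has to be isometric. -/
theorem isAsymptoticIsometry_cayley_conj (ℓ : E →ₗ[ℝ] R) (P : R)
    (h : ∀ x, ‖ℓ x * P - P * ℓ x‖ = ‖x‖) :
    IsAsymptoticIsometry fun x => cayley (ℓ x) * P * cayley (-ℓ x) := by
  have h1 := hasStrictFDerivAt_cayley_comp ℓ
  have h2 := hasStrictFDerivAt_cayley_comp (-ℓ)
  refine ((h1.mul_const' P).mul' h2).isAsymptoticIsometry fun v => ?_
  rw [← h v]
  congr 1
  simp [cayley_zero]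
  abel

/-- Solutions of `π (cayley (-ℓ x) * cayley (ℓ y) * B * cayley (ℓ x)) = 0` near the origin. -/
theorem exists_solution_cayley {F : Type*} [NormedAddCommGroup F] [NormedSpace ℝ F]
    [FiniteDimensional ℝ F] (ℓ : E →ₗ[ℝ] R) (π : R →ₗ[ℝ] F) (B : R) (hB : π B = 0)
    (S : E →ₗ[ℝ] E) (T : E ≃ₗ[ℝ] F) (hT : ∀ x, T x = π (ℓ x * B - B * ℓ x))
    (hS : ∀ y, T (S y) = π (ℓ y * B)) {ε : ℝ} (hε : 0 < ε) :
    ∃ r > 0, ∀ y ∈ closedBall (0 : E) r, ∃ x, ‖x - S y‖ ≤ ε * ‖y‖ ∧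
      π (cayley (-ℓ x) * cayley (ℓ y) * B * cayley (ℓ x)) = 0 := by
  have : CompleteSpace E := FiniteDimensional.complete ℝ E
  have : CompleteSpace F := FiniteDimensional.complete ℝ F
  let Φ : E × E → F := fun p => π (cayley (-ℓ p.2) * cayley (ℓ p.1) * B * cayley (ℓ p.2))
  have h1 := hasStrictFDerivAt_cayley_comp (-(ℓ ∘ₗ LinearMap.snd ℝ E E))
  have h2 := hasStrictFDerivAt_cayley_comp (ℓ ∘ₗ LinearMap.fst ℝ E E)
  have h3 := hasStrictFDerivAt_cayley_comp (ℓ ∘ₗ LinearMap.snd ℝ E E)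
  have h4 := ((h1.mul' h2).mul_const' B).mul' h3
  have h5 := (LinearMap.toContinuousLinearMap π).hasStrictFDerivAt.comp (0 : E × E) h4
  let Q : E →L[ℝ] F := LinearMap.toContinuousLinearMap
    (T.toLinearMap ∘ₗ S)
  let T' : E ≃L[ℝ] F := T.toContinuousLinearEquiv
  -- The derivative at the origin is (y, x) ↦ T (S y) - T x. The implicit function therefore has
  -- derivative `S`, and the bound on `x - S y` is the definition of that derivative.
  have hΦ : HasStrictFDerivAt Φ
      (Q.coprod (-(T' : E →L[ℝ] F))) (0 : E × E) := by
    refine h5.congr_fderiv ?_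
    ext v
    · simp [Q, cayley_zero, hS]
    · simp [T', cayley_zero, hT]
      abel
  have hinv : (Q.coprod (-(T' : E →L[ℝ] F)) ∘L ContinuousLinearMap.inr ℝ E E).IsInvertible := by
    refine ⟨T'.trans (ContinuousLinearEquiv.neg ℝ), ?_⟩
    ext v
    simp
  have hd := hΦ.hasStrictFDerivAt_implicitFunctionOfProdDomain hinv
  have hz := (hΦ.eventually_apply_eq_iff_implicitFunctionOfProdDomain hinv)
  set ψ := hΦ.implicitFunctionOfProdDomain hinv with hψ
  have hψ0 : ψ 0 = 0 := hz.self_of_nhds.1 rfl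
  have hΦ0 : Φ 0 = 0 := by simp [Φ, cayley_zero, hB]
  have hsol : ∀ᶠ y in 𝓝 (0 : E), Φ (y, ψ y) = 0 := by
    have hc : Tendsto (fun y => (y, ψ y)) (𝓝 (0 : E)) (𝓝 (0 : E × E)) := by
      have h0 : ContinuousAt ψ 0 := hd.continuousAt
      have := continuousAt_id.prodMk h0
      rw [ContinuousAt, hψ0] at this
      exact this
    filter_upwards [hc.eventually hz] with y hy
    rw [hy.2 rfl, hΦ0]
  have hder : ∀ v, (-(Q.coprod (-(T' : E →L[ℝ] F)) ∘L ContinuousLinearMap.inr ℝ E E).inverse ∘L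
      (Q.coprod (-(T' : E →L[ℝ] F)) ∘L ContinuousLinearMap.inl ℝ E E)) v = S v := by
    intro v
    have h6 : Q.coprod (-(T' : E →L[ℝ] F)) ∘L ContinuousLinearMap.inr ℝ E E =
      ((T'.trans (ContinuousLinearEquiv.neg ℝ) : E ≃L[ℝ] F) : E →L[ℝ] F) := by
      ext v; simp
    rw [h6, ContinuousLinearMap.inverse_equiv]
    simp [Q, T']
  have hlo := hd.hasFDerivAt.isLittleO.def hε
  have hev := hsol.and hlo
  rw [Metric.eventually_nhds_iff_ball] at hev
  obtain ⟨r, hr, hball⟩ := hev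
  refine ⟨r / 2, half_pos hr, fun y hy => ⟨ψ y, ?_, ?_⟩⟩
  · have h7 := (hball y (closedBall_subset_ball (by linarith) hy)).2
    rw [← hder]
    simpa [hψ0] using h7
  · exact (hball y (closedBall_subset_ball (by linarith) hy)).1

end Cayley

/-! ### The Cayley transform of skew-symmetric matrices -/

section SkewCayley

open Matrix

variable {n : ℕ}

/-- Skew-symmetry gives v · Z v = 0, so (1 + Z) v = 0 forces v · v = 0. -/
theorem isUnit_det_one_add_of_skew {Z : Matrix (Fin n) (Fin n) ℝ} (hZ : Zᵀ = -Z) :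
    IsUnit (1 + Z).det := by
  rw [isUnit_iff_ne_zero]
  intro h0
  obtain ⟨v, hv, hv0⟩ := exists_mulVec_eq_zero_iff.2 h0
  rw [add_mulVec, one_mulVec] at hv0
  have h1 : v ⬝ᵥ (Z *ᵥ v) = 0 := by
    have h2 : v ⬝ᵥ (Z *ᵥ v) = -(v ⬝ᵥ (Z *ᵥ v)) := by
      conv_lhs => rw [dotProduct_mulVec, ← mulVec_transpose, hZ, neg_mulVec, neg_dotProduct,
        dotProduct_comm]
    linarith
  have h3 := congrArg (v ⬝ᵥ ·) hv0
  simp only [dotProduct_add, h1, add_zero, dotProduct_zero] at h3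
  exact hv (dotProduct_self_eq_zero.1 h3)

theorem half_skew {Z : Matrix (Fin n) (Fin n) ℝ} (hZ : Zᵀ = -Z) :
    ((1 / 2 : ℝ) • Z)ᵀ = -((1 / 2 : ℝ) • Z) := by
  rw [transpose_smul, hZ, smul_neg]

theorem isUnit_det_one_sub_half {Z : Matrix (Fin n) (Fin n) ℝ} (hZ : Zᵀ = -Z) :
    IsUnit (1 - (1 / 2 : ℝ) • Z).det := by
  rw [sub_eq_add_neg]
  refine isUnit_det_one_add_of_skew ?_
  rw [transpose_neg, half_skew hZ]

theorem cayley_eq (Z : Matrix (Fin n) (Fin n) ℝ) :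
    cayley Z = (1 + (1 / 2 : ℝ) • Z) * (1 - (1 / 2 : ℝ) • Z)⁻¹ := by
  rw [cayley, nonsing_inv_eq_ringInverse]

theorem cayley_neg_mul_cayley {Z : Matrix (Fin n) (Fin n) ℝ} (hZ : Zᵀ = -Z) :
    cayley (-Z) * cayley Z = 1 := by
  have h1 := isUnit_det_one_sub_half hZ
  have h2 := isUnit_det_one_add_of_skew (half_skew hZ)
  rw [cayley_eq, cayley_eq, smul_neg, sub_neg_eq_add, ← sub_eq_add_neg]
  set Y := (1 / 2 : ℝ) • Z
  rw [Matrix.mul_assoc, nonsing_inv_mul_cancel_left _ _ h2, mul_nonsing_inv _ h1]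

theorem transpose_cayley {Z : Matrix (Fin n) (Fin n) ℝ} (hZ : Zᵀ = -Z) :
    (cayley Z)ᵀ = cayley (-Z) := by
  have h2 := isUnit_det_one_add_of_skew (half_skew hZ)
  rw [cayley_eq, cayley_eq, transpose_mul, transpose_nonsing_inv, transpose_add, transpose_sub,
    half_skew hZ, transpose_one, smul_neg, sub_neg_eq_add, ← sub_eq_add_neg]
  set Y := (1 / 2 : ℝ) • Z
  have h3 : (1 + Y) * (1 - Y) = (1 - Y) * (1 + Y) := by noncomm_ring
  calc (1 + Y)⁻¹ * (1 - Y) = (1 + Y)⁻¹ * ((1 - Y) * (1 + Y)) * (1 + Y)⁻¹ := by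
        rw [Matrix.mul_assoc, Matrix.mul_assoc, mul_nonsing_inv _ h2, Matrix.mul_one]
    _ = (1 - Y) * (1 + Y)⁻¹ := by rw [← h3, nonsing_inv_mul_cancel_left _ _ h2]

theorem cayley_mem_orthogonalGroup {Z : Matrix (Fin n) (Fin n) ℝ} (hZ : Zᵀ = -Z) :
    cayley Z ∈ orthogonalGroup (Fin n) ℝ := by
  rw [mem_orthogonalGroup_iff', transpose_cayley hZ, cayley_neg_mul_cayley hZ]

theorem continuous_cayley {X : Type*} [TopologicalSpace X] {Z : X → Matrix (Fin n) (Fin n) ℝ}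
    (hc : Continuous Z) (hZ : ∀ x, (Z x)ᵀ = -Z x) : Continuous fun x => cayley (Z x) := by
  simp_rw [cayley_eq, inv_def, Ring.inverse_eq_inv']
  have h0 : Continuous fun x => (1 / 2 : ℝ) • Z x := hc.const_smul (1 / 2 : ℝ)
  have h1 : Continuous fun x => 1 - (1 / 2 : ℝ) • Z x := continuous_const.sub h0
  refine (continuous_const.add h0).matrix_mul ?_
  exact (h1.matrix_det.inv₀ fun x => (isUnit_det_one_sub_half (hZ x)).ne_zero).smul
    h1.matrix_adjugate

/-- The inverse of the Cayley transform. -/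
def invCayley (U : Matrix (Fin n) (Fin n) ℝ) : Matrix (Fin n) (Fin n) ℝ :=
  (2 : ℝ) • ((U - 1) * (U + 1)⁻¹)

theorem cayley_invCayley {U : Matrix (Fin n) (Fin n) ℝ} (hU : IsUnit (U + 1).det) :
    cayley (invCayley U) = U := by
  have h1 : 1 + (U - 1) * (U + 1)⁻¹ = (2 : ℝ) • (U * (U + 1)⁻¹) := by
    calc 1 + (U - 1) * (U + 1)⁻¹ = ((U + 1) + (U - 1)) * (U + 1)⁻¹ := by
          rw [Matrix.add_mul, mul_nonsing_inv _ hU]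
      _ = _ := by rw [← Matrix.smul_mul, two_smul]; congr 1; abel
  have h2 : 1 - (U - 1) * (U + 1)⁻¹ = (2 : ℝ) • (U + 1)⁻¹ := by
    calc 1 - (U - 1) * (U + 1)⁻¹ = ((U + 1) - (U - 1)) * (U + 1)⁻¹ := by
          rw [Matrix.sub_mul (U + 1), mul_nonsing_inv _ hU]
      _ = ((2 : ℝ) • (1 : Matrix (Fin n) (Fin n) ℝ)) * (U + 1)⁻¹ := by
          rw [two_smul]; congr 1; abel
      _ = _ := by rw [Matrix.smul_mul, Matrix.one_mul]
  rw [cayley_eq, invCayley, smul_smul]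
  norm_num
  rw [h1, h2]
  have h3 : ((2 : ℝ) • (U + 1)⁻¹)⁻¹ = (2 : ℝ)⁻¹ • (U + 1) := by
    apply inv_eq_right_inv
    rw [Matrix.smul_mul, Matrix.mul_smul, smul_smul, nonsing_inv_mul _ hU]
    norm_num
  rw [h3, Matrix.smul_mul, Matrix.mul_smul, smul_smul, Matrix.mul_assoc, nonsing_inv_mul _ hU]
  norm_num

theorem transpose_invCayley {U : Matrix (Fin n) (Fin n) ℝ} (hU : U * Uᵀ = 1)
    (h1 : IsUnit (U + 1).det) : (invCayley U)ᵀ = -invCayley U := by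
  have hU' : Uᵀ * U = 1 := mul_eq_one_comm.1 hU
  have h2 : (Uᵀ + 1) = Uᵀ * (U + 1) := by rw [Matrix.mul_add, hU', Matrix.mul_one, add_comm]
  have h3 : (Uᵀ - 1) = -(Uᵀ * (U - 1)) := by
    rw [Matrix.mul_sub, hU', Matrix.mul_one, neg_sub]
  have h4 : IsUnit (Uᵀ + 1).det := by
    have : Uᵀ + 1 = (U + 1)ᵀ := by simp
    rwa [this, det_transpose]
  rw [invCayley, transpose_smul, transpose_mul, transpose_nonsing_inv, transpose_add,
    transpose_sub, transpose_one, ← smul_neg]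
  congr 1
  have h5 : (Uᵀ + 1) * (-((U - 1) * (U + 1)⁻¹)) = Uᵀ - 1 := by
    have h6 : (U + 1) * (U - 1) = (U - 1) * (U + 1) := by noncomm_ring
    rw [h2, h3, Matrix.mul_neg, Matrix.mul_assoc, ← Matrix.mul_assoc (U + 1), h6, Matrix.mul_assoc,
      mul_nonsing_inv _ h1, Matrix.mul_one]
  rw [← h5, nonsing_inv_mul_cancel_left _ _ h4]

/-- The inverse Cayley transform commutes with conjugation and turns transposition of an orthogonal
matrix into negation. With `R` a reflection this will force the generator to be block off-diagonal.
-/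
theorem cayley_conj {R : Matrix (Fin n) (Fin n) ℝ} (hR : R * R = 1)
    {U : Matrix (Fin n) (Fin n) ℝ} (hU : U * Uᵀ = 1) (h1 : IsUnit (U + 1).det)
    (h : R * U * R = Uᵀ) : R * invCayley U * R = -invCayley U := by
  rw [← transpose_invCayley hU h1, invCayley]
  have hRR : ∀ M N : Matrix (Fin n) (Fin n) ℝ, R * (M * N) * R = (R * M * R) * (R * N * R) := by
    intro M N
    rw [show (R * M * R) * (R * N * R) = R * M * (R * R) * N * R by simp only [Matrix.mul_assoc],
      hR, Matrix.mul_one]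
    simp only [Matrix.mul_assoc]
  have h2 : R * (U - 1) * R = Uᵀ - 1 := by
    rw [Matrix.mul_sub, Matrix.sub_mul, h, Matrix.mul_one, hR]
  have h3 : R * (U + 1)⁻¹ * R = (Uᵀ + 1)⁻¹ := by
    symm
    apply inv_eq_right_inv
    have : Uᵀ + 1 = R * (U + 1) * R := by
      rw [Matrix.mul_add, Matrix.add_mul, h, Matrix.mul_one, hR]
    rw [this, ← hRR, mul_nonsing_inv _ h1, Matrix.mul_one, hR]
  have h4 : IsUnit (Uᵀ + 1).det := by
    have : Uᵀ + 1 = (U + 1)ᵀ := by simp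
    rwa [this, det_transpose]
  rw [Matrix.mul_smul, Matrix.smul_mul, hRR, h2, h3, transpose_smul, transpose_mul,
    transpose_nonsing_inv, transpose_add, transpose_sub, transpose_one]
  congr 1
  have h6 : (Uᵀ + 1) * (Uᵀ - 1) = (Uᵀ - 1) * (Uᵀ + 1) := by noncomm_ring
  calc (Uᵀ - 1) * (Uᵀ + 1)⁻¹ = (Uᵀ + 1)⁻¹ * ((Uᵀ + 1) * (Uᵀ - 1)) * (Uᵀ + 1)⁻¹ := by
        rw [nonsing_inv_mul_cancel_left _ _ h4]
    _ = _ := by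
        rw [h6, Matrix.mul_assoc, Matrix.mul_assoc, mul_nonsing_inv _ h4, Matrix.mul_one]

theorem continuousAt_invCayley : ContinuousAt (invCayley (n := n)) 1 := by
  have h1 : ContinuousAt (fun U : Matrix (Fin n) (Fin n) ℝ => (U + 1)⁻¹) 1 := by
    simp_rw [inv_def, Ring.inverse_eq_inv']
    have hc : Continuous fun U : Matrix (Fin n) (Fin n) ℝ => U + 1 :=
      continuous_id.add continuous_const
    refine (hc.matrix_det.continuousAt.inv₀ ?_).smul hc.matrix_adjugate.continuousAt
    rw [show (1 : Matrix (Fin n) (Fin n) ℝ) + 1 = (2 : ℝ) • 1 by rw [two_smul], det_smul]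
    simp
  exact ContinuousAt.const_smul ((continuousAt_id.sub continuousAt_const).mul h1) (2 : ℝ)

theorem invCayley_one : invCayley (1 : Matrix (Fin n) (Fin n) ℝ) = 0 := by
  simp [invCayley]

end SkewCayley

/-! ### Charts of the orthogonal group and the Grassmannian -/

section Charts

open Matrix

attribute [local instance] Matrix.frobeniusNormedAddCommGroup Matrix.frobeniusNormedSpace
  Matrix.frobeniusNormedRing Matrix.frobeniusNormedAlgebra

theorem frobenius_norm_sq {ι κ : Type*} [Fintype ι] [Fintype κ] (M : Matrix ι κ ℝ) :
    ‖M‖ ^ 2 = ∑ i, ∑ j, M i j ^ 2 := by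
  rw [frobenius_norm_def, ← Real.rpow_natCast, ← Real.rpow_mul (by positivity)]
  simp

variable {k m n : ℕ}

theorem frobenius_norm_sq_blk (a : Matrix (Fin k) (Fin k) ℝ) (b : Matrix (Fin k) (Fin m) ℝ)
    (c : Matrix (Fin m) (Fin k) ℝ) (d : Matrix (Fin m) (Fin m) ℝ) :
    ‖blk a b c d‖ ^ 2 = (∑ i, ∑ j, a i j ^ 2) + (∑ i, ∑ j, b i j ^ 2) + (∑ i, ∑ j, c i j ^ 2) +
      ∑ i, ∑ j, d i j ^ 2 := by
  rw [frobenius_norm_sq]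
  simp only [Fin.sum_univ_add, blk, submatrix_apply, finSumFinEquiv_symm_apply_castAdd,
    finSumFinEquiv_symm_apply_natAdd, fromBlocks_apply₁₁, fromBlocks_apply₁₂, fromBlocks_apply₂₁,
    fromBlocks_apply₂₂, Finset.sum_add_distrib]
  ring

/-- Pairs `i < j` of indices. -/
abbrev LtPair (n : ℕ) := {p : Fin n × Fin n // p.1 < p.2}

theorem sum_prod_eq_of_symm (f : Fin n → Fin n → ℝ) (h0 : ∀ i, f i i = 0)
    (hs : ∀ i j, f i j = f j i) : ∑ i, ∑ j, f i j = 2 * ∑ p : LtPair n, f p.1.1 p.1.2 := by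
  classical
  have h1 : ∑ p : LtPair n, f p.1.1 p.1.2 =
      ∑ p ∈ (Finset.univ : Finset (Fin n × Fin n)).filter (fun p => p.1 < p.2), f p.1 p.2 :=
    (Finset.sum_subtype _ (by simp) (fun p : Fin n × Fin n => f p.1 p.2)).symm
  have h2 : ∑ p ∈ (Finset.univ : Finset (Fin n × Fin n)).filter (fun p => p.2 < p.1), f p.1 p.2 =
      ∑ p ∈ (Finset.univ : Finset (Fin n × Fin n)).filter (fun p => p.1 < p.2), f p.1 p.2 :=
    Finset.sum_nbij' Prod.swap Prod.swap (by simp) (by simp) (by simp) (by simp)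
      (fun p _ => hs _ _)
  rw [h1, two_mul, ← Fintype.sum_prod_type']
  conv_lhs => rw [← Finset.sum_filter_add_sum_filter_not _ (fun p : Fin n × Fin n => p.1 < p.2)]
  congr 1
  rw [← h2]
  symm
  refine Finset.sum_subset (fun p hp => ?_) (fun p hp hp' => ?_)
  · simp only [Finset.mem_filter, Finset.mem_univ, true_and] at hp ⊢
    exact not_lt.2 hp.le
  · simp only [Finset.mem_filter, Finset.mem_univ, true_and, not_lt] at hp hp'
    rw [le_antisymm hp hp', h0]

theorem card_ltPair (n : ℕ) : Fintype.card (LtPair n) = n * (n - 1) / 2 := by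
  have h := sum_prod_eq_of_symm (n := n) (fun i j => if i = j then 0 else 1) (by simp)
    (by intro i j; simp [eq_comm])
  have h1 : ∀ i : Fin n, ∑ j : Fin n, (if i = j then (0 : ℝ) else 1) = n - 1 := by
    intro i
    have : ∀ j : Fin n, (if i = j then (0 : ℝ) else 1) = 1 - if i = j then 1 else 0 := by
      intro j; split_ifs <;> simp
    simp [this]
  have h2 : ∀ p : LtPair n, (if p.1.1 = p.1.2 then (0 : ℝ) else 1) = 1 := fun p =>
    if_neg p.2.ne
  simp only [h1, h2, Finset.sum_const, Finset.card_univ, nsmul_eq_mul, mul_one,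
    Fintype.card_fin] at h
  rcases n with _ | n
  · simp
  · have h3 : (n + 1) * n = 2 * Fintype.card (LtPair (n + 1)) := by
      have : (((n + 1) * n : ℕ) : ℝ) = ((2 * Fintype.card (LtPair (n + 1)) : ℕ) : ℝ) := by
        push_cast at h ⊢
        linarith
      exact_mod_cast this
    rw [Nat.add_sub_cancel, h3]
    simp

/-- Isometric coordinates on skew-symmetric matrices. -/
def skewMat (n : ℕ) : EuclideanSpace ℝ (LtPair n) →ₗ[ℝ] Matrix (Fin n) (Fin n) ℝ where
  -- Each coordinate occurs twice in the matrix, so the factor 1/√2 makes the Frobenius norm equal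
  -- to the Euclidean norm.
  toFun z := of fun i j => if h : i < j then (√2)⁻¹ * z ⟨(i, j), h⟩ else
    if h : j < i then -((√2)⁻¹ * z ⟨(j, i), h⟩) else 0
  map_add' z w := by
    ext i j
    simp only [of_apply, Matrix.add_apply, PiLp.add_apply]
    split_ifs <;> ring
  map_smul' r z := by
    ext i j
    simp only [of_apply, Matrix.smul_apply, PiLp.smul_apply, RingHom.id_apply, smul_eq_mul]
    split_ifs <;> ring

theorem skewMat_apply (z : EuclideanSpace ℝ (LtPair n)) (i j : Fin n) :
    skewMat n z i j = if h : i < j then (√2)⁻¹ * z ⟨(i, j), h⟩ else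
      if h : j < i then -((√2)⁻¹ * z ⟨(j, i), h⟩) else 0 := rfl

theorem transpose_skewMat (z : EuclideanSpace ℝ (LtPair n)) :
    (skewMat n z)ᵀ = -skewMat n z := by
  ext i j
  rw [transpose_apply, Matrix.neg_apply, skewMat_apply, skewMat_apply]
  rcases lt_trichotomy i j with h | h | h
  · simp [h, h.not_gt]
  · simp [h]
  · simp [h, h.not_gt]

theorem sum_skewMat_sq (z : EuclideanSpace ℝ (LtPair n)) :
    ∑ i, ∑ j, skewMat n z i j ^ 2 = ‖z‖ ^ 2 := by
  rw [sum_prod_eq_of_symm]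
  · rw [EuclideanSpace.real_norm_sq_eq, Finset.mul_sum]
    refine Finset.sum_congr rfl fun p _ => ?_
    rw [skewMat_apply, dif_pos p.2, mul_pow, inv_pow, Real.sq_sqrt (by norm_num)]
    ring
  · intro i; simp [skewMat_apply]
  · intro i j
    have := congrFun (congrFun (transpose_skewMat z) i) j
    rw [transpose_apply, Matrix.neg_apply] at this
    rw [this, neg_sq]

theorem exists_skewMat_eq {Z : Matrix (Fin n) (Fin n) ℝ} (hZ : Zᵀ = -Z) :
    ∃ z, skewMat n z = Z := by
  refine ⟨WithLp.toLp 2 fun p => √2 * Z p.1.1 p.1.2, ?_⟩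
  have h : ∀ i j, Z j i = -Z i j := fun i j => congrFun (congrFun hZ i) j
  ext i j
  rw [skewMat_apply]
  rcases lt_trichotomy i j with hij | hij | hij
  · simp [hij]
  · subst hij
    simp only [lt_irrefl, dite_false]
    linarith [h i i]
  · simp [hij, hij.not_gt, h i j]

/-- Scaled coordinates on off-diagonal blocks. -/
def offMat (k m : ℕ) : EuclideanSpace ℝ (Fin k × Fin m) →ₗ[ℝ] Matrix (Fin m) (Fin k) ℝ where
  toFun y := of fun i j => (√2)⁻¹ * y (j, i)
  map_add' y w := by
    ext i j
    simp only [of_apply, Matrix.add_apply, PiLp.add_apply]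
    ring
  map_smul' r y := by
    ext i j
    simp only [of_apply, Matrix.smul_apply, PiLp.smul_apply, RingHom.id_apply, smul_eq_mul]
    ring

theorem offMat_apply (y : EuclideanSpace ℝ (Fin k × Fin m)) (i : Fin m) (j : Fin k) :
    offMat k m y i j = (√2)⁻¹ * y (j, i) := rfl

theorem sum_offMat_sq (y : EuclideanSpace ℝ (Fin k × Fin m)) :
    2 * ∑ i, ∑ j, offMat k m y i j ^ 2 = ‖y‖ ^ 2 := by
  rw [EuclideanSpace.real_norm_sq_eq, Fintype.sum_prod_type, Finset.sum_comm]
  simp only [offMat_apply, mul_pow, inv_pow, ← Finset.mul_sum]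
  rw [Real.sq_sqrt (by norm_num)]
  ring

/-- The skew-symmetric matrix with the given off-diagonal blocks. -/
def offSkew (k m : ℕ) :
    EuclideanSpace ℝ (Fin k × Fin m) →ₗ[ℝ] Matrix (Fin (k + m)) (Fin (k + m)) ℝ where
  toFun y := blk 0 (-(offMat k m y)ᵀ) (offMat k m y) 0
  map_add' y w := by
    rw [map_add, blk_add, transpose_add, neg_add, add_zero, add_zero]
  map_smul' r y := by
    simp [blk_smul]

theorem offSkew_apply (y : EuclideanSpace ℝ (Fin k × Fin m)) :
    offSkew k m y = blk 0 (-(offMat k m y)ᵀ) (offMat k m y) 0 := rfl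

theorem transpose_offSkew (y : EuclideanSpace ℝ (Fin k × Fin m)) :
    (offSkew k m y)ᵀ = -offSkew k m y := by
  simp [offSkew_apply, blk_transpose, blk_neg]

/-- The rotation with off-diagonal generator `y`. -/
def rot (y : EuclideanSpace ℝ (Fin k × Fin m)) : orthogonalGroup (Fin (k + m)) ℝ :=
  ⟨cayley (offSkew k m y), cayley_mem_orthogonalGroup (transpose_offSkew y)⟩

/-- The Cayley chart of the orthogonal group. -/
def cayleyChart (z : EuclideanSpace ℝ (LtPair n)) : orthogonalGroup (Fin n) ℝ :=
  ⟨cayley (skewMat n z), cayley_mem_orthogonalGroup (transpose_skewMat z)⟩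

theorem rot_zero : rot (0 : EuclideanSpace ℝ (Fin k × Fin m)) = 1 := by
  apply Subtype.ext
  change cayley (offSkew k m 0) = 1
  rw [map_zero, cayley_zero]

theorem continuous_skewMat : Continuous fun z => skewMat n z := by
  refine continuous_pi fun i => continuous_pi fun j => ?_
  simp_rw [skewMat_apply]
  split_ifs <;> fun_prop

theorem continuous_offMat : Continuous fun y => offMat k m y := by
  refine continuous_pi fun i => continuous_pi fun j => ?_
  simp_rw [offMat_apply]
  fun_prop

theorem continuous_offSkew : Continuous fun y => offSkew k m y := by
  simp_rw [offSkew_apply, blk]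
  exact (Continuous.matrix_fromBlocks continuous_const continuous_offMat.matrix_transpose.neg
    continuous_offMat continuous_const).matrix_submatrix _ _

theorem continuous_rot :
    Continuous (rot : EuclideanSpace ℝ (Fin k × Fin m) → orthogonalGroup (Fin (k + m)) ℝ) :=
  Continuous.subtype_mk (continuous_cayley continuous_offSkew transpose_offSkew) _

theorem continuous_cayleyChart :
    Continuous (cayleyChart : EuclideanSpace ℝ (LtPair n) → orthogonalGroup (Fin n) ℝ) :=
  Continuous.subtype_mk (continuous_cayley continuous_skewMat transpose_skewMat) _

theorem isAsymptoticIsometry_cayleyChart :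
    IsAsymptoticIsometry (cayleyChart : EuclideanSpace ℝ (LtPair n) → orthogonalGroup (Fin n) ℝ) :=
  isAsymptoticIsometry_cayley (skewMat n) fun z => by
    rw [← sq_eq_sq₀ (norm_nonneg _) (norm_nonneg _), frobenius_norm_sq, sum_skewMat_sq]

theorem transpose_rot (y : EuclideanSpace ℝ (Fin k × Fin m)) :
    (rot y).1ᵀ = cayley (-offSkew k m y) :=
  transpose_cayley (transpose_offSkew y)

/-- The chart of the Grassmannian at the plane of the first `k` coordinates. -/
def grassChart (y : EuclideanSpace ℝ (Fin k × Fin m)) : Grass (k + m) k :=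
  planeOf (rot y)

/-- The commutator of an off-diagonal skew generator with the coordinate projection is the symmetric
matrix with the same lower left block, so its Frobenius norm is again ‖y‖. -/
theorem isAsymptoticIsometry_grassChart :
    IsAsymptoticIsometry
      (grassChart : EuclideanSpace ℝ (Fin k × Fin m) → Grass (k + m) k) := by
  have h := isAsymptoticIsometry_cayley_conj (offSkew k m)
    (blk (1 : Matrix (Fin k) (Fin k) ℝ) 0 0 (0 : Matrix (Fin m) (Fin m) ℝ)) fun y => by
      rw [← sq_eq_sq₀ (norm_nonneg _) (norm_nonneg _), offSkew_apply, blk_mul, blk_mul, blk_sub,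
        frobenius_norm_sq_blk, ← sum_offMat_sq]
      simp
      rw [Finset.sum_comm]
      ring
  have h' : (fun y => projMatrix (grassChart y : Grass (k + m) k)) = fun y =>
      cayley (offSkew k m y) * blk 1 0 0 0 * cayley (-offSkew k m y) := by
    ext1 y
    rw [grassChart, projMatrix_planeOf, transpose_rot]
    rfl
  rw [← h'] at h
  exact h

/-- A chart of the orthogonal group adapted to the fibration over the Grassmannian. -/
def fibredChart (w : EuclideanSpace ℝ ((Fin k × Fin m) ⊕ (LtPair k ⊕ LtPair m))) :
    orthogonalGroup (Fin (k + m)) ℝ :=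
  rot (WithLp.toLp 2 fun i => w (Sum.inl i)) *
    blkO (cayleyChart (WithLp.toLp 2 fun i => w (Sum.inr (Sum.inl i))),
      cayleyChart (WithLp.toLp 2 fun i => w (Sum.inr (Sum.inr i))))

theorem cayley_blk {Z : Matrix (Fin k) (Fin k) ℝ} {Z' : Matrix (Fin m) (Fin m) ℝ}
    (hZ : Zᵀ = -Z) (hZ' : Z'ᵀ = -Z') :
    cayley (blk Z 0 0 Z') = blk (cayley Z) 0 0 (cayley Z') := by
  have h1 := isUnit_det_one_sub_half hZ
  have h2 := isUnit_det_one_sub_half hZ'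
  rw [cayley_eq, cayley_eq, cayley_eq, ← blk_one, blk_smul, smul_zero, smul_zero, blk_sub, blk_add,
    sub_zero, sub_zero, add_zero, add_zero]
  have h3 : (blk (1 - (1 / 2 : ℝ) • Z) 0 0 (1 - (1 / 2 : ℝ) • Z'))⁻¹ =
      blk (1 - (1 / 2 : ℝ) • Z)⁻¹ 0 0 (1 - (1 / 2 : ℝ) • Z')⁻¹ := by
    apply inv_eq_right_inv
    rw [blk_mul, mul_nonsing_inv _ h1, mul_nonsing_inv _ h2]
    simp [blk_one]
  rw [h3, blk_mul]
  simp

/-- The derivative at the origin is the sum of an off-diagonal and a block diagonal matrix. These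
are orthogonal, so their squared norms add up to ‖w‖². -/
theorem isAsymptoticIsometry_fibredChart :
    IsAsymptoticIsometry (fibredChart :
      EuclideanSpace ℝ ((Fin k × Fin m) ⊕ (LtPair k ⊕ LtPair m)) →
        orthogonalGroup (Fin (k + m)) ℝ) := by
  let ℓ : EuclideanSpace ℝ ((Fin k × Fin m) ⊕ (LtPair k ⊕ LtPair m)) →ₗ[ℝ]
      Matrix (Fin (k + m)) (Fin (k + m)) ℝ :=
    { toFun := fun w => offSkew k m (WithLp.toLp 2 fun i => w (Sum.inl i))
      map_add' := fun v w => by rw [← map_add]; rfl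
      map_smul' := fun r w => by rw [RingHom.id_apply, ← map_smul]; rfl }
  let ℓ' : EuclideanSpace ℝ ((Fin k × Fin m) ⊕ (LtPair k ⊕ LtPair m)) →ₗ[ℝ]
      Matrix (Fin (k + m)) (Fin (k + m)) ℝ :=
    { toFun := fun w => blk (skewMat k (WithLp.toLp 2 fun i => w (Sum.inr (Sum.inl i)))) 0 0
        (skewMat m (WithLp.toLp 2 fun i => w (Sum.inr (Sum.inr i))))
      map_add' := fun v w => by
        rw [blk_add, ← map_add, ← map_add, add_zero, add_zero]; rfl
      map_smul' := fun r w => by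
        rw [RingHom.id_apply, blk_smul, ← map_smul, ← map_smul, smul_zero, smul_zero]; rfl }
  have h := isAsymptoticIsometry_cayley_mul_cayley ℓ ℓ' fun w => by
    rw [← sq_eq_sq₀ (norm_nonneg _) (norm_nonneg _)]
    simp only [ℓ, ℓ', LinearMap.coe_mk, AddHom.coe_mk]
    rw [offSkew_apply, blk_add, frobenius_norm_sq_blk, zero_add, zero_add, add_zero, add_zero,
      sum_skewMat_sq, sum_skewMat_sq, EuclideanSpace.real_norm_sq_eq w]
    have h1 := sum_offMat_sq (k := k) (m := m) (WithLp.toLp 2 fun i => w (Sum.inl i))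
    simp only [EuclideanSpace.real_norm_sq_eq] at h1 ⊢
    simp only [Matrix.neg_apply, transpose_apply, neg_sq, Fintype.sum_sum_type]
    rw [← h1, Finset.sum_comm]
    ring
  have h' : (fun w => (fibredChart w : orthogonalGroup (Fin (k + m)) ℝ).1) =
      fun w => cayley (ℓ w) * cayley (ℓ' w) := by
    ext1 w
    simp only [ℓ', LinearMap.coe_mk, AddHom.coe_mk]
    rw [cayley_blk (transpose_skewMat _) (transpose_skewMat _)]
    rfl
  rw [← h'] at h
  exact h

end Charts

/-! ### Invariance and finiteness of the volumes -/

section Invariance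

open Matrix Topology

attribute [local instance] Matrix.frobeniusNormedAddCommGroup Matrix.frobeniusNormedSpace
  Matrix.frobeniusNormedRing Matrix.frobeniusNormedAlgebra

variable {n k m : ℕ}

theorem frobenius_norm_sq_eq_trace (X : Matrix (Fin n) (Fin n) ℝ) : ‖X‖ ^ 2 = (Xᵀ * X).trace := by
  rw [frobenius_norm_sq, Finset.sum_comm]
  simp [trace, mul_apply, sq]

theorem frobenius_norm_orthogonal_mul (V : orthogonalGroup (Fin n) ℝ)
    (X : Matrix (Fin n) (Fin n) ℝ) : ‖V.1 * X‖ = ‖X‖ := by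
  rw [← sq_eq_sq₀ (norm_nonneg _) (norm_nonneg _), frobenius_norm_sq_eq_trace,
    frobenius_norm_sq_eq_trace, transpose_mul, Matrix.mul_assoc, ← Matrix.mul_assoc _ᵀ V.1,
    orthogonalGroup_transpose_mul_self, Matrix.one_mul]

theorem frobenius_norm_mul_orthogonal (V : orthogonalGroup (Fin n) ℝ)
    (X : Matrix (Fin n) (Fin n) ℝ) : ‖X * V.1‖ = ‖X‖ := by
  rw [← frobenius_norm_transpose, transpose_mul, ← orthogonalGroup_coe_inv,
    frobenius_norm_orthogonal_mul, frobenius_norm_transpose]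

theorem orthogonal_dist_eq (U V : orthogonalGroup (Fin n) ℝ) : dist U V = ‖U.1 - V.1‖ :=
  dist_eq_norm U.1 V.1

theorem measurePreserving_of_isometry_equiv (e : orthogonalGroup (Fin n) ℝ ≃ orthogonalGroup (Fin n) ℝ)
    (he : ∀ U V, dist (e U) (e V) = dist U V) :
    MeasurePreserving e (orthogonalVolume n) (orthogonalVolume n) :=
  (IsometryEquiv.mk e (Isometry.of_dist_eq he)).measurePreserving_euclideanHausdorffMeasure _

instance orthogonalVolume_isMulLeftInvariant : (orthogonalVolume n).IsMulLeftInvariant :=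
  ⟨fun V => (measurePreserving_of_isometry_equiv (Equiv.mulLeft V) fun U W => by
    rw [orthogonal_dist_eq, orthogonal_dist_eq]
    change ‖V.1 * U.1 - V.1 * W.1‖ = _
    rw [← Matrix.mul_sub, frobenius_norm_orthogonal_mul]).map_eq⟩

instance orthogonalVolume_isMulRightInvariant : (orthogonalVolume n).IsMulRightInvariant :=
  ⟨fun V => (measurePreserving_of_isometry_equiv (Equiv.mulRight V) fun U W => by
    rw [orthogonal_dist_eq, orthogonal_dist_eq]
    change ‖U.1 * V.1 - W.1 * V.1‖ = _
    rw [← Matrix.sub_mul, frobenius_norm_mul_orthogonal]).map_eq⟩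

instance orthogonalVolume_isInvInvariant : (orthogonalVolume n).IsInvInvariant :=
  ⟨(measurePreserving_of_isometry_equiv (Equiv.inv _) fun U W => by
    rw [orthogonal_dist_eq, orthogonal_dist_eq]
    change ‖U.1ᵀ - W.1ᵀ‖ = _
    rw [← transpose_sub, frobenius_norm_transpose]).map_eq⟩

theorem finrank_euclideanSpace_ltPair :
    Module.finrank ℝ (EuclideanSpace ℝ (LtPair n)) = n * (n - 1) / 2 := by
  rw [finrank_euclideanSpace, card_ltPair]

/-- Near 1 the inverse Cayley transform is defined, skew-symmetric, continuous and vanishes at 1, so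
it supplies preimages of small norm. -/
theorem cayleyChart_image_closedBall_mem_nhds {r : ℝ} (hr : 0 < r) :
    cayleyChart '' Metric.closedBall (0 : EuclideanSpace ℝ (LtPair n)) r ∈
      𝓝 (1 : orthogonalGroup (Fin n) ℝ) := by
  have hval : Filter.Tendsto (fun U : orthogonalGroup (Fin n) ℝ => U.1) (𝓝 1) (𝓝 1) :=
    continuous_subtype_val.tendsto _
  have h1 : ∀ᶠ U : orthogonalGroup (Fin n) ℝ in 𝓝 1, (U.1 + 1).det ≠ 0 := by
    have hc : ContinuousAt (fun U : orthogonalGroup (Fin n) ℝ => (U.1 + 1).det) 1 :=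
      (continuous_subtype_val.add continuous_const).matrix_det.continuousAt
    refine hc.eventually_ne ?_
    rw [Submonoid.coe_one, show (1 : Matrix (Fin n) (Fin n) ℝ) + 1 = (2 : ℝ) • 1 by rw [two_smul],
      det_smul]
    simp
  have h2 : ∀ᶠ U : orthogonalGroup (Fin n) ℝ in 𝓝 1, ∑ i, ∑ j, (invCayley U.1) i j ^ 2 < r ^ 2 := by
    have hc : ContinuousAt (fun U : orthogonalGroup (Fin n) ℝ => invCayley U.1) 1 :=
      ContinuousAt.comp (f := fun U : orthogonalGroup (Fin n) ℝ => U.1) (x := 1)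
        continuousAt_invCayley continuous_subtype_val.continuousAt
    have hs : Continuous fun M : Matrix (Fin n) (Fin n) ℝ => ∑ i, ∑ j, M i j ^ 2 :=
      continuous_finsetSum _ fun i _ => continuous_finsetSum _ fun j _ =>
        (continuous_id.matrix_elem i j).pow 2
    have hcs := ContinuousAt.comp (f := fun U : orthogonalGroup (Fin n) ℝ => invCayley U.1) (x := 1)
      hs.continuousAt hc
    refine hcs.eventually (gt_mem_nhds ?_)
    simp only [Function.comp, Submonoid.coe_one, invCayley_one]
    simpa using pow_pos hr 2
  filter_upwards [h1, h2] with U hU1 hU2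
  have hu : IsUnit (U.1 + 1).det := isUnit_iff_ne_zero.2 hU1
  obtain ⟨z, hz⟩ := exists_skewMat_eq
    (transpose_invCayley (orthogonalGroup_mul_transpose_self U) hu)
  refine ⟨z, ?_, Subtype.ext ?_⟩
  · rw [mem_closedBall_zero_iff, ← abs_of_pos hr, ← abs_of_nonneg (norm_nonneg z), ← sq_le_sq,
      ← sum_skewMat_sq, hz]
    exact hU2.le
  · change cayley (skewMat n z) = U.1
    rw [hz, cayley_invCayley hu]

/-- One neighbourhood of 1 has finite volume, being an almost isometric image of a ball. Translation
carries it to every point and compactness finishes. -/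
instance orthogonalVolume_isFiniteMeasure : IsFiniteMeasure (orthogonalVolume n) := by
  obtain ⟨r, hr, -, -, h⟩ := (isAsymptoticIsometry_cayleyChart (n := n)).exists_measure_image
    finrank_euclideanSpace_ltPair one_pos
  set N := cayleyChart '' Metric.closedBall (0 : EuclideanSpace ℝ (LtPair n)) r with hN
  have hfin : orthogonalVolume n N < ⊤ :=
    (h _ subset_rfl).2.trans_lt (ENNReal.mul_lt_top (by simp)
      (Metric.isBounded_closedBall.measure_lt_top))
  refine ⟨isCompact_univ.measure_lt_top_of_nhdsWithin fun V _ => ?_⟩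
  rw [nhdsWithin_univ]
  refine ⟨(fun U => V⁻¹ * U) ⁻¹' N, ?_, ?_⟩
  · have hc : ContinuousAt (fun U : orthogonalGroup (Fin n) ℝ => V⁻¹ * U) V :=
      (continuous_const.mul continuous_id).continuousAt
    apply hc
    change _ ∈ 𝓝 (V⁻¹ * V)
    rw [inv_mul_cancel]
    exact cayleyChart_image_closedBall_mem_nhds hr
  · rw [measure_preimage_mul]
    exact hfin

theorem grass_dist_eq (g h : Grass n k) : dist g h = ‖projMatrix g - projMatrix h‖ :=
  dist_eq_norm (projMatrix g) (projMatrix h)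

theorem dist_rotGrass (U : orthogonalGroup (Fin (k + m)) ℝ) (g h : Grass (k + m) k) :
    dist (rotGrass U g) (rotGrass U h) = dist g h := by
  rw [grass_dist_eq, grass_dist_eq, projMatrix_rotGrass, projMatrix_rotGrass, ← Matrix.sub_mul,
    ← Matrix.mul_sub, ← orthogonalGroup_coe_inv, frobenius_norm_mul_orthogonal,
    frobenius_norm_orthogonal_mul]

theorem rotGrass_rotGrass (U V : orthogonalGroup (Fin (k + m)) ℝ) (g : Grass (k + m) k) :
    rotGrass U (rotGrass V g) = rotGrass (U * V) g := by
  obtain ⟨W, rfl⟩ := planeOf_surjective g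
  rw [rotGrass_planeOf, rotGrass_planeOf, rotGrass_planeOf, mul_assoc]

theorem rotGrass_one (g : Grass (k + m) k) :
    rotGrass (1 : orthogonalGroup (Fin (k + m)) ℝ) g = g := by
  obtain ⟨W, rfl⟩ := planeOf_surjective g
  rw [rotGrass_planeOf, one_mul]

theorem measurePreserving_rotGrass (U : orthogonalGroup (Fin (k + m)) ℝ) :
    MeasurePreserving (rotGrass U : Grass (k + m) k → Grass (k + m) k)
      (grassVolume (k + m) k) (grassVolume (k + m) k) := by
  let e : Grass (k + m) k ≃ Grass (k + m) k :=
    { toFun := rotGrass U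
      invFun := rotGrass U⁻¹
      left_inv := fun g => by rw [rotGrass_rotGrass, inv_mul_cancel, rotGrass_one]
      right_inv := fun g => by rw [rotGrass_rotGrass, mul_inv_cancel, rotGrass_one] }
  exact (IsometryEquiv.mk e
    (Isometry.of_dist_eq (dist_rotGrass U))).measurePreserving_euclideanHausdorffMeasure _

theorem projMatrix_mul_self (g : Grass (k + m) k) : projMatrix g * projMatrix g = projMatrix g := by
  obtain ⟨W, rfl⟩ := planeOf_surjective g
  rw [projMatrix_planeOf]
  rw [show W.1 * blk (1 : Matrix (Fin k) (Fin k) ℝ) 0 0 (0 : Matrix (Fin m) (Fin m) ℝ) * W.1ᵀ *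
      (W.1 * blk 1 0 0 0 * W.1ᵀ) = W.1 * (blk 1 0 0 0 * (W.1ᵀ * W.1) * blk 1 0 0 0) * W.1ᵀ by
    simp only [Matrix.mul_assoc], orthogonalGroup_transpose_mul_self, Matrix.mul_one, blk_mul]
  simp

theorem transpose_projMatrix (g : Grass (k + m) k) : (projMatrix g)ᵀ = projMatrix g := by
  obtain ⟨W, rfl⟩ := planeOf_surjective g
  rw [projMatrix_planeOf, transpose_mul, transpose_mul, transpose_transpose, blk_transpose]
  simp [Matrix.mul_assoc]

theorem norm_offSkew (y : EuclideanSpace ℝ (Fin k × Fin m)) : ‖offSkew k m y‖ = ‖y‖ := by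
  rw [← sq_eq_sq₀ (norm_nonneg _) (norm_nonneg _), offSkew_apply, frobenius_norm_sq_blk,
    ← sum_offMat_sq]
  simp
  rw [Finset.sum_comm]
  ring

/-- Conjugation by the reflection fixes the diagonal blocks, so being negated kills them;
skew-symmetry relates the two remaining blocks. -/
theorem exists_offSkew_eq {Z : Matrix (Fin (k + m)) (Fin (k + m)) ℝ} (hZ : Zᵀ = -Z)
    (hR : blk (1 : Matrix (Fin k) (Fin k) ℝ) 0 0 (-1 : Matrix (Fin m) (Fin m) ℝ) * Z *
      blk 1 0 0 (-1) = -Z) : ∃ y, offSkew k m y = Z := by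
  rw [← blk_blocks Z, blk_mul, blk_mul, blk_neg] at hR
  rw [← blk_blocks Z, blk_transpose, blk_neg] at hZ
  have h1 : ulBlock Z = 0 := by
    have := congrArg ulBlock hR
    simp only [ulBlock_blk, Matrix.one_mul, Matrix.zero_mul, Matrix.mul_one, Matrix.mul_zero,
      add_zero] at this
    ext i j
    have h := congrFun (congrFun this i) j
    rw [Matrix.neg_apply] at h
    rw [Matrix.zero_apply]
    linarith
  have h2 : lrBlock Z = 0 := by
    have := congrArg lrBlock hR
    simp only [lrBlock_blk, Matrix.neg_mul, Matrix.one_mul, Matrix.zero_mul, Matrix.mul_one,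
      Matrix.mul_zero, zero_add, Matrix.mul_neg, neg_neg] at this
    ext i j
    have h := congrFun (congrFun this i) j
    rw [Matrix.neg_apply] at h
    rw [Matrix.zero_apply]
    linarith
  have h3 : urBlock Z = -(llBlock Z)ᵀ := by
    have := congrArg llBlock hZ
    rw [llBlock_blk, llBlock_blk] at this
    rw [← neg_eq_iff_eq_neg.2 this, transpose_neg, transpose_transpose]
    simp
  refine ⟨WithLp.toLp 2 fun p => √2 * llBlock Z p.2 p.1, ?_⟩
  have h4 : offMat k m (WithLp.toLp 2 fun p => √2 * llBlock Z p.2 p.1) = llBlock Z := by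
    ext i j
    simp [offMat_apply]
  rw [offSkew_apply, h4]
  conv_rhs => rw [← blk_blocks Z, h1, h2, h3]

/-- The orthogonal reflection with the first `k` coordinates as fixed space. -/
def stdRefl (k m : ℕ) : Matrix (Fin (k + m)) (Fin (k + m)) ℝ :=
  blk (1 : Matrix (Fin k) (Fin k) ℝ) 0 0 (-1 : Matrix (Fin m) (Fin m) ℝ)

theorem stdRefl_mul_self : stdRefl k m * stdRefl k m = 1 := by
  simp only [stdRefl, blk_mul]
  simp [blk_one]

theorem transpose_stdRefl : (stdRefl k m)ᵀ = stdRefl k m := by simp [stdRefl, blk_transpose]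

/-- The product of the reflections in `g` and in the plane of the first `k` coordinates. -/
def reflProd (g : Grass (k + m) k) : Matrix (Fin (k + m)) (Fin (k + m)) ℝ :=
  ((2 : ℝ) • projMatrix g - 1) * stdRefl k m

theorem continuous_reflProd :
    Continuous (reflProd : Grass (k + m) k → Matrix (Fin (k + m)) (Fin (k + m)) ℝ) :=
  ((continuous_projMatrix.const_smul (2 : ℝ)).sub continuous_const).matrix_mul continuous_const

theorem reflProd_planeOf_one :
    reflProd (planeOf (1 : orthogonalGroup (Fin (k + m)) ℝ)) = 1 := by
  have hP₀ : (2 : ℝ) • projMatrix (planeOf (1 : orthogonalGroup (Fin (k + m)) ℝ)) - 1 =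
      stdRefl k m := by
    rw [projMatrix_planeOf, Submonoid.coe_one, Matrix.one_mul, transpose_one, Matrix.mul_one,
      blk_smul, ← blk_one, blk_sub, stdRefl]
    simp only [smul_zero, sub_zero, two_smul, add_sub_cancel_right, zero_sub]
  rw [reflProd, hP₀, stdRefl_mul_self]

/-- The projection matrix of the plane whose reflection is `cayley (offSkew k m y) * stdRefl k m`. -/
def projChart (k m : ℕ) (y : EuclideanSpace ℝ (Fin k × Fin m)) :
    Matrix (Fin (k + m)) (Fin (k + m)) ℝ :=
  (1 / 2 : ℝ) • (1 + cayley (offSkew k m y) * stdRefl k m)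

/-- The product of the two reflections is orthogonal, and conjugation by the standard one transposes
it. Its inverse Cayley transform is thus an off-diagonal skew matrix, from which the projection is
read back. This covers a whole neighbourhood of the base plane without a local inverse of
`grassChart`. -/
theorem exists_projChart_eq (g : Grass (k + m) k) (hu : IsUnit (reflProd g + 1).det) :
    ∃ y, offSkew k m y = invCayley (reflProd g) ∧ projMatrix g = projChart k m y := by
  set Rg := (2 : ℝ) • projMatrix g - 1 with hRg
  have hRgt : Rgᵀ = Rg := by
    rw [hRg, transpose_sub, transpose_smul, transpose_projMatrix, transpose_one]
  have hRgs : Rg * Rg = 1 := by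
    rw [hRg, Matrix.mul_sub, Matrix.sub_mul, Matrix.smul_mul, Matrix.mul_smul,
      projMatrix_mul_self, Matrix.mul_one, Matrix.one_mul, two_smul, two_smul]
    abel
  have hUg : reflProd g = Rg * stdRefl k m := rfl
  have hUt : (reflProd g)ᵀ = stdRefl k m * Rg := by
    rw [hUg, transpose_mul, transpose_stdRefl, hRgt]
  have hUU : reflProd g * (reflProd g)ᵀ = 1 := by
    rw [hUt, hUg, Matrix.mul_assoc, ← Matrix.mul_assoc (stdRefl k m), stdRefl_mul_self,
      Matrix.one_mul, hRgs]
  have hconj : stdRefl k m * reflProd g * stdRefl k m = (reflProd g)ᵀ := by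
    rw [hUt, hUg, Matrix.mul_assoc, Matrix.mul_assoc, stdRefl_mul_self, Matrix.mul_one]
  obtain ⟨y, hy⟩ := exists_offSkew_eq (transpose_invCayley hUU hu)
    (cayley_conj stdRefl_mul_self hUU hu hconj)
  refine ⟨y, hy, ?_⟩
  rw [projChart, hy, cayley_invCayley hu, hUg, Matrix.mul_assoc, stdRefl_mul_self, Matrix.mul_one,
    hRg, add_sub_cancel, smul_smul]
  norm_num

theorem eventually_exists_projChart_eq {r : ℝ} (hr : 0 < r) :
    ∀ᶠ g in 𝓝 (planeOf (1 : orthogonalGroup (Fin (k + m)) ℝ)),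
      ∃ y ∈ Metric.closedBall 0 r, projMatrix g = projChart k m y := by
  have hlim : Filter.Tendsto (reflProd : Grass (k + m) k → _)
      (𝓝 (planeOf (1 : orthogonalGroup (Fin (k + m)) ℝ))) (𝓝 1) := by
    have h := (continuous_reflProd (k := k) (m := m)).tendsto
      (planeOf (1 : orthogonalGroup (Fin (k + m)) ℝ))
    rwa [reflProd_planeOf_one] at h
  have h1 : ∀ᶠ M : Matrix (Fin (k + m)) (Fin (k + m)) ℝ in 𝓝 1, (M + 1).det ≠ 0 := by
    have hc : ContinuousAt (fun M : Matrix (Fin (k + m)) (Fin (k + m)) ℝ => (M + 1).det) 1 :=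
      (continuous_id.add continuous_const).matrix_det.continuousAt
    refine hc.eventually_ne ?_
    rw [show (1 : Matrix (Fin (k + m)) (Fin (k + m)) ℝ) + 1 = (2 : ℝ) • 1 by rw [two_smul],
      det_smul]
    simp
  have h2 : ∀ᶠ M : Matrix (Fin (k + m)) (Fin (k + m)) ℝ in 𝓝 1,
      ∑ i, ∑ j, (invCayley M) i j ^ 2 < r ^ 2 := by
    have hs : Continuous fun M : Matrix (Fin (k + m)) (Fin (k + m)) ℝ => ∑ i, ∑ j, M i j ^ 2 :=
      continuous_finsetSum _ fun i _ => continuous_finsetSum _ fun j _ =>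
        (continuous_id.matrix_elem i j).pow 2
    have hcs : Filter.Tendsto (fun M : Matrix (Fin (k + m)) (Fin (k + m)) ℝ =>
        ∑ i, ∑ j, (invCayley M) i j ^ 2) (𝓝 1)
        (𝓝 (∑ i, ∑ j, (invCayley (1 : Matrix (Fin (k + m)) (Fin (k + m)) ℝ)) i j ^ 2)) :=
      (hs.tendsto _).comp (continuousAt_invCayley (n := k + m))
    refine hcs.eventually (gt_mem_nhds ?_)
    rw [invCayley_one]
    simpa using pow_pos hr 2
  filter_upwards [hlim.eventually h1, hlim.eventually h2] with g hg1 hg2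
  obtain ⟨y, hy, hg⟩ := exists_projChart_eq g (isUnit_iff_ne_zero.2 hg1)
  refine ⟨y, ?_, hg⟩
  rw [mem_closedBall_zero_iff, ← abs_of_pos hr, ← abs_of_nonneg (norm_nonneg y), ← sq_le_sq,
    ← norm_offSkew, hy, frobenius_norm_sq]
  exact hg2.le

theorem exists_lipschitz_projChart : ∃ r > 0, ∀ x ∈ Metric.closedBall 0 r,
    ∀ y ∈ Metric.closedBall 0 r,
      ‖projChart k m x - projChart k m y‖ ≤ ‖stdRefl k m‖ * dist x y := by
  obtain ⟨r, hr, hlip⟩ := isAsymptoticIsometry_cayley (offSkew k m) norm_offSkew 1 one_pos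
  refine ⟨r, hr, fun x hx y hy => ?_⟩
  have h1 : projChart k m x - projChart k m y =
      (1 / 2 : ℝ) • ((cayley (offSkew k m x) - cayley (offSkew k m y)) * stdRefl k m) := by
    rw [projChart, projChart, ← smul_sub, Matrix.sub_mul, add_sub_add_left_eq_sub]
  have h2 := (hlip x hx y hy).2
  rw [dist_eq_norm (cayley (offSkew k m x))] at h2
  rw [h1, norm_smul]
  calc ‖(1 / 2 : ℝ)‖ * ‖(cayley (offSkew k m x) - cayley (offSkew k m y)) * stdRefl k m‖
      ≤ (1 / 2) * (((1 + 1) * dist x y) * ‖stdRefl k m‖) := by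
        rw [Real.norm_of_nonneg (by norm_num)]
        exact mul_le_mul_of_nonneg_left ((norm_mul_le _ _).trans
          (mul_le_mul_of_nonneg_right h2 (norm_nonneg _))) (by norm_num)
    _ = ‖stdRefl k m‖ * dist x y := by ring

theorem finrank_euclideanSpace_grass :
    Module.finrank ℝ (EuclideanSpace ℝ (Fin k × Fin m)) = k * (k + m - k) := by
  rw [finrank_euclideanSpace]
  simp

theorem exists_nhds_grassVolume_lt_top :
    ∃ N ∈ 𝓝 (planeOf (1 : orthogonalGroup (Fin (k + m)) ℝ)), grassVolume (k + m) k N < ⊤ := by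
  obtain ⟨r, hr, hlip⟩ := exists_lipschitz_projChart (k := k) (m := m)
  have : Nonempty (Grass (k + m) k) := ⟨planeOf 1⟩
  -- Not every `projChart k m y` is known to be the projection of a k-plane, so the Lipschitz
  -- parametrization is restricted to the set `S` where it is. Only finiteness is wanted, hence the
  -- crude Lipschitz constant.
  let φ : EuclideanSpace ℝ (Fin k × Fin m) → Grass (k + m) k := fun y =>
    Function.invFun projMatrix (projChart k m y)
  let S : Set (EuclideanSpace ℝ (Fin k × Fin m)) :=
    {y | y ∈ Metric.closedBall 0 r ∧ ∃ g : Grass (k + m) k, projMatrix g = projChart k m y}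
  have hφ : ∀ y ∈ S, projMatrix (φ y) = projChart k m y := fun y hy => Function.invFun_eq hy.2
  refine ⟨φ '' S, ?_, ?_⟩
  · filter_upwards [eventually_exists_projChart_eq (k := k) (m := m) hr] with g hg
    obtain ⟨y, hy, hgy⟩ := hg
    have hyS : y ∈ S := ⟨hy, g, hgy⟩
    exact ⟨y, hyS, projMatrix_injective _ _ ((hφ y hyS).trans hgy.symm)⟩
  · have hL : LipschitzOnWith (‖stdRefl k m‖).toNNReal φ S := by
      refine LipschitzOnWith.of_dist_le_mul fun x hx y hy => ?_
      rw [Real.coe_toNNReal _ (norm_nonneg _), grass_dist_eq, hφ x hx, hφ y hy]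
      exact hlip x hx.1 y hy.1
    rw [grassVolume]
    refine (euclideanHausdorffMeasure_image_le (K := ‖stdRefl k m‖) (norm_nonneg (stdRefl k m))
      hL).trans_lt ?_
    rw [← finrank_euclideanSpace_grass, InnerProductSpace.euclideanHausdorffMeasure_eq_volume]
    refine ENNReal.mul_lt_top (by simp) ((measure_mono fun y hy => hy.1).trans_lt
      (Metric.isBounded_closedBall (x := (0 : EuclideanSpace ℝ (Fin k × Fin m)))
        (r := r)).measure_lt_top)

end Invariance

/-! ### Finiteness of the Grassmannian volume -/

section GrassFinite

open Matrix Topology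

variable {k m : ℕ}

theorem continuous_rotGrass_left (W : orthogonalGroup (Fin (k + m)) ℝ) :
    Continuous (rotGrass W : Grass (k + m) k → Grass (k + m) k) :=
  (continuous_rotGrass (k := k) (m := m)).comp (Continuous.prodMk_right W)

instance grassVolume_isFiniteMeasure : IsFiniteMeasure (grassVolume (k + m) k) := by
  have := grass_compactSpace (k := k) (m := m)
  obtain ⟨N, hN, hfin⟩ := exists_nhds_grassVolume_lt_top (k := k) (m := m)
  obtain ⟨O, hON, hO, hmem⟩ := mem_nhds_iff.1 hN
  refine ⟨isCompact_univ.measure_lt_top_of_nhdsWithin fun g _ => ?_⟩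
  rw [nhdsWithin_univ]
  obtain ⟨W, rfl⟩ := planeOf_surjective g
  refine ⟨rotGrass W⁻¹ ⁻¹' O, ?_, ?_⟩
  · apply (hO.preimage (continuous_rotGrass_left W⁻¹)).mem_nhds
    rw [Set.mem_preimage, rotGrass_planeOf, inv_mul_cancel]
    exact hmem
  · rw [(measurePreserving_rotGrass W⁻¹).measure_preimage hO.measurableSet.nullMeasurableSet]
    exact (measure_mono hON).trans_lt hfin


end GrassFinite

/-! ### Volumes in the fibration of O_n over the Grassmannian -/

section Fibration

open Matrix Topology

variable {k m : ℕ}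

instance grass_compactSpace_inst : CompactSpace (Grass (k + m) k) := grass_compactSpace

theorem measurable_rotGrass_planeOf {f : Grass (k + m) k → ENNReal} (hf : Measurable f) :
    Measurable fun p : Grass (k + m) k × orthogonalGroup (Fin (k + m)) ℝ =>
      f (rotGrass p.2 p.1) :=
  hf.comp ((continuous_rotGrass (k := k) (m := m)).comp continuous_swap).measurable

/-- Averaging over the orthogonal group and over the Grassmannian agree up to normalization. -/
theorem lintegral_planeOf {f : Grass (k + m) k → ENNReal} (hf : Measurable f) :
    grassVolume (k + m) k Set.univ * ∫⁻ W, f (planeOf W) ∂orthogonalVolume (k + m) =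
      orthogonalVolume (k + m) Set.univ * ∫⁻ g, f g ∂grassVolume (k + m) k := by
  -- Integrate f(W g) in both orders: the integral over W does not depend on g, by transitivity and
  -- right invariance; the integral over g does not depend on W, since W acts by isometries.
  have h := lintegral_lintegral_swap (μ := grassVolume (k + m) k) (ν := orthogonalVolume (k + m))
    (f := fun g W => f (rotGrass W g)) (measurable_rotGrass_planeOf hf).aemeasurable
  have h1 : ∀ g : Grass (k + m) k, ∫⁻ W, f (rotGrass W g) ∂orthogonalVolume (k + m) =
      ∫⁻ W, f (planeOf W) ∂orthogonalVolume (k + m) := by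
    intro g
    obtain ⟨V, rfl⟩ := planeOf_surjective g
    simp_rw [rotGrass_planeOf]
    exact lintegral_mul_right_eq_self (μ := orthogonalVolume (k + m)) (fun W => f (planeOf W)) V
  have h2 : ∀ W : orthogonalGroup (Fin (k + m)) ℝ, ∫⁻ g, f (rotGrass W g) ∂grassVolume (k + m) k =
      ∫⁻ g, f g ∂grassVolume (k + m) k := fun W =>
    (measurePreserving_rotGrass W).lintegral_comp hf
  simp_rw [h1, h2, lintegral_const] at h
  rw [mul_comm, h, mul_comm]

/-- The product of the volumes of `O_k` and `O_m`. -/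
abbrev fibreVolume (k m : ℕ) :
    Measure (orthogonalGroup (Fin k) ℝ × orthogonalGroup (Fin m) ℝ) :=
  (orthogonalVolume k).prod (orthogonalVolume m)

theorem lintegral_mul_blkO {F : orthogonalGroup (Fin (k + m)) ℝ → ENNReal} (hF : Measurable F) :
    ∫⁻ U, ∫⁻ h, F (U * blkO h) ∂fibreVolume k m ∂orthogonalVolume (k + m) =
      fibreVolume k m Set.univ * ∫⁻ U, F U ∂orthogonalVolume (k + m) := by
  rw [lintegral_lintegral_swap]
  · simp_rw [fun h => lintegral_mul_right_eq_self (μ := orthogonalVolume (k + m)) F (blkO h)]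
    rw [lintegral_const, mul_comm]
  · exact (hF.comp (continuous_fst.mul
      ((continuous_blkO (k := k) (m := m)).comp continuous_snd)).measurable).aemeasurable

theorem blkO_injective : Function.Injective
    (blkO : orthogonalGroup (Fin k) ℝ × orthogonalGroup (Fin m) ℝ → _) := by
  intro h h' e
  have e1 : blk h.1.1 0 0 h.2.1 = blk h'.1.1 0 0 h'.2.1 := congrArg Subtype.val e
  have e2 := congrArg ulBlock e1
  have e3 := congrArg lrBlock e1
  rw [ulBlock_blk, ulBlock_blk] at e2
  rw [lrBlock_blk, lrBlock_blk] at e3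
  exact Prod.ext (Subtype.ext e2) (Subtype.ext e3)

theorem continuous_grassChart :
    Continuous (grassChart : EuclideanSpace ℝ (Fin k × Fin m) → Grass (k + m) k) :=
  continuous_planeOf.comp continuous_rot

/-- Average over the fibres: if the plane of U lies in the image of `Y`, then U = rot y * blkO b,
with y unique in `Y`, and the h with U * blkO h in the product set form a translate of `T`. Over
other planes there are none. -/
theorem fibreVolume_mul_image {Y : Set (EuclideanSpace ℝ (Fin k × Fin m))} (hY : IsCompact Y)
    (hinj : Set.InjOn (grassChart : _ → Grass (k + m) k) Y)
    {T : Set (orthogonalGroup (Fin k) ℝ × orthogonalGroup (Fin m) ℝ)} (hT : IsCompact T) :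
    fibreVolume k m Set.univ * orthogonalVolume (k + m)
        ((fun p : EuclideanSpace ℝ (Fin k × Fin m) × _ => rot p.1 * blkO p.2) '' Y ×ˢ T) =
      fibreVolume k m T * orthogonalVolume (k + m) (planeOf ⁻¹' (grassChart '' Y)) := by
  set S := (fun p : EuclideanSpace ℝ (Fin k × Fin m) × _ => rot p.1 * blkO p.2) '' Y ×ˢ T with hS
  have hSm : MeasurableSet S := ((hY.prod hT).image ((continuous_rot.comp continuous_fst).mul
    (continuous_blkO.comp continuous_snd))).isClosed.measurableSet
  have hPm : MeasurableSet ((planeOf : _ → Grass (k + m) k) ⁻¹' (grassChart '' Y)) :=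
    ((hY.image continuous_grassChart).isClosed.preimage continuous_planeOf).measurableSet
  have key : ∀ U : orthogonalGroup (Fin (k + m)) ℝ,
      ∫⁻ h, S.indicator 1 (U * blkO h) ∂fibreVolume k m =
        ((planeOf : _ → Grass (k + m) k) ⁻¹' (grassChart '' Y)).indicator
          (fun _ => fibreVolume k m T) U := by
    intro U
    by_cases hU : U ∈ (planeOf : _ → Grass (k + m) k) ⁻¹' (grassChart '' Y)
    · rw [Set.indicator_of_mem hU]
      obtain ⟨y, hy, hyU⟩ := hU
      obtain ⟨b, rfl⟩ := exists_eq_mul_blkO hyU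
      have hiff : ∀ h, S.indicator (1 : orthogonalGroup (Fin (k + m)) ℝ → ENNReal) (rot y * blkO b * blkO h) =
          T.indicator 1 (b * h) := by
        intro h
        rw [mul_assoc, ← blkO_mul]
        by_cases hb : b * h ∈ T
        · rw [Set.indicator_of_mem hb, Set.indicator_of_mem]
          · rfl
          · exact ⟨(y, b * h), ⟨hy, hb⟩, rfl⟩
        · rw [Set.indicator_of_notMem hb, Set.indicator_of_notMem]
          rintro ⟨⟨y', t⟩, ⟨hy', ht⟩, e⟩
          dsimp only at hy' ht e
          have e1 := congrArg (planeOf : _ → Grass (k + m) k) e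
          rw [planeOf_mul_blkO, planeOf_mul_blkO] at e1
          rw [hinj hy' hy e1] at e
          exact hb (blkO_injective (mul_left_cancel e) ▸ ht)
      simp_rw [hiff]
      rw [lintegral_mul_left_eq_self, lintegral_indicator_one hT.isClosed.measurableSet]
    · rw [Set.indicator_of_notMem hU]
      have hz : ∀ h, S.indicator (1 : orthogonalGroup (Fin (k + m)) ℝ → ENNReal) (U * blkO h) = 0 := by
        intro h
        rw [Set.indicator_of_notMem]
        rintro ⟨⟨y', t⟩, ⟨hy', ht⟩, e⟩
        have e1 := congrArg (planeOf : _ → Grass (k + m) k) e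
        rw [planeOf_mul_blkO, planeOf_mul_blkO] at e1
        exact hU ⟨y', hy', e1⟩
      simp [hz]
  have h := lintegral_mul_blkO (k := k) (m := m)
    (measurable_one.indicator hSm : Measurable (S.indicator (1 : orthogonalGroup (Fin (k + m)) ℝ → ENNReal)))
  simp_rw [key] at h
  rw [lintegral_indicator_const hPm, lintegral_indicator_one hSm] at h
  exact h.symm

/-- The cube with half-side `t`. -/
def cube (ι : Type*) [Fintype ι] (t : ℝ) : Set (EuclideanSpace ℝ ι) := {w | ∀ i, |w i| ≤ t}

theorem cube_eq (ι : Type*) [Fintype ι] (t : ℝ) : cube ι t =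
    (MeasurableEquiv.toLp 2 (ι → ℝ)).symm ⁻¹' Set.univ.pi fun _ => Set.Icc (-t) t := by
  ext w
  simp only [cube, Set.mem_ofPred_eq, Set.mem_preimage, Set.mem_univ_pi, Set.mem_Icc, abs_le]
  rfl

theorem volume_cube (ι : Type*) [Fintype ι] (t : ℝ) :
    volume (cube ι t) = ENNReal.ofReal (2 * t) ^ Fintype.card ι := by
  rw [cube_eq, (EuclideanSpace.volume_preserving_symm_measurableEquiv_toLp ι).measure_preimage
    (MeasurableSet.univ_pi fun _ => measurableSet_Icc).nullMeasurableSet, volume_pi_pi]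
  simp [two_mul]

theorem cube_subset_closedBall (ι : Type*) [Fintype ι] {r t : ℝ} (hr : 0 < r) (ht0 : 0 ≤ t)
    (ht : (Fintype.card ι + 1) * t ≤ r) : cube ι t ⊆ Metric.closedBall 0 r := by
  intro w hw
  rw [mem_closedBall_zero_iff, ← abs_of_pos hr, ← abs_of_nonneg (norm_nonneg w), ← sq_le_sq,
    EuclideanSpace.real_norm_sq_eq]
  calc ∑ i, w i ^ 2 ≤ ∑ _i : ι, t ^ 2 := Finset.sum_le_sum fun i _ => by
        rw [← sq_abs]
        exact pow_le_pow_left₀ (abs_nonneg _) (hw i) 2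
    _ = Fintype.card ι * t ^ 2 := by simp
    _ ≤ ((Fintype.card ι + 1) * t) ^ 2 := by
        have : (0 : ℝ) ≤ Fintype.card ι := Nat.cast_nonneg _
        nlinarith [sq_nonneg t, mul_nonneg this (sq_nonneg t),
          mul_nonneg (mul_nonneg this this) (sq_nonneg t)]
    _ ≤ r ^ 2 := pow_le_pow_left₀ (by positivity) ht 2

theorem isCompact_cube (ι : Type*) [Fintype ι] (t : ℝ) : IsCompact (cube ι t) := by
  have : cube ι t = (EuclideanSpace.equiv ι ℝ).toHomeomorph ⁻¹' Set.univ.pi fun _ =>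
      Set.Icc (-t) t := by
    ext w
    simp only [cube, Set.mem_ofPred_eq, Set.mem_preimage, Set.mem_univ_pi, Set.mem_Icc, abs_le]
    rfl
  rw [this, Homeomorph.isCompact_preimage]
  exact isCompact_univ_pi fun _ => isCompact_Icc

/-- Cubes are used instead of balls because a cube is the product of cubes in the base and fibre
coordinates. -/
theorem fibredChart_image_cube (t : ℝ) :
    fibredChart '' cube ((Fin k × Fin m) ⊕ (LtPair k ⊕ LtPair m)) t =
      (fun p : EuclideanSpace ℝ (Fin k × Fin m) × _ => rot p.1 * blkO p.2) ''
        cube (Fin k × Fin m) t ×ˢ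
          ((cayleyChart '' cube (LtPair k) t) ×ˢ (cayleyChart '' cube (LtPair m) t)) := by
  ext U
  constructor
  · rintro ⟨w, hw, rfl⟩
    exact ⟨(_, (_, _)), ⟨fun i => hw _, ⟨_, fun i => hw (Sum.inr (Sum.inl i)), rfl⟩,
      ⟨_, fun i => hw (Sum.inr (Sum.inr i)), rfl⟩⟩, rfl⟩
  · rintro ⟨⟨y, _, _⟩, ⟨hy, ⟨z, hz, rfl⟩, ⟨z', hz', rfl⟩⟩, rfl⟩
    refine ⟨WithLp.toLp 2 (Sum.elim y.ofLp (Sum.elim z.ofLp z'.ofLp)), ?_, rfl⟩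
    rintro (i | i | i)
    exacts [hy i, hz i, hz' i]

theorem card_fibre :
    Fintype.card ((Fin k × Fin m) ⊕ (LtPair k ⊕ LtPair m)) = (k + m) * (k + m - 1) / 2 := by
  rw [Fintype.card_sum, Fintype.card_sum, card_ltPair, card_ltPair, Fintype.card_prod,
    Fintype.card_fin, Fintype.card_fin, ← Nat.choose_two_right, ← Nat.choose_two_right,
    ← Nat.choose_two_right]
  induction m with
  | zero => simp
  | succ m ih =>
    rw [show k + (m + 1) = k + m + 1 from rfl, Nat.choose_succ_succ' (k + m), Nat.choose_succ_succ' m, ← ih,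
      Nat.choose_one_right, Nat.choose_one_right]
    ring

/-- The letters stand for volumes: `G`, `H`, `O` of the Grassmannian, the fibre and the group; `ω`,
`γ`, `τ₁`, `τ₂` of the images of small cubes of side `c` in the group, the base and the two fibre
factors; `p` of the preimage of the base image. -/
theorem mul_le_of_fibration {G H O ω p γ τ₁ τ₂ x y c : ENNReal} {a b d : ℕ}
    (hfib : H * ω = τ₁ * τ₂ * p) (hG : G * p = O * γ) (e₀ : x * c ^ (a + (b + d)) ≤ ω)
    (e₁ : γ ≤ y * c ^ a) (e₂ : τ₁ ≤ y * c ^ b) (e₃ : τ₂ ≤ y * c ^ d) :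
    G * H * x * c ^ (a + (b + d)) ≤ O * y ^ 3 * c ^ (a + (b + d)) :=
  calc G * H * x * c ^ (a + (b + d)) = G * (H * (x * c ^ (a + (b + d)))) := by ring
    _ ≤ G * (H * ω) := by gcongr
    _ = τ₁ * τ₂ * (O * γ) := by rw [hfib, ← hG]; ring
    _ ≤ (y * c ^ b) * (y * c ^ d) * (O * (y * c ^ a)) := by gcongr
    _ = O * y ^ 3 * c ^ (a + (b + d)) := by ring

/-- Compute the volume of one small cube image at the identity twice: by `fibredChart` it is almost
the Lebesgue volume, and by homogeneity it is the product of the fractions of base and fibre that it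
covers, times the volume of the group. Then ε → 0. -/
theorem grassVolume_mul_fibreVolume_le :
    grassVolume (k + m) k Set.univ * fibreVolume k m Set.univ ≤
      orthogonalVolume (k + m) Set.univ := by
  have main : ∀ ε : ℝ, 0 < ε → grassVolume (k + m) k Set.univ * fibreVolume k m Set.univ *
      ENNReal.ofReal (1 - ε) ≤
      orthogonalVolume (k + m) Set.univ * ENNReal.ofReal (1 + ε) ^ 3 := by
    intro ε hε
    obtain ⟨r₀, hr₀, -, -, h₀⟩ := (isAsymptoticIsometry_fibredChart (k := k)
      (m := m)).exists_measure_image (finrank_euclideanSpace.trans card_fibre) hε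
    obtain ⟨r₁, hr₁, hi, -, h₁⟩ := (isAsymptoticIsometry_grassChart (k := k)
      (m := m)).exists_measure_image finrank_euclideanSpace_grass hε
    obtain ⟨r₂, hr₂, -, -, h₂⟩ := (isAsymptoticIsometry_cayleyChart
      (n := k)).exists_measure_image finrank_euclideanSpace_ltPair hε
    obtain ⟨r₃, hr₃, -, -, h₃⟩ := (isAsymptoticIsometry_cayleyChart
      (n := m)).exists_measure_image finrank_euclideanSpace_ltPair hε
    have hsmall : ∀ (ι : Type) [Fintype ι] {r : ℝ}, 0 < r → ∀ᶠ t : ℝ in 𝓝[>] 0,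
        cube ι t ⊆ Metric.closedBall 0 r := by
      intro ι _ r hr
      have hlim : Filter.Tendsto (fun t : ℝ => (Fintype.card ι + 1 : ℝ) * t) (𝓝[>] 0) (𝓝 0) := by
        have : Continuous fun t : ℝ => (Fintype.card ι + 1 : ℝ) * t := by fun_prop
        simpa using (this.tendsto 0).mono_left nhdsWithin_le_nhds
      filter_upwards [hlim.eventually (eventually_le_nhds hr), self_mem_nhdsWithin] with t ht ht0
      exact cube_subset_closedBall ι hr (le_of_lt ht0) ht
    obtain ⟨t, ⟨⟨⟨⟨ht₀, ht₁⟩, ht₂⟩, ht₃⟩, ht⟩⟩ := ((((hsmall ((Fin k × Fin m) ⊕ (LtPair k ⊕ LtPair m)) hr₀).and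
      (hsmall (Fin k × Fin m) hr₁)).and (hsmall (LtPair k) hr₂)).and (hsmall (LtPair m) hr₃) |>.and self_mem_nhdsWithin).exists
    have e₀ := (h₀ _ ht₀).1
    have e₁ := (h₁ _ ht₁).2
    have e₂ := (h₂ _ ht₂).2
    have e₃ := (h₃ _ ht₃).2
    rw [fibredChart_image_cube, volume_cube, Fintype.card_sum, Fintype.card_sum] at e₀
    rw [volume_cube] at e₁ e₂ e₃
    change _ ≤ orthogonalVolume (k + m) _ at e₀
    change grassVolume (k + m) k _ ≤ _ at e₁
    change orthogonalVolume k _ ≤ _ at e₂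
    change orthogonalVolume m _ ≤ _ at e₃
    set c := ENNReal.ofReal (2 * t) with hc
    have hc0 : c ≠ 0 := by
      rw [hc, Ne, ENNReal.ofReal_eq_zero, not_le]
      have : 0 < t := ht
      linarith
    have hct : c ≠ ⊤ := ENNReal.ofReal_ne_top
    have hfib := fibreVolume_mul_image (isCompact_cube (Fin k × Fin m) t) (hi.mono ht₁)
      (((isCompact_cube (LtPair k) t).image continuous_cayleyChart).prod
        ((isCompact_cube (LtPair m) t).image continuous_cayleyChart))
    rw [Measure.prod_prod] at hfib
    have hΓ : IsCompact ((grassChart : _ → Grass (k + m) k) '' cube (Fin k × Fin m) t) :=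
      (isCompact_cube _ t).image continuous_grassChart
    have hG := lintegral_planeOf (k := k) (m := m)
      (measurable_one.indicator hΓ.isClosed.measurableSet :
        Measurable (Set.indicator (grassChart '' cube (Fin k × Fin m) t)
          (1 : Grass (k + m) k → ENNReal)))
    rw [lintegral_indicator_one hΓ.isClosed.measurableSet] at hG
    have hG' : ∫⁻ W : orthogonalGroup (Fin (k + m)) ℝ,
        Set.indicator (grassChart '' cube (Fin k × Fin m) t)
          (1 : Grass (k + m) k → ENNReal) (planeOf W) ∂orthogonalVolume (k + m) =
        orthogonalVolume (k + m) (planeOf ⁻¹' ((grassChart : _ → Grass (k + m) k) ''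
          cube (Fin k × Fin m) t)) := by
      rw [← lintegral_indicator_one (hΓ.isClosed.preimage continuous_planeOf).measurableSet]
      rfl
    rw [hG'] at hG
    set a := Fintype.card (Fin k × Fin m)
    set b := Fintype.card (LtPair k)
    set d := Fintype.card (LtPair m)
    have hpow0 : c ^ (a + (b + d)) ≠ 0 := pow_ne_zero _ hc0
    have hpowt : c ^ (a + (b + d)) ≠ ⊤ := ENNReal.pow_ne_top hct
    rw [← ENNReal.mul_le_mul_iff_left hpow0 hpowt]
    exact mul_le_of_fibration hfib hG e₀ e₁ e₂ e₃
  have hl : Filter.Tendsto (fun ε : ℝ => grassVolume (k + m) k Set.univ *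
      fibreVolume k m Set.univ * ENNReal.ofReal (1 - ε)) (𝓝[>] 0)
      (𝓝 (grassVolume (k + m) k Set.univ * fibreVolume k m Set.univ * 1)) := by
    refine ENNReal.Tendsto.const_mul ?_ (Or.inl one_ne_zero)
    have : Continuous fun ε : ℝ => ENNReal.ofReal (1 - ε) :=
      ENNReal.continuous_ofReal.comp (continuous_const.sub continuous_id)
    simpa using (this.tendsto 0).mono_left nhdsWithin_le_nhds
  have hr : Filter.Tendsto (fun ε : ℝ => orthogonalVolume (k + m) Set.univ *
      ENNReal.ofReal (1 + ε) ^ 3) (𝓝[>] 0) (𝓝 (orthogonalVolume (k + m) Set.univ * 1)) := by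
    refine ENNReal.Tendsto.const_mul ?_ (Or.inl one_ne_zero)
    have : Continuous fun ε : ℝ => ENNReal.ofReal (1 + ε) ^ 3 :=
      (ENNReal.continuous_pow 3).comp
        (ENNReal.continuous_ofReal.comp (continuous_const.add continuous_id))
    simpa using (this.tendsto 0).mono_left nhdsWithin_le_nhds
  rw [mul_one] at hl hr
  exact le_of_tendsto_of_tendsto hl hr
    (Filter.eventually_of_mem self_mem_nhdsWithin fun ε hε => main ε hε)

theorem fibreVolume_mul_lintegral_le {f : Grass (k + m) k → ENNReal} (hf : Measurable f) :
    fibreVolume k m Set.univ * ∫⁻ g, f g ∂grassVolume (k + m) k ≤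
      ∫⁻ W, f (planeOf W) ∂orthogonalVolume (k + m) := by
  by_cases h0 : grassVolume (k + m) k Set.univ = 0
  · rw [Measure.measure_univ_eq_zero.1 h0]
    simp
  · rw [← ENNReal.mul_le_mul_iff_right h0 (measure_ne_top _ _), lintegral_planeOf hf, ← mul_assoc]
    gcongr
    exact grassVolume_mul_fibreVolume_le

end Fibration

/-! ### Fixed planes of perturbed matrices -/

section LocalSolution

open Matrix Topology
open scoped Kronecker

attribute [local instance] Matrix.frobeniusNormedAddCommGroup Matrix.frobeniusNormedSpace
  Matrix.frobeniusNormedRing Matrix.frobeniusNormedAlgebra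

variable {k m : ℕ}

/-- The operator `X ↦ X - d X a⁻¹` in coordinates. -/
def gapMat (a : Matrix (Fin k) (Fin k) ℝ) (d : Matrix (Fin m) (Fin m) ℝ) :
    Matrix (Fin k × Fin m) (Fin k × Fin m) ℝ := 1 - (a⁻¹)ᵀ ⊗ₖ d

theorem offMat_injective : Function.Injective (offMat k m) := by
  intro x y h
  ext p
  have h1 := congrFun (congrFun h p.2) p.1
  rw [offMat_apply, offMat_apply] at h1
  exact mul_left_cancel₀ (by positivity) h1

theorem vec_offMat (x : EuclideanSpace ℝ (Fin k × Fin m)) :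
    (offMat k m x).vec = (√2)⁻¹ • x.ofLp := rfl

theorem offMat_gapMat (a : Matrix (Fin k) (Fin k) ℝ) (d : Matrix (Fin m) (Fin m) ℝ)
    (x : EuclideanSpace ℝ (Fin k × Fin m)) :
    offMat k m (toEuclideanLin (gapMat a d) x) =
      offMat k m x - d * offMat k m x * a⁻¹ := by
  rw [← vec_inj, vec_offMat]
  change (√2)⁻¹ • (gapMat a d *ᵥ x.ofLp) = _
  rw [← mulVec_smul, ← vec_offMat, gapMat, sub_mulVec, one_mulVec, kronecker_mulVec_vec,
    transpose_transpose, vec_sub]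

theorem llBlock_commutator (a : Matrix (Fin k) (Fin k) ℝ) (b : Matrix (Fin k) (Fin m) ℝ)
    (d : Matrix (Fin m) (Fin m) ℝ) (x : EuclideanSpace ℝ (Fin k × Fin m)) :
    llBlock (offSkew k m x * blk a b 0 d) = offMat k m x * a ∧
    llBlock (offSkew k m x * blk a b 0 d - blk a b 0 d * offSkew k m x) =
      offMat k m x * a - d * offMat k m x := by
  rw [map_sub, offSkew_apply, blk_mul, blk_mul, llBlock_blk, llBlock_blk]
  simp

theorem offMat_gapMat_mul {a : Matrix (Fin k) (Fin k) ℝ} (ha : IsUnit a.det)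
    (d : Matrix (Fin m) (Fin m) ℝ) (x : EuclideanSpace ℝ (Fin k × Fin m)) :
    offMat k m (toEuclideanLin (gapMat a d) x) * a = offMat k m x * a - d * offMat k m x := by
  rw [offMat_gapMat, Matrix.sub_mul, Matrix.mul_assoc _ a⁻¹, nonsing_inv_mul _ ha, Matrix.mul_one]

theorem mul_right_injective_of_det {a : Matrix (Fin k) (Fin k) ℝ} (ha : IsUnit a.det)
    {X Y : Matrix (Fin m) (Fin k) ℝ} (h : X * a = Y * a) : X = Y := by
  have := congrArg (· * a⁻¹) h
  simpa [Matrix.mul_assoc, mul_nonsing_inv _ ha] using this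

/-- The Sylvester operator X ↦ X a - d X is `gapMat` followed by right multiplication by `a`. So a
nonzero density determinant already guarantees that the fixed plane is nondegenerate. -/
theorem det_sylv_ne_zero {a : Matrix (Fin k) (Fin k) ℝ} (ha : IsUnit a.det)
    {d : Matrix (Fin m) (Fin m) ℝ} (h : (gapMat a d).det ≠ 0) : (sylv a d).det ≠ 0 := by
  have h1 : sylv a d = (aᵀ ⊗ₖ (1 : Matrix (Fin m) (Fin m) ℝ)) * gapMat a d := by
    rw [gapMat, Matrix.mul_sub, Matrix.mul_one, ← mul_kronecker_mul, ← transpose_mul,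
      nonsing_inv_mul _ ha, transpose_one, Matrix.one_mul, sylv]
  rw [h1, det_mul, det_kronecker, det_transpose, det_one, one_pow, mul_one]
  exact mul_ne_zero (pow_ne_zero _ ha.ne_zero) h

theorem det_toEuclideanLin {ι : Type*} [Fintype ι] [DecidableEq ι] (M : Matrix ι ι ℝ) :
    LinearMap.det (toEuclideanLin M) = M.det := by
  rw [toEuclideanLin_eq_toLin_orthonormal, LinearMap.det_toLin]

theorem continuous_det_sylv : Continuous fun M : Matrix (Fin (k + m)) (Fin (k + m)) ℝ =>
    (sylv (ulBlock M) (lrBlock M)).det := by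
  refine Continuous.matrix_det ?_
  refine continuous_pi fun i => continuous_pi fun j => ?_
  simp only [sylv, Matrix.sub_apply]
  refine (Continuous.mul ?_ continuous_const).sub (continuous_const.mul ?_)
  · exact continuous_id.matrix_elem _ _
  · exact continuous_id.matrix_elem _ _

theorem eventually_det_sylv_ne_zero {B : Matrix (Fin (k + m)) (Fin (k + m)) ℝ}
    (hB : (sylv (ulBlock B) (lrBlock B)).det ≠ 0) :
    ∀ᶠ p : EuclideanSpace ℝ (Fin k × Fin m) × EuclideanSpace ℝ (Fin k × Fin m) in 𝓝 0,
      (sylv (ulBlock ((rot p.1).1ᵀ * ((rot p.2).1 * B) * (rot p.1).1))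
        (lrBlock ((rot p.1).1ᵀ * ((rot p.2).1 * B) * (rot p.1).1))).det ≠ 0 := by
  have hr : Continuous fun x : EuclideanSpace ℝ (Fin k × Fin m) => (rot x).1 :=
    continuous_subtype_val.comp continuous_rot
  have hN : Continuous fun p : EuclideanSpace ℝ (Fin k × Fin m) × EuclideanSpace ℝ (Fin k × Fin m)
      => (rot p.1).1ᵀ * ((rot p.2).1 * B) * (rot p.1).1 :=
    ((hr.comp continuous_fst).matrix_transpose.matrix_mul
      ((hr.comp continuous_snd).matrix_mul continuous_const)).matrix_mul (hr.comp continuous_fst)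
  refine (continuous_det_sylv.comp hN).continuousAt.eventually_ne ?_
  simp only [Function.comp, Prod.fst_zero, Prod.snd_zero, rot_zero]
  simpa using hB

/-- Near a nondegenerate invariant plane of `B`, the invariant planes of perturbations of `B` by
rotations `rot y` depend on `y` to first order through the inverse of `gapMat`. -/
theorem exists_isGoodFrame_near {a : Matrix (Fin k) (Fin k) ℝ} (ha : IsUnit a.det)
    (b : Matrix (Fin k) (Fin m) ℝ) {d : Matrix (Fin m) (Fin m) ℝ} (hK : (gapMat a d).det ≠ 0)
    {ε : ℝ} (hε : 0 < ε) :
    ∃ ρ > 0, ∀ δ, 0 < δ → δ ≤ ρ → ∀ z ∈ Metric.closedBall 0 ((1 - ε) * δ),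
      ∃ x ∈ Metric.closedBall (0 : EuclideanSpace ℝ (Fin k × Fin m)) δ,
        IsGoodFrame ((rot (toEuclideanLin (gapMat a d) z)).1 * blk a b 0 d) (rot x) := by
  set R := toEuclideanLin (gapMat a d) with hR
  have hRdet : LinearMap.det R ≠ 0 := by rwa [hR, det_toEuclideanLin]
  let Re := R.equivOfDetNeZero hRdet
  have hRe : ∀ x, Re x = R x := fun x => rfl
  let T₀ : EuclideanSpace ℝ (Fin k × Fin m) →ₗ[ℝ] Matrix (Fin m) (Fin k) ℝ :=
    llBlock ∘ₗ (LinearMap.mulRight ℝ (blk a b 0 d) ∘ₗ offSkew k m -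
      LinearMap.mulLeft ℝ (blk a b 0 d) ∘ₗ offSkew k m)
  have hT₀ : ∀ x, T₀ x = llBlock (offSkew k m x * blk a b 0 d - blk a b 0 d * offSkew k m x) :=
    fun x => rfl
  have hT₀' : ∀ x, T₀ x = offMat k m (R x) * a := fun x => by
    rw [hT₀, (llBlock_commutator a b d x).2, offMat_gapMat_mul ha]
  have hinj : Function.Injective T₀ := by
    intro x y h
    rw [hT₀', hT₀'] at h
    exact Re.injective (offMat_injective (mul_right_injective_of_det ha h))
  have hfr : Module.finrank ℝ (EuclideanSpace ℝ (Fin k × Fin m)) =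
      Module.finrank ℝ (Matrix (Fin m) (Fin k) ℝ) := by
    rw [finrank_euclideanSpace, Module.finrank_matrix]
    simp [mul_comm]
  let T := LinearEquiv.ofInjectiveOfFinrankEq T₀ hinj hfr
  -- With y = R z the linearized solution is z. Dividing ε by ‖R‖ + 1 makes the error at most ε δ,
  -- so z in the ball of radius (1 - ε) δ yields x in the ball of radius δ.
  obtain ⟨r, hr, hsol⟩ := exists_solution_cayley (offSkew k m) (llBlock (k := k) (m := m))
    (blk a b 0 d) (by rw [llBlock_blk]) Re.symm.toLinearMap T (fun x => hT₀ x)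
    (fun y => by
      change T₀ (Re.symm y) = _
      rw [hT₀', ← hRe, LinearEquiv.apply_symm_apply, (llBlock_commutator a b d y).1])
    (ε := ε / (‖LinearMap.toContinuousLinearMap R‖ + 1)) (by positivity)
  have hB : (sylv (ulBlock (blk a b 0 d)) (lrBlock (blk a b 0 d))).det ≠ 0 := by
    rw [ulBlock_blk, lrBlock_blk]
    exact det_sylv_ne_zero ha hK
  obtain ⟨s, hs, hgood⟩ := Metric.eventually_nhds_iff_ball.1 (eventually_det_sylv_ne_zero hB)
  set N := ‖LinearMap.toContinuousLinearMap R‖ with hN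
  have hN0 : 0 ≤ N := norm_nonneg _
  have hRn : ∀ z, ‖R z‖ ≤ N * ‖z‖ := fun z => (LinearMap.toContinuousLinearMap R).le_opNorm z
  refine ⟨min r s / (2 * (N + 1)), by positivity, fun δ hδ hδρ z hz => ?_⟩
  rw [mem_closedBall_zero_iff] at hz
  have hzδ : ‖z‖ ≤ δ := hz.trans (by nlinarith)
  rw [le_div_iff₀ (by positivity)] at hδρ
  have hRz : ‖R z‖ ≤ N * δ := (hRn z).trans (by gcongr)
  have hmr := min_le_left r s
  have hms := min_le_right r s
  have hNδ : 0 ≤ N * δ := by positivity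
  obtain ⟨x, hx, hx0⟩ := hsol (R z) (by rw [mem_closedBall_zero_iff]; nlinarith)
  have hSz : Re.symm.toLinearMap (R z) = z := Re.symm_apply_apply z
  rw [hSz] at hx
  have hxz : ‖x‖ ≤ δ := by
    have h1 : ‖x‖ ≤ ‖z‖ + ‖x - z‖ := by
      have := norm_add_le z (x - z)
      rwa [add_sub_cancel] at this
    have h2 : ε / (N + 1) * ‖R z‖ ≤ ε * δ := by
      rw [div_mul_eq_mul_div, div_le_iff₀ (by positivity)]
      nlinarith [mul_nonneg hε.le hNδ, mul_le_mul_of_nonneg_left hRz hε.le, mul_pos hε hδ]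
    linarith
  refine ⟨x, mem_closedBall_zero_iff.2 hxz, ?_, ?_⟩
  · rw [transpose_rot, ← Matrix.mul_assoc]
    exact hx0
  · refine hgood (x, R z) ?_
    rw [mem_ball_zero_iff, Prod.norm_def, max_lt_iff]
    dsimp only
    constructor <;> nlinarith

end LocalSolution

/-! ### Borel measurability of projections -/

section Measurability

/-- The condition g > 0 is a countable union of closed conditions g ≥ 1/(n + 1), so the image is a
countable union of compact sets. This makes the projections below Borel and not merely analytic. -/
theorem measurableSet_image_pos {Z Y : Type*} [TopologicalSpace Z] [TopologicalSpace Y] [T2Space Y]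
    [MeasurableSpace Y] [OpensMeasurableSpace Y] {f : Z → Y} (hf : Continuous f) {K : Set Z}
    (hK : IsCompact K) {g : Z → ℝ} (hg : Continuous g) :
    MeasurableSet (f '' {z | z ∈ K ∧ 0 < g z}) := by
  have h : f '' {z | z ∈ K ∧ 0 < g z} = ⋃ n : ℕ, f '' (K ∩ {z | 1 / ((n : ℝ) + 1) ≤ g z}) := by
    rw [← Set.image_iUnion]
    congr 1
    ext z
    simp only [Set.mem_ofPred_eq, Set.mem_iUnion, Set.mem_inter_iff]
    constructor
    · rintro ⟨h1, h2⟩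
      obtain ⟨n, hn⟩ := exists_nat_one_div_lt h2
      exact ⟨n, h1, hn.le⟩
    · rintro ⟨n, h1, h2⟩
      exact ⟨h1, lt_of_lt_of_le Nat.one_div_pos_of_nat h2⟩
  rw [h]
  exact MeasurableSet.iUnion fun n => ((hK.inter_right (isClosed_le continuous_const hg)).image
    hf).isClosed.measurableSet

open Matrix

variable {k m : ℕ}

theorem continuous_llBlock : Continuous fun M : Matrix (Fin (k + m)) (Fin (k + m)) ℝ =>
    llBlock M :=
  continuous_pi fun _ => continuous_pi fun _ => continuous_id.matrix_elem _ _

theorem measurableSet_image_isGoodFrame {Z Y : Type*} [TopologicalSpace Z] [TopologicalSpace Y]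
    [T2Space Y] [MeasurableSpace Y] [OpensMeasurableSpace Y] {f : Z → Y} (hf : Continuous f)
    {K : Set Z} (hK : IsCompact K) {M : Z → Matrix (Fin (k + m)) (Fin (k + m)) ℝ}
    (hM : Continuous M) {W : Z → orthogonalGroup (Fin (k + m)) ℝ} (hW : Continuous W) :
    MeasurableSet (f '' {z | z ∈ K ∧ IsGoodFrame (M z) (W z)}) := by
  have hW' : Continuous fun z => (W z).1 := continuous_subtype_val.comp hW
  have hN : Continuous fun z => (W z).1ᵀ * M z * (W z).1 :=
    (hW'.matrix_transpose.matrix_mul hM).matrix_mul hW'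
  have h := measurableSet_image_pos hf (hK.inter_right (isClosed_eq (continuous_llBlock.comp hN)
    (continuous_const (y := 0)))) (continuous_det_sylv.comp hN).abs
  convert h using 3
  simp only [IsGoodFrame, Set.mem_inter_iff, Set.mem_ofPred_eq, Function.comp, abs_pos,
    and_assoc]

end Measurability

/-! ### Density of rotations with a fixed plane near a given one -/

section LocalCount

open Matrix Topology Filter
open scoped Kronecker

variable {k m : ℕ}

theorem IsAsymptoticIsometry.measure_image_closedBall_ne_zero {E X : Type*} [NormedAddCommGroup E]
    [InnerProductSpace ℝ E] [FiniteDimensional ℝ E] [MeasurableSpace E] [BorelSpace E]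
    [MetricSpace X] [MeasurableSpace X] [BorelSpace X] {f : E → X} (hf : IsAsymptoticIsometry f)
    {d : ℕ} (hd : Module.finrank ℝ E = d) {δ : ℝ} (hδ : 0 < δ) :
    μHE[d] (f '' Metric.closedBall 0 δ) ≠ 0 := by
  obtain ⟨r, hr, -, -, h⟩ := hf.exists_measure_image hd (ε := 1 / 2) (by norm_num)
  have h1 := (h (Metric.closedBall 0 (min r δ)) (Metric.closedBall_subset_closedBall
    (min_le_left _ _))).1
  have h2 : μHE[d] (f '' Metric.closedBall 0 (min r δ)) ≤ μHE[d] (f '' Metric.closedBall 0 δ) :=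
    measure_mono (Set.image_mono (Metric.closedBall_subset_closedBall (min_le_right _ _)))
  refine (lt_of_lt_of_le (ENNReal.mul_pos ?_ ?_) (h1.trans h2)).ne'
  · rw [Ne, ENNReal.ofReal_eq_zero]
    norm_num
  · exact (Metric.measure_closedBall_pos volume 0 (lt_min hr hδ)).ne'

theorem orthogonalVolume_univ_ne_zero (n : ℕ) : orthogonalVolume n Set.univ ≠ 0 := fun h =>
  isAsymptoticIsometry_cayleyChart.measure_image_closedBall_ne_zero finrank_euclideanSpace_ltPair
    one_pos (measure_mono_null (Set.subset_univ _) h)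

theorem grassVolume_image_ne_zero {δ : ℝ} (hδ : 0 < δ) :
    grassVolume (k + m) k (grassChart '' Metric.closedBall 0 δ) ≠ 0 :=
  isAsymptoticIsometry_grassChart.measure_image_closedBall_ne_zero finrank_euclideanSpace_grass hδ

theorem grassVolume_univ_ne_zero : grassVolume (k + m) k Set.univ ≠ 0 := fun h =>
  grassVolume_image_ne_zero one_pos (measure_mono_null (Set.subset_univ _) h)

/-- The rotations `U` for which `U A` has a good frame in the `δ`-ball of the chart. -/
def goodRot (A : Matrix (Fin (k + m)) (Fin (k + m)) ℝ) (δ : ℝ) :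
    Set (orthogonalGroup (Fin (k + m)) ℝ) :=
  {U | ∃ x ∈ Metric.closedBall (0 : EuclideanSpace ℝ (Fin k × Fin m)) δ,
    IsGoodFrame (U.1 * A) (rot x)}

theorem measurableSet_goodRot (A : Matrix (Fin (k + m)) (Fin (k + m)) ℝ) (δ : ℝ) :
    MeasurableSet (goodRot A δ) := by
  have h := measurableSet_image_isGoodFrame (k := k) (m := m)
    (Z := EuclideanSpace ℝ (Fin k × Fin m) × orthogonalGroup (Fin (k + m)) ℝ)
    (f := Prod.snd) continuous_snd ((isCompact_closedBall 0 δ).prod isCompact_univ)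
    (M := fun p => p.2.1 * A)
    ((continuous_subtype_val.comp continuous_snd).matrix_mul continuous_const)
    (continuous_rot.comp continuous_fst)
  convert h using 1
  ext U
  simp [goodRot, and_assoc]

/-- The pairs `(g, h)` of a plane in the `R`-ball of the chart and an element of the fibre whose
product has a good frame in the `δ`-ball. -/
def nearSet (A : Matrix (Fin (k + m)) (Fin (k + m)) ℝ) (R δ : ℝ) :
    Set (Grass (k + m) k × (orthogonalGroup (Fin k) ℝ × orthogonalGroup (Fin m) ℝ)) :=
  {q | ∃ x ∈ Metric.closedBall (0 : EuclideanSpace ℝ (Fin k × Fin m)) δ,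
    ∃ y ∈ Metric.closedBall 0 R, grassChart y = q.1 ∧
      IsGoodFrame ((rot y).1 * ((blkO q.2).1 * A)) (rot x)}

theorem measurableSet_nearSet (A : Matrix (Fin (k + m)) (Fin (k + m)) ℝ) (R δ : ℝ) :
    MeasurableSet (nearSet A R δ) := by
  let Z := EuclideanSpace ℝ (Fin k × Fin m) ×
    (EuclideanSpace ℝ (Fin k × Fin m) × (orthogonalGroup (Fin k) ℝ × orthogonalGroup (Fin m) ℝ))
  have h1 : Continuous fun p : Z => p.2.1 := continuous_fst.comp continuous_snd
  have h2 : Continuous fun p : Z => p.2.2 := continuous_snd.comp continuous_snd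
  have hM : Continuous fun p : Z => (rot p.2.1).1 * ((blkO p.2.2).1 * A) :=
    (continuous_subtype_val.comp (continuous_rot.comp h1)).matrix_mul
      ((continuous_subtype_val.comp (continuous_blkO.comp h2)).matrix_mul continuous_const)
  have hf : Continuous fun p : Z => ((grassChart p.2.1 : Grass (k + m) k), p.2.2) :=
    (continuous_grassChart.comp h1).prodMk h2
  have hW : Continuous fun p : Z => (rot p.1 : orthogonalGroup (Fin (k + m)) ℝ) :=
    continuous_rot.comp continuous_fst
  have hK : IsCompact ((Metric.closedBall (0 : EuclideanSpace ℝ (Fin k × Fin m)) δ) ×ˢ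
      ((Metric.closedBall (0 : EuclideanSpace ℝ (Fin k × Fin m)) R) ×ˢ
        (Set.univ : Set (orthogonalGroup (Fin k) ℝ × orthogonalGroup (Fin m) ℝ)))) :=
    (isCompact_closedBall 0 δ).prod ((isCompact_closedBall 0 R).prod isCompact_univ)
  have h := measurableSet_image_isGoodFrame hf hK hM hW
  convert h using 1
  ext ⟨g, b⟩
  constructor
  · rintro ⟨x, hx, y, hy, hg, hgood⟩
    exact ⟨(x, y, b), ⟨⟨hx, hy, Set.mem_univ _⟩, hgood⟩, Prod.ext hg rfl⟩
  · rintro ⟨⟨x, y, b'⟩, ⟨⟨hx, hy, -⟩, hgood⟩, e⟩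
    obtain ⟨hg, rfl⟩ := Prod.ext_iff.1 e
    exact ⟨x, hx, y, hy, hg, hgood⟩

theorem ofReal_mul_le_div {c D ε q : ℝ} {N γ v : ENNReal} (hε : 0 < ε) (hD : 0 ≤ D)
    (hc : c = (1 - ε) * q / (1 + ε)) (hε1 : ε < 1) (hq : 0 ≤ q)
    (hN : ENNReal.ofReal (1 - ε) * (ENNReal.ofReal D * (ENNReal.ofReal q * v)) ≤ N)
    (hγ : γ ≤ ENNReal.ofReal (1 + ε) * v) (hγ0 : γ ≠ 0) (hγt : γ ≠ ⊤) :
    ENNReal.ofReal (c * D) ≤ N / γ := by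
  rw [ENNReal.le_div_iff_mul_le (Or.inl hγ0) (Or.inl hγt)]
  have hc0 : 0 ≤ c := by
    rw [hc]
    have : 0 ≤ 1 - ε := by linarith
    positivity
  calc ENNReal.ofReal (c * D) * γ ≤ ENNReal.ofReal (c * D) * (ENNReal.ofReal (1 + ε) * v) := by
        gcongr
    _ = ENNReal.ofReal (c * D * (1 + ε)) * v := by
        rw [← mul_assoc, ← ENNReal.ofReal_mul (by positivity)]
    _ = ENNReal.ofReal ((1 - ε) * (D * q)) * v := by
        congr 2
        rw [hc]
        field_simp
    _ = ENNReal.ofReal (1 - ε) * (ENNReal.ofReal D * (ENNReal.ofReal q * v)) := by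
        rw [ENNReal.ofReal_mul (by linarith), ENNReal.ofReal_mul hD]
        ring
    _ ≤ N := hN

/-- For fixed `h` the slice contains the chart image of L(ball of radius (1 - ε) δ), where L is the
`gapMat` of the rotated blocks. Its volume is nearly |det L| times that of the δ-ball, so the
determinant is the limiting density. A zero determinant needs no argument. -/
theorem le_liminf_nearSet {A : Matrix (Fin (k + m)) (Fin (k + m)) ℝ} (hA : llBlock A = 0)
    (ha : IsUnit (ulBlock A).det) {δ : ℕ → ℝ} (hδ0 : ∀ i, 0 < δ i) (hδ : Tendsto δ atTop (𝓝 0))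
    {R : ℝ} (hR : 0 < R) (h : orthogonalGroup (Fin k) ℝ × orthogonalGroup (Fin m) ℝ) :
    ENNReal.ofReal |(1 - (h.1.1 * ((ulBlock A)⁻¹)ᵀ) ⊗ₖ (h.2.1 * lrBlock A)).det| ≤
      liminf (fun i => grassVolume (k + m) k ((fun g => (g, h)) ⁻¹' nearSet A R (δ i)) /
        grassVolume (k + m) k (grassChart '' Metric.closedBall 0 (δ i))) atTop := by
  set a := h.1.1 * ulBlock A with ha'
  set d := h.2.1 * lrBlock A with hd'
  set b := h.1.1 * urBlock A with hb'
  have hB : (blkO h).1 * A = blk a b 0 d := by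
    conv_lhs => rw [← blk_blocks A, hA]
    change blk _ _ _ _ * blk _ _ _ _ = _
    rw [blk_mul]
    simp [a, b, d]
  have hau : IsUnit a.det := by
    rw [ha', det_mul]
    exact ((isUnit_det_of_left_inverse (orthogonalGroup_transpose_mul_self h.1))).mul ha
  have hK : 1 - (h.1.1 * ((ulBlock A)⁻¹)ᵀ) ⊗ₖ d = gapMat a d := by
    rw [gapMat, ha', Matrix.mul_inv_rev, transpose_mul,
      inv_eq_left_inv (orthogonalGroup_transpose_mul_self h.1), transpose_transpose]
  rw [hK]
  by_cases hdet : (gapMat a d).det = 0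
  · simp [hdet]
  set D := |(gapMat a d).det| with hD
  set dim := Module.finrank ℝ (EuclideanSpace ℝ (Fin k × Fin m)) with hdim
  have key : ∀ ε : ℝ, 0 < ε → ε < 1 → ENNReal.ofReal ((1 - ε) * (1 - ε) ^ dim / (1 + ε) * D) ≤
      liminf (fun i => grassVolume (k + m) k ((fun g => (g, h)) ⁻¹' nearSet A R (δ i)) /
        grassVolume (k + m) k (grassChart '' Metric.closedBall 0 (δ i))) atTop := by
    intro ε hε hε1
    obtain ⟨ρ, hρ, hgood⟩ := exists_isGoodFrame_near hau b hdet hε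
    obtain ⟨r, hr, -, -, hvol⟩ := (isAsymptoticIsometry_grassChart (k := k)
      (m := m)).exists_measure_image finrank_euclideanSpace_grass hε
    set L := toEuclideanLin (gapMat a d) with hL
    set N := ‖LinearMap.toContinuousLinearMap L‖ with hN
    have hN0 : 0 ≤ N := norm_nonneg _
    have hLn : ∀ z, ‖L z‖ ≤ N * ‖z‖ := fun z => (LinearMap.toContinuousLinearMap L).le_opNorm z
    have hs : 0 < min ρ (min r R / (N + 1)) := by positivity
    refine le_liminf_of_le (by isBoundedDefault) ?_
    filter_upwards [hδ.eventually (eventually_le_nhds hs)] with i hi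
    have hiρ : δ i ≤ ρ := hi.trans (min_le_left _ _)
    have hir : δ i * (N + 1) ≤ min r R := by
      rw [← le_div_iff₀ (by positivity)]
      exact hi.trans (min_le_right _ _)
    have hδi := hδ0 i
    have hNδ : 0 ≤ N * δ i := by positivity
    have hLz : ∀ z ∈ Metric.closedBall (0 : EuclideanSpace ℝ (Fin k × Fin m)) ((1 - ε) * δ i),
        ‖L z‖ ≤ min r R := by
      intro z hz
      rw [mem_closedBall_zero_iff] at hz
      have h1 : ‖z‖ ≤ δ i := hz.trans (by nlinarith)
      have h2 : N * ‖z‖ ≤ N * δ i := by gcongr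
      linarith [hLn z]
    have hsub : grassChart '' (L '' Metric.closedBall 0 ((1 - ε) * δ i)) ⊆
        (fun g => (g, h)) ⁻¹' nearSet A R (δ i) := by
      rintro _ ⟨_, ⟨z, hz, rfl⟩, rfl⟩
      obtain ⟨x, hx, hgx⟩ := hgood (δ i) hδi hiρ z hz
      refine ⟨x, hx, L z, mem_closedBall_zero_iff.2 ((hLz z hz).trans (min_le_right _ _)), rfl, ?_⟩
      rw [hB]
      exact hgx
    have hlow := (hvol (L '' Metric.closedBall 0 ((1 - ε) * δ i)) (by
      rintro _ ⟨z, hz, rfl⟩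
      exact mem_closedBall_zero_iff.2 ((hLz z hz).trans (min_le_left _ _)))).1
    have hup := (hvol (Metric.closedBall 0 (δ i)) (Metric.closedBall_subset_closedBall
      (le_trans (by nlinarith) (hir.trans (min_le_left _ _))))).2
    rw [Measure.addHaar_image_linearMap, hL, det_toEuclideanLin,
      Measure.addHaar_closedBall_mul volume _ (by linarith) hδi.le] at hlow
    refine ofReal_mul_le_div (v := volume (Metric.closedBall
      (0 : EuclideanSpace ℝ (Fin k × Fin m)) (δ i))) hε (abs_nonneg _) rfl hε1
      (pow_nonneg (by linarith) _) (hlow.trans (measure_mono hsub)) hup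
      (grassVolume_image_ne_zero hδi) (measure_ne_top _ _)
  have hlim : Tendsto (fun ε : ℝ => ENNReal.ofReal ((1 - ε) * (1 - ε) ^ dim / (1 + ε) * D))
      (𝓝[>] 0) (𝓝 (ENNReal.ofReal D)) := by
    have h1 : ContinuousAt (fun ε : ℝ => (1 - ε) * (1 - ε) ^ dim / (1 + ε) * D) 0 := by
      refine ContinuousAt.mul (ContinuousAt.div (by fun_prop) (by fun_prop) (by norm_num))
        continuousAt_const
    have h2 := (ENNReal.continuous_ofReal.tendsto _).comp
      (h1.tendsto.mono_left (nhdsWithin_le_nhds (s := Set.Ioi 0)))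
    have h3 : (1 - 0) * (1 - 0) ^ dim / (1 + 0) * D = D := by simp
    rw [h3] at h2
    exact h2
  refine le_of_tendsto hlim ?_
  filter_upwards [Ioo_mem_nhdsGT one_pos] with ε hε using key ε hε.1 hε.2

theorem div_le_mul_div {O G H x γ s p : ENNReal} (h : O * x ≤ G * (H * s)) (hp : G * p = O * γ)
    (hO : O ≠ 0) (hOt : O ≠ ⊤) (hG : G ≠ 0) (hGt : G ≠ ⊤) : x / γ ≤ H * (s / p) := by
  rw [← ENNReal.mul_div_mul_left x γ hO hOt, ← hp, ← mul_div_assoc,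
    ← ENNReal.mul_div_mul_left (H * s) p hG hGt]
  gcongr

theorem grassVolume_mul_measure_preimage {S : Set (Grass (k + m) k)} (hS : MeasurableSet S) :
    grassVolume (k + m) k Set.univ * orthogonalVolume (k + m) (planeOf ⁻¹' S) =
      orthogonalVolume (k + m) Set.univ * grassVolume (k + m) k S := by
  have h := lintegral_planeOf (k := k) (m := m)
    (measurable_one.indicator hS : Measurable (S.indicator (1 : Grass (k + m) k → ENNReal)))
  rw [lintegral_indicator_one hS] at h
  rw [← h, ← lintegral_indicator_one (continuous_planeOf.measurable hS)]
  rfl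

/-- Disintegrate the volume of `goodRot` along the fibres. If U = rot y * blkO b with y in the
`R`-ball, the fibre slice at U contains, up to translation by `b`, the slice of `nearSet` at the
plane of U. Elsewhere the slice of `nearSet` is empty. -/
theorem lintegral_nearSet_le (A : Matrix (Fin (k + m)) (Fin (k + m)) ℝ) {R δ : ℝ}
    (hinj : Set.InjOn (grassChart : _ → Grass (k + m) k) (Metric.closedBall 0 R)) :
    orthogonalVolume (k + m) Set.univ *
        ∫⁻ h, grassVolume (k + m) k ((fun g => (g, h)) ⁻¹' nearSet A R δ) ∂fibreVolume k m ≤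
      grassVolume (k + m) k Set.univ *
        (fibreVolume k m Set.univ * orthogonalVolume (k + m) (goodRot A δ)) := by
  have hN := measurableSet_nearSet A R δ
  have hS := measurableSet_goodRot A δ
  rw [← Measure.prod_apply_symm hN, Measure.prod_apply hN,
    ← lintegral_planeOf (measurable_measure_prodMk_left hN), ← lintegral_indicator_one hS,
    ← lintegral_mul_blkO (measurable_one.indicator hS)]
  gcongr with U
  have hm : MeasurableSet ((fun h => U * blkO h) ⁻¹' goodRot A δ) :=
    (continuous_const.mul (continuous_blkO (k := k) (m := m))).measurable hS
  have heq : ∫⁻ h, (goodRot A δ).indicator 1 (U * blkO h) ∂fibreVolume k m =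
      fibreVolume k m ((fun h => U * blkO h) ⁻¹' goodRot A δ) := by
    rw [← lintegral_indicator_one hm]
    rfl
  rw [heq]
  by_cases hU : ∃ y ∈ Metric.closedBall (0 : EuclideanSpace ℝ (Fin k × Fin m)) R,
      grassChart y = planeOf U
  · obtain ⟨y, hy, hyU⟩ := hU
    obtain ⟨b, rfl⟩ := exists_eq_mul_blkO hyU
    rw [← measure_preimage_mul (fibreVolume k m) b]
    refine measure_mono ?_
    rintro h ⟨x, hx, y', hy', e, hgood⟩
    dsimp only at e hgood
    rw [← hyU] at e
    rw [hinj hy' hy e] at hgood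
    refine ⟨x, hx, ?_⟩
    change IsGoodFrame ((rot y * blkO b * blkO h).1 * A) (rot x)
    rw [mul_assoc, ← blkO_mul, Submonoid.coe_mul, Matrix.mul_assoc]
    exact hgood
  · have hempty : Prod.mk (planeOf U : Grass (k + m) k) ⁻¹' nearSet A R δ = ∅ := by
      rw [Set.eq_empty_iff_forall_notMem]
      rintro h ⟨x, hx, y', hy', e, -⟩
      exact hU ⟨y', hy', e⟩
    rw [hempty, measure_empty]
    exact zero_le

/-- Fatou's lemma moves the fibre average of the local densities inside the limit, the determinant
average bounds it below by the fibre volume, and that volume cancels. -/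
theorem one_le_liminf_goodRot_of_llBlock {A : Matrix (Fin (k + m)) (Fin (k + m)) ℝ}
    (hA : IsUnit A.det) (hll : llBlock A = 0) {δ : ℕ → ℝ} (hδ0 : ∀ i, 0 < δ i)
    (hδ : Tendsto δ atTop (𝓝 0)) :
    1 ≤ liminf (fun i => orthogonalVolume (k + m) (goodRot A (δ i)) /
      orthogonalVolume (k + m) ((planeOf : _ → Grass (k + m) k) ⁻¹'
        (grassChart '' Metric.closedBall 0 (δ i)))) atTop := by
  have hdet : IsUnit (ulBlock A).det ∧ IsUnit (lrBlock A).det := by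
    rw [← blk_blocks A, hll, det_blk_zero] at hA
    exact IsUnit.mul_iff.1 hA
  obtain ⟨R, hR, hinj, -, -⟩ := (isAsymptoticIsometry_grassChart (k := k)
    (m := m)).exists_measure_image finrank_euclideanSpace_grass one_pos
  set H := fibreVolume k m Set.univ with hH
  have hH' : H = orthogonalVolume k Set.univ * orthogonalVolume m Set.univ := by
    rw [hH, ← Set.univ_prod_univ, Measure.prod_prod]
  have hH0 : H ≠ 0 := by
    rw [hH']
    exact mul_ne_zero (orthogonalVolume_univ_ne_zero k) (orthogonalVolume_univ_ne_zero m)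
  have hHt : H ≠ ⊤ := measure_ne_top _ _
  set s : ℕ → ENNReal := fun i => orthogonalVolume (k + m) (goodRot A (δ i)) /
      orthogonalVolume (k + m) ((planeOf : _ → Grass (k + m) k) ⁻¹'
        (grassChart '' Metric.closedBall 0 (δ i))) with hs
  have hmain : H ≤ liminf (fun i => H * s i) atTop := by
    calc H ≤ ∫⁻ h, ENNReal.ofReal
          |(1 - (h.1.1 * ((ulBlock A)⁻¹)ᵀ) ⊗ₖ (h.2.1 * lrBlock A)).det| ∂fibreVolume k m := by
          rw [hH']
          refine measure_univ_le_lintegral_abs_det _ _ _ _ ?_ hdet.2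
          rw [det_transpose]
          exact isUnit_nonsing_inv_det _ hdet.1
      _ ≤ ∫⁻ h, liminf (fun i => grassVolume (k + m) k
          ((fun g => (g, h)) ⁻¹' nearSet A R (δ i)) / grassVolume (k + m) k
            (grassChart '' Metric.closedBall 0 (δ i))) atTop ∂fibreVolume k m :=
          lintegral_mono fun h => le_liminf_nearSet hll hdet.1 hδ0 hδ hR h
      _ ≤ liminf (fun i => ∫⁻ h, grassVolume (k + m) k
          ((fun g => (g, h)) ⁻¹' nearSet A R (δ i)) / grassVolume (k + m) k
            (grassChart '' Metric.closedBall 0 (δ i)) ∂fibreVolume k m) atTop :=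
          lintegral_liminf_le fun i =>
            (measurable_measure_prodMk_right (measurableSet_nearSet A R (δ i))).div_const _
      _ ≤ _ := by
          refine liminf_le_liminf (Eventually.of_forall fun i => ?_)
          simp_rw [div_eq_mul_inv]
          rw [lintegral_mul_const _ (measurable_measure_prodMk_right
            (measurableSet_nearSet A R (δ i))), ← div_eq_mul_inv]
          have hc : IsCompact ((grassChart : _ → Grass (k + m) k) ''
            Metric.closedBall 0 (δ i)) := (isCompact_closedBall _ _).image continuous_grassChart
          exact div_le_mul_div (lintegral_nearSet_le A hinj)
            (grassVolume_mul_measure_preimage hc.isClosed.measurableSet)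
            (orthogonalVolume_univ_ne_zero _) (measure_ne_top _ _) grassVolume_univ_ne_zero
            (measure_ne_top _ _)
  calc (1 : ENNReal) = H⁻¹ * H := (ENNReal.inv_mul_cancel hH0 hHt).symm
    _ ≤ H⁻¹ * liminf (fun i => H * s i) atTop := by gcongr
    _ = liminf (fun _ : ℕ => H⁻¹) atTop * liminf (fun i => H * s i) atTop := by rw [liminf_const]
    _ ≤ liminf ((fun _ : ℕ => H⁻¹) * fun i => H * s i) atTop := ENNReal.le_liminf_mul
    _ = liminf s atTop := by
      congr 1
      ext i
      rw [Pi.mul_apply, ← mul_assoc, ENNReal.inv_mul_cancel hH0 hHt, one_mul]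

/-- Rotate the image of the coordinate plane under `A` back to the coordinate plane. -/
theorem exists_orthogonal_llBlock_eq_zero {A : Matrix (Fin (k + m)) (Fin (k + m)) ℝ}
    (hA : IsUnit A.det) : ∃ τ : orthogonalGroup (Fin (k + m)) ℝ,
      llBlock (k := k) (m := m) (τ.1 * A) = 0 := by
  have hinj : Function.Injective (toEuclideanLin A) := by
    rw [← LinearMap.ker_eq_bot, LinearMap.ker_eq_bot']
    intro x hx
    have h1 : A *ᵥ x.ofLp = 0 := congrArg WithLp.ofLp hx
    have h2 := congrArg (A⁻¹ *ᵥ ·) h1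
    simp only [mulVec_mulVec, nonsing_inv_mul _ hA, one_mulVec, mulVec_zero] at h2
    exact WithLp.ofLp_injective 2 h2
  let g₀ : Grass (k + m) k := planeOf 1
  let g : Grass (k + m) k := ⟨g₀.space.map (toEuclideanLin A), by
    rw [(Submodule.equivMapOfInjective _ hinj g₀.space).symm.finrank_eq, g₀.finrank_eq]⟩
  obtain ⟨W, hW⟩ := planeOf_surjective g
  refine ⟨W⁻¹, ?_⟩
  have hu : IsUnit ((W⁻¹).1 * A).det := by
    rw [det_mul]
    exact (isUnit_det_of_left_inverse (orthogonalGroup_transpose_mul_self W⁻¹)).mul hA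
  have h1 : (planeOf 1 : Grass (k + m) k) ∈ fixedPlanes k ((W⁻¹).1 * A) := by
    change g₀.space.map (toEuclideanLin ((W⁻¹).1 * A)) = g₀.space
    have h2 : rotGrass W⁻¹ g = g₀ := by rw [← hW, rotGrass_planeOf, inv_mul_cancel]
    have h3 := congrArg Grass.space h2
    refine Eq.trans ?_ h3
    change _ = (g₀.space.map (toEuclideanLin A)).map (toEuclideanLin (W⁻¹).1)
    rw [← Submodule.map_comp, ← toLpLin_mul_same]
  have h4 := (planeOf_mem_fixedPlanes_iff _ hu 1).1 h1
  simpa using h4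

/-- Near the plane of the first `k` coordinates, the planes fixed by `U A` are on average at least
as frequent as the planes `U g`. -/
theorem one_le_liminf_goodRot {A : Matrix (Fin (k + m)) (Fin (k + m)) ℝ}
    (hA : IsUnit A.det) {δ : ℕ → ℝ} (hδ0 : ∀ i, 0 < δ i) (hδ : Tendsto δ atTop (𝓝 0)) :
    1 ≤ liminf (fun i => orthogonalVolume (k + m) (goodRot A (δ i)) /
      orthogonalVolume (k + m) ((planeOf : _ → Grass (k + m) k) ⁻¹'
        (grassChart '' Metric.closedBall 0 (δ i)))) atTop := by
  obtain ⟨τ, hτ⟩ := exists_orthogonal_llBlock_eq_zero (k := k) (m := m) hA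
  have hu : IsUnit (τ.1 * A).det := by
    rw [det_mul]
    exact (isUnit_det_of_left_inverse (orthogonalGroup_transpose_mul_self τ)).mul hA
  have h := one_le_liminf_goodRot_of_llBlock hu hτ hδ0 hδ
  -- Replacing `A` by `τ A` translates the set of good rotations on the right, which preserves its
  -- volume.
  have heq : ∀ i, orthogonalVolume (k + m) (goodRot (k := k) (m := m) (τ.1 * A) (δ i)) =
      orthogonalVolume (k + m) (goodRot A (δ i)) := by
    intro i
    rw [← measure_preimage_mul_right (orthogonalVolume (k + m)) τ (goodRot A (δ i))]
    congr 1
    ext U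
    simp only [goodRot, Set.mem_preimage, Set.mem_ofPred_eq, Submonoid.coe_mul, Matrix.mul_assoc]
  simp_rw [heq] at h
  exact h

end LocalCount

/-! ### Double counting and the main inequality -/

section Main

open Matrix Topology Filter

variable {k m : ℕ}

theorem continuous_posLog_absDetOn (A : Matrix (Fin (k + m)) (Fin (k + m)) ℝ) :
    Continuous fun g : Grass (k + m) k => Real.posLog (absDetOn A g) :=
  Real.continuous_posLog.comp (continuous_absDetOn A)

theorem exists_posLog_absDetOn_le (A : Matrix (Fin (k + m)) (Fin (k + m)) ℝ) :
    ∃ C, ∀ g : Grass (k + m) k, Real.posLog (absDetOn A g) ≤ C := by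
  obtain ⟨C, hC⟩ := isCompact_univ.bddAbove_image (continuous_posLog_absDetOn A).continuousOn
  exact ⟨C, fun g => hC ⟨g, Set.mem_univ _, rfl⟩⟩

theorem posLog_le_supFixed (A : Matrix (Fin (k + m)) (Fin (k + m)) ℝ)
    (U : orthogonalGroup (Fin (k + m)) ℝ) {g : Grass (k + m) k}
    (hg : g ∈ fixedPlanes k (U.1 * A)) :
    Real.posLog (absDetOn A g) ≤ supFixed k (U.1 * A) := by
  obtain ⟨C, hC⟩ := exists_posLog_absDetOn_le (k := k) (m := m) (U.1 * A)
  rw [← absDetOn_orthogonal_mul A U g]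
  exact le_ciSup (f := fun g : fixedPlanes k (U.1 * A) => Real.posLog (absDetOn (U.1 * A) g.1))
    ⟨C, by rintro _ ⟨g, rfl⟩; exact hC _⟩ ⟨g, hg⟩

theorem supFixed_nonneg {n : ℕ} (M : Matrix (Fin n) (Fin n) ℝ) : 0 ≤ supFixed k M :=
  Real.iSup_nonneg fun _ => Real.posLog_nonneg

/-- Nonnegativity of `c` is essential: when no plane is fixed the supremum is 0, which must not
exceed `c`. -/
theorem lt_supFixed_iff (A : Matrix (Fin (k + m)) (Fin (k + m)) ℝ)
    (U : orthogonalGroup (Fin (k + m)) ℝ) {c : ℝ} (hc : 0 ≤ c) :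
    c < supFixed k (U.1 * A) ↔
      ∃ g : Grass (k + m) k, g ∈ fixedPlanes k (U.1 * A) ∧ c < Real.posLog (absDetOn A g) := by
  constructor
  · intro h
    by_contra! hcon
    refine h.not_ge (Real.iSup_le (fun g => ?_) hc)
    rw [absDetOn_orthogonal_mul]
    exact hcon g.1 g.2
  · rintro ⟨g, hg, h⟩
    exact h.trans_le (posLog_le_supFixed A U hg)

theorem isUnit_det_orthogonal_mul {A : Matrix (Fin (k + m)) (Fin (k + m)) ℝ} (hA : IsUnit A.det)
    (U : orthogonalGroup (Fin (k + m)) ℝ) : IsUnit (U.1 * A).det := by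
  rw [det_mul]
  exact (isUnit_det_of_left_inverse (orthogonalGroup_transpose_mul_self U)).mul hA

theorem measurable_supFixed {A : Matrix (Fin (k + m)) (Fin (k + m)) ℝ} (hA : IsUnit A.det) :
    Measurable fun U : orthogonalGroup (Fin (k + m)) ℝ => supFixed k (U.1 * A) := by
  refine measurable_of_Ioi fun c => ?_
  rcases lt_or_ge c 0 with hc | hc
  · convert MeasurableSet.univ
    ext U
    simpa using hc.trans_le (supFixed_nonneg _)
  let Z := orthogonalGroup (Fin (k + m)) ℝ × orthogonalGroup (Fin (k + m)) ℝ
  have h1 : Continuous fun p : Z => p.1.1 := continuous_subtype_val.comp continuous_fst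
  have h2 : Continuous fun p : Z => p.2.1 := continuous_subtype_val.comp continuous_snd
  have hN : Continuous fun p : Z => p.2.1ᵀ * (p.1.1 * A) * p.2.1 :=
    (h2.matrix_transpose.matrix_mul (h1.matrix_mul continuous_const)).matrix_mul h2
  have hK : IsClosed {p : Z | llBlock (k := k) (m := m) (p.2.1ᵀ * (p.1.1 * A) * p.2.1) = 0} :=
    isClosed_eq (continuous_llBlock.comp hN) continuous_const
  have hg : Continuous fun p : Z =>
      Real.posLog (absDetOn A (planeOf p.2 : Grass (k + m) k)) - c :=
    ((continuous_posLog_absDetOn A).comp (continuous_planeOf.comp continuous_snd)).sub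
      continuous_const
  have h := measurableSet_image_pos (f := fun p : Z => p.1) continuous_fst hK.isCompact hg
  convert h using 1
  ext U
  rw [Set.mem_preimage, Set.mem_Ioi, lt_supFixed_iff A U hc]
  constructor
  · rintro ⟨g, hg, hlt⟩
    obtain ⟨W, rfl⟩ := planeOf_surjective g
    exact ⟨(U, W), ⟨(planeOf_mem_fixedPlanes_iff _ (isUnit_det_orthogonal_mul hA U) W).1 hg,
      sub_pos.2 hlt⟩, rfl⟩
  · rintro ⟨⟨U', W⟩, ⟨hW, hlt⟩, rfl⟩
    exact ⟨planeOf W, (planeOf_mem_fixedPlanes_iff _ (isUnit_det_orthogonal_mul hA U') W).2 hW,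
      sub_pos.1 hlt⟩

theorem integrable_supFixed {A : Matrix (Fin (k + m)) (Fin (k + m)) ℝ} (hA : IsUnit A.det) :
    Integrable (fun U : orthogonalGroup (Fin (k + m)) ℝ => supFixed k (U.1 * A))
      (orthogonalVolume (k + m)) := by
  obtain ⟨C, hC⟩ := exists_posLog_absDetOn_le (k := k) (m := m) A
  refine Integrable.of_bound (measurable_supFixed hA).aestronglyMeasurable C
    (Eventually.of_forall fun U => ?_)
  rw [Real.norm_of_nonneg (supFixed_nonneg _)]
  refine Real.iSup_le (fun g => ?_) (Real.posLog_nonneg.trans (hC (planeOf 1)))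
  rw [absDetOn_orthogonal_mul]
  exact hC _

theorem integrable_posLog_absDetOn (A : Matrix (Fin (k + m)) (Fin (k + m)) ℝ) :
    Integrable (fun g : Grass (k + m) k => Real.posLog (absDetOn A g)) (grassVolume (k + m) k) := by
  obtain ⟨C, hC⟩ := exists_posLog_absDetOn_le (k := k) (m := m) A
  refine Integrable.of_bound (continuous_posLog_absDetOn A).measurable.aestronglyMeasurable C
    (Eventually.of_forall fun g => ?_)
  rw [Real.norm_of_nonneg Real.posLog_nonneg]
  exact hC g

/-- The pairs `(U, V)` for which `U A` has a good frame in the `δ`-ball of the chart at `V`. -/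
def goodPairs (A : Matrix (Fin (k + m)) (Fin (k + m)) ℝ) (δ : ℝ) :
    Set (orthogonalGroup (Fin (k + m)) ℝ × orthogonalGroup (Fin (k + m)) ℝ) :=
  {p | ∃ x ∈ Metric.closedBall (0 : EuclideanSpace ℝ (Fin k × Fin m)) δ,
    IsGoodFrame (p.1.1 * A) (p.2 * rot x)}

theorem measurableSet_goodPairs (A : Matrix (Fin (k + m)) (Fin (k + m)) ℝ) (δ : ℝ) :
    MeasurableSet (goodPairs A δ) := by
  let Z := EuclideanSpace ℝ (Fin k × Fin m) ×
    (orthogonalGroup (Fin (k + m)) ℝ × orthogonalGroup (Fin (k + m)) ℝ)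
  have h1 : Continuous fun p : Z => p.2.1.1 :=
    continuous_subtype_val.comp (continuous_fst.comp continuous_snd)
  have h2 : Continuous fun p : Z => p.2.2 := continuous_snd.comp continuous_snd
  have hW : Continuous fun p : Z => p.2.2 * rot p.1 :=
    h2.mul (continuous_rot.comp continuous_fst)
  have hK : IsCompact ((Metric.closedBall (0 : EuclideanSpace ℝ (Fin k × Fin m)) δ) ×ˢ
      (Set.univ : Set (orthogonalGroup (Fin (k + m)) ℝ × orthogonalGroup (Fin (k + m)) ℝ))) :=
    (isCompact_closedBall 0 δ).prod isCompact_univ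
  have h := measurableSet_image_isGoodFrame (f := fun p : Z => p.2) continuous_snd hK
    (h1.matrix_mul (continuous_const (y := A))) hW
  convert h using 1
  ext p
  constructor
  · rintro ⟨x, hx, hgood⟩
    exact ⟨(x, p), ⟨⟨hx, Set.mem_univ _⟩, hgood⟩, rfl⟩
  · rintro ⟨⟨x, p'⟩, ⟨⟨hx, -⟩, hgood⟩, rfl⟩
    exact ⟨x, hx, hgood⟩

/-- Conjugating by `V` moves the frame back to the identity and replaces U A by (V⁻¹ U)(A V); left
invariance absorbs V⁻¹. -/
theorem measure_goodPairs_slice (A : Matrix (Fin (k + m)) (Fin (k + m)) ℝ) (δ : ℝ)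
    (V : orthogonalGroup (Fin (k + m)) ℝ) :
    orthogonalVolume (k + m) ((fun U => (U, V)) ⁻¹' goodPairs (k := k) (m := m) A δ) =
      orthogonalVolume (k + m) (goodRot (k := k) (m := m) (A * V.1) δ) := by
  rw [← measure_preimage_mul (orthogonalVolume (k + m)) V⁻¹ (goodRot (A * V.1) δ)]
  congr 1
  ext U
  simp only [goodPairs, goodRot, Set.mem_preimage, Set.mem_ofPred_eq, isGoodFrame_mul_iff,
    Submonoid.coe_mul, orthogonalGroup_coe_inv, Matrix.mul_assoc]

/-- Inversion and right translation preserve the volume, so the base plane does not matter. Each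
fixed plane is therefore met by the same volume of V. -/
theorem measure_rotGrass_inv_mem (S : Set (Grass (k + m) k)) (g : Grass (k + m) k) :
    orthogonalVolume (k + m) {V | rotGrass V⁻¹ g ∈ S} =
      orthogonalVolume (k + m) (planeOf ⁻¹' S) := by
  obtain ⟨W, rfl⟩ := planeOf_surjective g
  have h1 : {V : orthogonalGroup (Fin (k + m)) ℝ | rotGrass V⁻¹ (planeOf W) ∈ S} =
      ((fun V => V * W) ⁻¹' (planeOf ⁻¹' S))⁻¹ := by
    ext V
    simp [rotGrass_planeOf]
  rw [h1, Measure.measure_inv, measure_preimage_mul_right]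

/-- Uniform continuity on the compact Grassmannian; the radius is independent of V because V acts by
isometries. -/
theorem exists_posLog_sub_le (A : Matrix (Fin (k + m)) (Fin (k + m)) ℝ) {ε : ℝ} (hε : 0 < ε) :
    ∃ η > 0, ∀ x ∈ Metric.closedBall (0 : EuclideanSpace ℝ (Fin k × Fin m)) η,
      ∀ V : orthogonalGroup (Fin (k + m)) ℝ,
        Real.posLog (absDetOn A (planeOf V : Grass (k + m) k)) - ε ≤
          Real.posLog (absDetOn A (planeOf (V * rot x) : Grass (k + m) k)) := by
  have hu := CompactSpace.uniformContinuous_of_continuous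
    (continuous_posLog_absDetOn (k := k) (m := m) A)
  obtain ⟨θ, hθ, hφ⟩ := Metric.uniformContinuous_iff.1 hu ε hε
  obtain ⟨η, hη, hx⟩ := Metric.continuousAt_iff.1
    ((continuous_grassChart (k := k) (m := m)).continuousAt (x := 0)) θ hθ
  refine ⟨η / 2, half_pos hη, fun x hxη V => ?_⟩
  have h1 : dist (planeOf V : Grass (k + m) k) (planeOf (V * rot x)) < θ := by
    have h2 : (planeOf V : Grass (k + m) k) = rotGrass V (grassChart 0) := by
      rw [grassChart, rotGrass_planeOf, rot_zero, mul_one]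
    rw [h2, ← rotGrass_planeOf, dist_rotGrass, dist_comm]
    exact hx (lt_of_le_of_lt (Metric.mem_closedBall.1 hxη) (half_lt_self hη))
  have h3 := hφ h1
  rw [Real.dist_eq] at h3
  linarith [(abs_lt.1 h3).2]

/-- A good pair (U, V) puts one of the finitely many nondegenerate fixed planes g of U A into the
δ-ball at V. There the weight at V is at most the value at g, hence at most the supremum. Summing
over g bounds the integral by the number of planes times one common volume. -/
theorem lintegral_goodPairs_le {A : Matrix (Fin (k + m)) (Fin (k + m)) ℝ} (hA : IsUnit A.det)
    {ε δ : ℝ} (hunif : ∀ x ∈ Metric.closedBall (0 : EuclideanSpace ℝ (Fin k × Fin m)) δ,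
      ∀ V : orthogonalGroup (Fin (k + m)) ℝ,
        Real.posLog (absDetOn A (planeOf V : Grass (k + m) k)) - ε ≤
          Real.posLog (absDetOn A (planeOf (V * rot x) : Grass (k + m) k)))
    (U : orthogonalGroup (Fin (k + m)) ℝ) :
    ∫⁻ V, (goodPairs A δ).indicator (fun p => ENNReal.ofReal
        (Real.posLog (absDetOn A (planeOf p.2 : Grass (k + m) k)) - ε)) (U, V)
        ∂orthogonalVolume (k + m) ≤
      ((k + m).choose k * ENNReal.ofReal (supFixed k (U.1 * A))) *
        orthogonalVolume (k + m) ((planeOf : _ → Grass (k + m) k) ⁻¹'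
          (grassChart '' Metric.closedBall 0 δ)) := by
  classical
  obtain ⟨hfin, hcard⟩ := goodPlanes_finite_ncard_le (k := k) (m := m) (U.1 * A)
  have hc : IsCompact ((grassChart : _ → Grass (k + m) k) '' Metric.closedBall 0 δ) :=
    (isCompact_closedBall _ _).image continuous_grassChart
  set Γ := (grassChart : _ → Grass (k + m) k) '' Metric.closedBall 0 δ with hΓ
  set F := hfin.toFinset with hF
  have hmeas : ∀ g : Grass (k + m) k, MeasurableSet {V | rotGrass V⁻¹ g ∈ Γ} := fun g =>
    (continuous_rotGrass.comp (continuous_inv.prodMk continuous_const)).measurable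
      hc.isClosed.measurableSet
  calc _ ≤ ∫⁻ V, ∑ g ∈ F, {V | rotGrass V⁻¹ g ∈ Γ}.indicator
          (fun _ => ENNReal.ofReal (supFixed k (U.1 * A))) V ∂orthogonalVolume (k + m) := by
        refine lintegral_mono fun V => ?_
        by_cases hV : (U, V) ∈ goodPairs A δ
        · rw [Set.indicator_of_mem hV]
          obtain ⟨x, hx, hgood⟩ := hV
          dsimp only at hgood
          have hg : (planeOf (V * rot x) : Grass (k + m) k) ∈ goodPlanes (U.1 * A) :=
            ⟨_, rfl, hgood⟩
          refine le_trans ?_ (Finset.single_le_sum (f := fun g : Grass (k + m) k =>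
            {V | rotGrass V⁻¹ g ∈ Γ}.indicator
              (fun _ => ENNReal.ofReal (supFixed k (U.1 * A))) V)
            (fun _ _ => zero_le) (hfin.mem_toFinset.2 hg))
          rw [Set.indicator_of_mem]
          · exact ENNReal.ofReal_le_ofReal ((hunif x hx V).trans (posLog_le_supFixed A U
              (goodPlanes_subset_fixedPlanes _ (isUnit_det_orthogonal_mul hA U) hg)))
          · change rotGrass V⁻¹ (planeOf (V * rot x)) ∈ Γ
            rw [rotGrass_planeOf, inv_mul_cancel_left]
            exact ⟨x, hx, rfl⟩
        · rw [Set.indicator_of_notMem hV]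
          exact zero_le
    _ = F.card * (ENNReal.ofReal (supFixed k (U.1 * A)) *
          orthogonalVolume (k + m) ((planeOf : _ → Grass (k + m) k) ⁻¹' Γ)) := by
        rw [lintegral_finsetSum _ fun g _ => measurable_const.indicator (hmeas g)]
        simp_rw [fun g => lintegral_indicator_const (hmeas g) (μ := orthogonalVolume (k + m))
          (ENNReal.ofReal (supFixed k (U.1 * A))),
          measure_rotGrass_inv_mem]
        rw [Finset.sum_const, nsmul_eq_mul]
    _ ≤ _ := by
        rw [← mul_assoc]
        gcongr
        rwa [hF, ← Set.ncard_eq_toFinset_card _ hfin]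

/-- Count weighted good pairs in both orders and divide by the volume of the δ-ball preimage.
Integration over U first has limiting density at least 1 for each V; integration over V first gives
the binomial bound for each δ. Fatou's lemma joins the two. -/
theorem lintegral_sub_le {A : Matrix (Fin (k + m)) (Fin (k + m)) ℝ} (hA : IsUnit A.det)
    {ε : ℝ} (hε : 0 < ε) :
    ∫⁻ V, ENNReal.ofReal (Real.posLog (absDetOn A (planeOf V : Grass (k + m) k)) - ε)
        ∂orthogonalVolume (k + m) ≤
      (k + m).choose k * ∫⁻ U, ENNReal.ofReal (supFixed k (U.1 * A))
        ∂orthogonalVolume (k + m) := by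
  obtain ⟨η, hη, hunif⟩ := exists_posLog_sub_le (k := k) (m := m) A hε
  let δ : ℕ → ℝ := fun i => η * (1 / ((i : ℝ) + 1))
  have hδ0 : ∀ i, 0 < δ i := fun i => mul_pos hη Nat.one_div_pos_of_nat
  have hδη : ∀ i, δ i ≤ η := fun i => by
    refine mul_le_of_le_one_right hη.le ?_
    rw [div_le_one (by positivity)]
    have : (0 : ℝ) ≤ i := Nat.cast_nonneg i
    linarith
  have hδ : Tendsto δ atTop (𝓝 0) := by
    have h := (tendsto_one_div_add_atTop_nhds_zero_nat (𝕜 := ℝ)).const_mul η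
    rwa [mul_zero] at h
  let c : orthogonalGroup (Fin (k + m)) ℝ → ENNReal := fun V =>
    ENNReal.ofReal (Real.posLog (absDetOn A (planeOf V : Grass (k + m) k)) - ε)
  have hcm : Measurable c := (ENNReal.continuous_ofReal.comp
    (((continuous_posLog_absDetOn A).comp continuous_planeOf).sub continuous_const)).measurable
  let p : ℕ → ENNReal := fun i => orthogonalVolume (k + m) ((planeOf : _ → Grass (k + m) k) ⁻¹'
    (grassChart '' Metric.closedBall 0 (δ i)))
  let s : ℕ → orthogonalGroup (Fin (k + m)) ℝ → ENNReal := fun i V =>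
    orthogonalVolume (k + m) (goodRot (k := k) (m := m) (A * V.1) (δ i))
  have hsm : ∀ i, Measurable (s i) := fun i => by
    simp only [s, ← measure_goodPairs_slice]
    exact measurable_measure_prodMk_right (measurableSet_goodPairs A (δ i))
  have hstep : ∀ i, ∫⁻ V, c V * s i V ∂orthogonalVolume (k + m) ≤
      ((k + m).choose k * ∫⁻ U, ENNReal.ofReal (supFixed k (U.1 * A))
        ∂orthogonalVolume (k + m)) * p i := by
    intro i
    have hG := measurableSet_goodPairs (k := k) (m := m) A (δ i)
    have hind : Measurable ((goodPairs (k := k) (m := m) A (δ i)).indicator fun p => c p.2) :=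
      (hcm.comp measurable_snd).indicator hG
    calc ∫⁻ V, c V * s i V ∂orthogonalVolume (k + m)
        = ∫⁻ V, ∫⁻ U, (goodPairs (k := k) (m := m) A (δ i)).indicator (fun p => c p.2) (U, V)
            ∂orthogonalVolume (k + m) ∂orthogonalVolume (k + m) := by
          refine lintegral_congr fun V => ?_
          have hV : MeasurableSet ((fun U => (U, V)) ⁻¹' goodPairs (k := k) (m := m) A (δ i)) :=
            measurable_prodMk_right hG
          simp only [s, ← measure_goodPairs_slice]
          rw [← lintegral_indicator_const hV]
          rfl
      _ = ∫⁻ U, ∫⁻ V, (goodPairs (k := k) (m := m) A (δ i)).indicator (fun p => c p.2) (U, V)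
            ∂orthogonalVolume (k + m) ∂orthogonalVolume (k + m) :=
          (lintegral_lintegral_swap (f := fun U V =>
            (goodPairs (k := k) (m := m) A (δ i)).indicator (fun p => c p.2) (U, V))
            hind.aemeasurable).symm
      _ ≤ ∫⁻ U, ((k + m).choose k * ENNReal.ofReal (supFixed k (U.1 * A))) * p i
            ∂orthogonalVolume (k + m) :=
          lintegral_mono fun U => lintegral_goodPairs_le hA (fun x hx => hunif x
            (Metric.closedBall_subset_closedBall (hδη i) hx)) U
      _ = _ := by
          rw [lintegral_mul_const _ ((measurable_supFixed hA).ennreal_ofReal.const_mul _),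
            lintegral_const_mul _ (measurable_supFixed hA).ennreal_ofReal]
  have hone : ∀ V, c V ≤ liminf (fun i => c V * (s i V / p i)) atTop := by
    intro V
    have hAV : IsUnit (A * V.1).det := by
      rw [det_mul]
      exact hA.mul (isUnit_det_of_left_inverse (orthogonalGroup_transpose_mul_self V))
    have h := one_le_liminf_goodRot (k := k) (m := m) hAV hδ0 hδ
    calc c V = c V * 1 := (mul_one _).symm
      _ ≤ c V * liminf (fun i => s i V / p i) atTop := by gcongr
      _ = liminf (fun _ : ℕ => c V) atTop * liminf (fun i => s i V / p i) atTop := by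
          rw [liminf_const]
      _ ≤ _ := ENNReal.le_liminf_mul
  calc ∫⁻ V, c V ∂orthogonalVolume (k + m)
      ≤ ∫⁻ V, liminf (fun i => c V * (s i V / p i)) atTop ∂orthogonalVolume (k + m) :=
        lintegral_mono hone
    _ ≤ liminf (fun i => ∫⁻ V, c V * (s i V / p i) ∂orthogonalVolume (k + m)) atTop :=
        lintegral_liminf_le fun i => hcm.mul ((hsm i).div_const _)
    _ ≤ liminf (fun _ : ℕ => (k + m).choose k * ∫⁻ U, ENNReal.ofReal (supFixed k (U.1 * A))
        ∂orthogonalVolume (k + m)) atTop := by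
        refine liminf_le_liminf (Eventually.of_forall fun i => ?_)
        simp_rw [← mul_div_assoc, div_eq_mul_inv]
        rw [lintegral_mul_const (f := fun V => c V * s i V) _ (hcm.mul (hsm i)), ← div_eq_mul_inv]
        exact ENNReal.div_le_of_le_mul (hstep i)
    _ = _ := liminf_const _

theorem lintegral_posLog_planeOf_le {A : Matrix (Fin (k + m)) (Fin (k + m)) ℝ}
    (hA : IsUnit A.det) :
    ∫⁻ V, ENNReal.ofReal (Real.posLog (absDetOn A (planeOf V : Grass (k + m) k)))
        ∂orthogonalVolume (k + m) ≤
      (k + m).choose k * ∫⁻ U, ENNReal.ofReal (supFixed k (U.1 * A))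
        ∂orthogonalVolume (k + m) := by
  have key : ∀ ε : ℝ, 0 < ε →
      ∫⁻ V, ENNReal.ofReal (Real.posLog (absDetOn A (planeOf V : Grass (k + m) k)))
        ∂orthogonalVolume (k + m) ≤
      ((k + m).choose k * ∫⁻ U, ENNReal.ofReal (supFixed k (U.1 * A))
        ∂orthogonalVolume (k + m)) +
        ENNReal.ofReal ε * orthogonalVolume (k + m) Set.univ := by
    intro ε hε
    calc _ ≤ ∫⁻ V, (ENNReal.ofReal
          (Real.posLog (absDetOn A (planeOf V : Grass (k + m) k)) - ε) + ENNReal.ofReal ε)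
          ∂orthogonalVolume (k + m) := by
          refine lintegral_mono fun V => ?_
          refine le_trans (ENNReal.ofReal_le_ofReal (by linarith)) ENNReal.ofReal_add_le
      _ ≤ _ := by
          rw [lintegral_add_right _ measurable_const, lintegral_const]
          gcongr
          exact lintegral_sub_le hA hε
  have hlim : Tendsto (fun ε : ℝ => ((k + m).choose k *
      ∫⁻ U : orthogonalGroup (Fin (k + m)) ℝ, ENNReal.ofReal (supFixed k (U.1 * A))
        ∂orthogonalVolume (k + m)) +
        ENNReal.ofReal ε * orthogonalVolume (k + m) Set.univ) (𝓝[>] 0)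
      (𝓝 (((k + m).choose k *
      ∫⁻ U : orthogonalGroup (Fin (k + m)) ℝ, ENNReal.ofReal (supFixed k (U.1 * A))
        ∂orthogonalVolume (k + m)) + 0 * orthogonalVolume (k + m) Set.univ)) := by
    refine tendsto_const_nhds.add (ENNReal.Tendsto.mul_const ?_ (Or.inr (measure_ne_top _ _)))
    have := (ENNReal.continuous_ofReal.tendsto 0).mono_left (nhdsWithin_le_nhds (s := Set.Ioi 0))
    simpa using this
  rw [zero_mul, add_zero] at hlim
  exact ge_of_tendsto hlim (eventually_of_mem self_mem_nhdsWithin fun ε hε => key ε hε)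

theorem cConst_mul_integral_le {A : Matrix (Fin (k + m)) (Fin (k + m)) ℝ} (hA : IsUnit A.det) :
    cConst (k + m) k * ∫ g : Grass (k + m) k, Real.posLog (absDetOn A g) ∂grassVolume (k + m) k ≤
      ∫ U : orthogonalGroup (Fin (k + m)) ℝ, supFixed k (U.1 * A) ∂orthogonalVolume (k + m) := by
  have h := (fibreVolume_mul_lintegral_le (k := k) (m := m)
    (continuous_posLog_absDetOn A).measurable.ennreal_ofReal).trans
    (lintegral_posLog_planeOf_le hA)
  rw [← Set.univ_prod_univ, Measure.prod_prod,
    ← ofReal_integral_eq_lintegral_ofReal (integrable_posLog_absDetOn A)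
      (Eventually.of_forall fun _ => Real.posLog_nonneg),
    ← ofReal_integral_eq_lintegral_ofReal (integrable_supFixed hA)
      (Eventually.of_forall fun _ => supFixed_nonneg _)] at h
  have h1 := ENNReal.toReal_mono (ENNReal.mul_ne_top (ENNReal.natCast_ne_top _)
    ENNReal.ofReal_ne_top) h
  rw [ENNReal.toReal_mul, ENNReal.toReal_mul, ENNReal.toReal_mul, ENNReal.toReal_natCast,
    ENNReal.toReal_ofReal (integral_nonneg fun _ => Real.posLog_nonneg),
    ENNReal.toReal_ofReal (integral_nonneg fun _ => supFixed_nonneg _)] at h1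
  rw [cConst, Nat.add_sub_cancel_left, div_mul_eq_mul_div, div_le_iff₀ (by
    exact_mod_cast Nat.choose_pos (Nat.le_add_right k m)), mul_comm (∫ U, _ ∂_)]
  exact h1

end Main

end

theorem theorem2 (n k : ℕ) (hk : k ≤ n) (A : GL (Fin n) ℝ) :
    Integrable (fun U : Matrix.orthogonalGroup (Fin n) ℝ =>
        supFixed k ((U : Matrix (Fin n) (Fin n) ℝ) * (A : Matrix (Fin n) (Fin n) ℝ))) (orthogonalVolume n) ∧
      Integrable (fun g : Grass n k => Real.posLog (absDetOn (A : Matrix (Fin n) (Fin n) ℝ) g))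
        (grassVolume n k) ∧
      cConst n k *
          ∫ g : Grass n k, Real.posLog (absDetOn (A : Matrix (Fin n) (Fin n) ℝ) g)
            ∂(grassVolume n k) ≤
        ∫ U : Matrix.orthogonalGroup (Fin n) ℝ,
          supFixed k ((U : Matrix (Fin n) (Fin n) ℝ) * (A : Matrix (Fin n) (Fin n) ℝ)) ∂(orthogonalVolume n) := by
  -- Writing n = k + m makes the block decomposition available without casts.
  obtain ⟨m, rfl⟩ := Nat.exists_eq_add_of_le hk
  have hA : IsUnit A.1.det := (Matrix.isUnit_iff_isUnit_det _).1 A.isUnit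
  exact ⟨integrable_supFixed hA, integrable_posLog_absDetOn _, cConst_mul_integral_le hA⟩
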